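/- Let $N\ge 2$ and let $b:[-1,1]\to\mathbb{R}$ be Lipschitz, non-decreasing and convex on $(-1,1)$, with $0<b_m\le b\le b_M<\infty$ on $[-1,1]$. For $\alpha\in(0,1)$ the inelastic hard-sphere collision operator $Q_\alpha$ is defined by its action on test functions $\psi$, $$\int_{\mathbb{R}^N} Q_\alpha(g,f)\,\psi\,dv=\int_{\mathbb{R}^N}\int_{\mathbb{R}^N}\int_{\mathbb{S}^{N-1}} b(\hat u\cdot\sigma)\,|u|\,g(v_*)\,f(v)\,\big(\psi(v')-\psi(v)\big)\,d\sigma\,dv\,dv_*,$$ where $u=v-v_*$, $\hat u=u/|u|$ and $v'=\frac{v+v_*}{2}+\frac12\left(\frac{1-\alpha}{2}\,u+\frac{1+\alpha}{2}\,|u|\,\sigma\right)$. Let $\|f\|_{L^1_3}=\int_{\mathbb{R}^N}|f(v)|\,(1+|v|^2)^{3/2}\,dv$. **Proposition D.1.** Let $\rho,C,t_1\in(0,\infty)$. There is a constant $a_1\in(0,\infty)$, depending only on $N,b,\rho,C,t_1$ (in particular neither on $T$ nor on $\alpha$), such that the following holds. Let $\alpha\in(0,1)$, $T>t_1$, and let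 $0\le g\in C([0,\infty);L^1_3)$, with mass $\int_{\mathbb{R}^N} g(0,v)\,dv=\rho$, be a solution (in the sense of distributions, that is, tested against $\psi\in C_c^\infty(\mathbb{R}^N)$ and integrated in time from the datum $g(0,\cdot)$) of $$\partial_t g=Q_\alpha(g,g)+\tau_\alpha\,\Delta_v g,\qquad \tau_\alpha=\rho\,(1-\alpha),$$ such that $\|g(t,\cdot)\|_{L^2}\le C$ and $\|g(t,\cdot)\|_{L^1_3}\le C$ for all $t\in[0,T]$. Then for every $t\in[t_1,T]$ $$g(t,v)\ \ge\ a_1^{-1}\,e^{-a_1|v|^8}$$ for almost every $v\in\mathbb{R}^N$, and for every $v\in\mathbb{R}^N$ at which $g(t,\cdot)$ is continuous. -/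

import Mathlib

open MeasureTheory Filter Set
open scoped Topology ENNReal ContDiff InnerProductSpace

namespace InelasticBoltzmann

noncomputable section

/-- The velocity space `ℝᴺ` with its Euclidean norm. -/
abbrev Vel (N : ℕ) : Type := EuclideanSpace ℝ (Fin N)

/-- The unit sphere `𝕊ᴺ⁻¹` of the velocity space. -/
abbrev Sph (N : ℕ) : Type := Metric.sphere (0 : Vel N) 1

/-- The surface measure on the unit sphere. -/
abbrev surf (N : ℕ) : Measure (Sph N) := (volume : Measure (Vel N)).toSphere

/-- `⟨v⟩ = √(1 + |v|²)`. -/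
def bracket {N : ℕ} (v : Vel N) : ℝ := Real.sqrt (1 + ‖v‖ ^ 2)

/-- Membership in the weighted Lebesgue space `L^p_q`: the function `⟨v⟩^q f` is in `L^p`. -/
def MemWeightedLp {N : ℕ} (p : ℝ≥0∞) (q : ℝ) (f : Vel N → ℝ) : Prop :=
  MemLp (fun v => bracket v ^ q * f v) p volume

/-- The norm of `L^p_q`, that is `(∫ |f|^p ⟨v⟩^{pq} dv)^{1/p}` for finite `p`,
with values in `[0, ∞]`. -/
def weightedNorm {N : ℕ} (p : ℝ≥0∞) (q : ℝ) (f : Vel N → ℝ) : ℝ≥0∞ :=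
  eLpNorm (fun v => bracket v ^ q * f v) p volume

/-- The assumptions on the angular cross-section: `b` is Lipschitz, non-decreasing and convex on
`(-1, 1)`, and bounded above and below by positive constants on `[-1, 1]`. -/
structure IsCrossSection (b : ℝ → ℝ) : Prop where
  lipschitz : ∃ K : NNReal, LipschitzOnWith K b (Ioo (-1) 1)
  monotone : MonotoneOn b (Ioo (-1) 1)
  convex : ConvexOn ℝ (Ioo (-1) 1) b
  bounds : ∃ bm bM : ℝ, 0 < bm ∧ 0 < bM ∧ ∀ x ∈ Icc (-1 : ℝ) 1, bm ≤ b x ∧ b x ≤ bM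

/-- The velocity `v'` of the first particle after an inelastic collision of two particles with
velocities `v`, `vs`, with restitution coefficient `α` and angular parameter `σ`:
`v' = w/2 + u'/2`, `w = v + vs`, `u = v - vs`, `u' = (1-α)/2 u + (1+α)/2 |u| σ`. -/
def postVel {N : ℕ} (α : ℝ) (v vs σ : Vel N) : Vel N :=
  (1 / 2 : ℝ) • (v + vs) +
    (1 / 2 : ℝ) • (((1 - α) / 2) • (v - vs) + ((1 + α) / 2 * ‖v - vs‖) • σ)

/-- The collision operator `Q_α(g, f)`, acting on a test function `ψ`:
`∫∫∫ b(û · σ) |u| g(vs) f(v) (ψ(v') - ψ(v)) dσ dv dvs`, with `u = v - vs` and `û = u / |u|`. -/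
def collisionWeak {N : ℕ} (α : ℝ) (b : ℝ → ℝ) (g f ψ : Vel N → ℝ) : ℝ :=
  ∫ p : Vel N × Vel N × Sph N,
    b (inner ℝ (‖p.1 - p.2.1‖⁻¹ • (p.1 - p.2.1)) (p.2.2 : Vel N)) * ‖p.1 - p.2.1‖ *
      g p.2.1 * f p.1 * (ψ (postVel α p.1 p.2.1 (p.2.2 : Vel N)) - ψ p.1)
    ∂((volume : Measure (Vel N)).prod ((volume : Measure (Vel N)).prod (surf N)))

/-- `g ∈ C([0, ∞); L^1_3)` is a non-negative solution of mass `ρ` of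
`∂_t g = Q_α(g, g) + τ_α Δ g` with `τ_α = ρ (1 - α)`, in the sense of distributions. -/
structure IsSolution {N : ℕ} (α ρ : ℝ) (b : ℝ → ℝ) (g : ℝ → Vel N → ℝ) : Prop where
  nonneg : ∀ t, 0 ≤ t → ∀ᵐ v, 0 ≤ g t v
  mem : ∀ t, 0 ≤ t → MemWeightedLp 1 3 (g t)
  continuous : ∀ t, 0 ≤ t →
    Tendsto (fun s => weightedNorm 1 3 (fun v => g s v - g t v)) (𝓝[Ici 0] t) (𝓝 0)
  mass : ∫ v, g 0 v = ρ
  equation : ∀ ψ : Vel N → ℝ, ContDiff ℝ ∞ ψ → HasCompactSupport ψ → ∀ t, 0 ≤ t →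
    ∫ v, g t v * ψ v = (∫ v, g 0 v * ψ v) +
      ∫ s in (0 : ℝ)..t,
        (collisionWeak α b (g s) (g s) ψ + ρ * (1 - α) * ∫ v, g s v * Laplacian.laplacian ψ v)

end

end InelasticBoltzmann

/-!
The lower bound is obtained by duality with explicit test functions; no representation formula
for the solution is used.

A convex function of the heat kernel is a subsolution of the heat equation. With the convex function
`phi`, which vanishes on the negative half-line, this gives the compactly supported profile `prof`
(`profT_le_deriv2`), and products of such profiles over the coordinates of an orthonormal basis give
the test functions `kern`. Tested against `kern`, run backwards in time, the diffusion contributes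
with a favourable sign, uniformly in `α`, and the loss term costs at most the factor
`exp (-rate * time)`, since the support is bounded. What remains is Duhamel's inequality
`Bounded.kern_duhamel`: the mass seen by the kernel at the final time is at least the mass seen at
the initial time plus the integrated gain term. The widths of the kernel at the final time are free.
Letting all of them tend to zero gives a pointwise bound (`ae_le_of_kern`), letting only one of them
tend to zero gives a bound on the mass near a hyperplane (`le_slab_of_kern`).

The velocity `v'` runs over the sphere with centre `(1 - κ) v + κ w` and radius `κ |v - w|`, where
`κ = (1 + α) / 4` lies in `[1/4, 1/2]`; this range makes all geometric constants uniform in `α`. For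
given `v ≠ y`, the collision of `v` and `w` can produce `y` exactly if `w` lies on the hyperplane
`⟨n, w - v⟩ = |y - v| / (2 κ)`, with `n` the direction of `y - v`. Two mechanisms follow.

* Collisions between two lumps of mass charge every slab around a hyperplane that cuts the resulting
  spheres well inside (`exists_slab_lower`).
* Collisions of a lump of mass near `v` with mass charging all slabs around these hyperplanes give a
  pointwise lower bound at `y` (`exists_point_lower`).

Mass conservation, the second moment and the `L²` bound provide two separate lumps
(`exists_lumps`), which persist for a short time. Applying the two mechanisms one after the other
yields a uniform lower bound on a ball (`exists_first_ball`). Given such a bound `δ` on a ball of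
radius `r`, the second mechanism yields a bound of order `δ²` on the concentric ball of radius
`√(6/5) r` (`exists_spread`), for a loss which is controlled by taking time steps of length `2⁻ⁿ`:
after `n` steps the bound is of order `E ^ 2 ^ n` on a ball of radius `√(6/5) ^ n r`
(`exists_spread_iterate`). As `√(6/5) ^ 8 > 2`, at the point `v` this is at least
`exp (-a (1 + |v|⁸))`. At a point of continuity the almost everywhere bound holds because a set of
full measure is dense.
-/

open MeasureTheory Filter Set
open scoped Topology ENNReal ContDiff InnerProductSpace

namespace InelasticBoltzmann

noncomputable section

/-! ### Weights and the collision kernel -/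

instance instSFiniteProdSurf (N : ℕ) : SFinite ((volume : Measure (Vel N)).prod (surf N)) :=
  Measure.prod.instSFinite

/-- The weight `1 + |v|²`. Every integrability statement about the collision operator follows
from that of `(1 + |v|²) g`. -/
def wt {N : ℕ} (v : Vel N) : ℝ := 1 + ‖v‖ ^ 2

lemma one_le_wt {N : ℕ} (v : Vel N) : 1 ≤ wt v := by
  unfold wt; nlinarith [sq_nonneg ‖v‖]

lemma wt_pos {N : ℕ} (v : Vel N) : 0 < wt v := lt_of_lt_of_le one_pos (one_le_wt v)

lemma continuous_wt {N : ℕ} : Continuous (wt : Vel N → ℝ) := by unfold wt; fun_prop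

lemma norm_le_wt {N : ℕ} (v : Vel N) : ‖v‖ ≤ wt v := by
  unfold wt; nlinarith [sq_nonneg (‖v‖ - 1)]

lemma norm_sub_le_wt_mul {N : ℕ} (v w : Vel N) : ‖v - w‖ ≤ wt v * wt w := by
  have h := norm_sub_le v w
  unfold wt
  nlinarith [sq_nonneg (‖v‖ - 1 / 2), sq_nonneg (‖w‖ - 1 / 2),
    mul_nonneg (sq_nonneg ‖v‖) (sq_nonneg ‖w‖)]

lemma norm_sub_sq_le_wt_mul {N : ℕ} (v w : Vel N) : ‖v - w‖ ^ 2 ≤ 2 * (wt v * wt w) := by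
  have h := norm_sub_le v w
  have : ‖v - w‖ ^ 2 ≤ (‖v‖ + ‖w‖) ^ 2 := by gcongr
  unfold wt
  nlinarith [sq_nonneg (‖v‖ - ‖w‖), mul_nonneg (sq_nonneg ‖v‖) (sq_nonneg ‖w‖)]

/-- Integrability against the weight `1 + |v|²`. -/
def WInt {N : ℕ} (f : Vel N → ℝ) : Prop := Integrable (fun v => wt v * f v)

lemma WInt.aestronglyMeasurable {N : ℕ} {f : Vel N → ℝ} (hf : WInt f) :
    AEStronglyMeasurable f volume := by
  have h1 : AEStronglyMeasurable (fun v : Vel N => (wt v)⁻¹ * (wt v * f v)) volume :=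
    (continuous_wt.inv₀ (fun v => (wt_pos v).ne')).aestronglyMeasurable.mul hf.1
  refine h1.congr (Eventually.of_forall fun v => ?_)
  have := (wt_pos v).ne'
  field_simp

lemma WInt.integrable {N : ℕ} {f : Vel N → ℝ} (hf : WInt f) : Integrable f := by
  refine Integrable.mono hf hf.aestronglyMeasurable (Eventually.of_forall fun v => ?_)
  rw [norm_mul]
  have := one_le_wt v
  rw [Real.norm_of_nonneg (wt_pos v).le]
  nlinarith [norm_nonneg (f v)]

lemma WInt.sub {N : ℕ} {f g : Vel N → ℝ} (hf : WInt f) (hg : WInt g) :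
    WInt (fun v => f v - g v) := by
  have := Integrable.sub hf hg
  refine this.congr (Eventually.of_forall fun v => ?_)
  simp only [Pi.sub_apply]; ring

lemma WInt.integrable_mul {N : ℕ} {f ψ : Vel N → ℝ} (hf : WInt f) {M : ℝ}
    (hψ : AEStronglyMeasurable ψ volume) (hM : ∀ v, |ψ v| ≤ M) :
    Integrable (fun v => f v * ψ v) := by
  have := hf.integrable.bdd_mul hψ (Eventually.of_forall hM)
  exact this.congr (Eventually.of_forall fun v => by ring)

/-- The collision kernel `b(û · σ) |u|` as a function of `(v, vs, σ)`. -/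
def cker {N : ℕ} (b : ℝ → ℝ) (p : Vel N × Vel N × Sph N) : ℝ :=
  b (inner ℝ (‖p.1 - p.2.1‖⁻¹ • (p.1 - p.2.1)) (p.2.2 : Vel N)) * ‖p.1 - p.2.1‖

lemma inner_unit_mem_Icc {N : ℕ} (u : Vel N) (σ : Sph N) :
    inner ℝ (‖u‖⁻¹ • u) (σ : Vel N) ∈ Icc (-1 : ℝ) 1 := by
  have h1 : ‖(σ : Vel N)‖ = 1 := by simp
  have h2 : ‖‖u‖⁻¹ • u‖ ≤ 1 := by
    rw [norm_smul, norm_inv, norm_norm]; exact inv_mul_le_one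
  have h3 := abs_real_inner_le_norm (‖u‖⁻¹ • u) (σ : Vel N)
  rw [h1, mul_one] at h3
  exact abs_le.1 (h3.trans h2)

lemma measurable_cker {N : ℕ} {b : ℝ → ℝ} (hb : IsCrossSection b) :
    Measurable (cker b : Vel N × Vel N × Sph N → ℝ) := by
  classical
  obtain ⟨K, hK⟩ := hb.lipschitz
  set b₁ : ℝ → ℝ := (Ioo (-1 : ℝ) 1).piecewise b (fun _ => 0) with hb₁
  have m₁ : Measurable b₁ :=
    hK.continuousOn.measurable_piecewise continuousOn_const measurableSet_Ioo
  set b₂ : ℝ → ℝ := fun x => if x = 1 then b 1 else if x = -1 then b (-1) else b₁ x with hb₂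
  have m₂ : Measurable b₂ :=
    Measurable.ite (measurableSet_singleton _) measurable_const
      (Measurable.ite (measurableSet_singleton _) measurable_const m₁)
  have e : ∀ x ∈ Icc (-1 : ℝ) 1, b x = b₂ x := by
    intro x hx
    simp only [hb₂, hb₁]
    split_ifs with h1 h2
    · rw [h1]
    · rw [h2]
    · rw [Set.piecewise_eq_of_mem]
      exact ⟨lt_of_le_of_ne hx.1 (Ne.symm h2), lt_of_le_of_ne hx.2 h1⟩
  have : (cker b : Vel N × Vel N × Sph N → ℝ) = fun p =>
      b₂ (inner ℝ (‖p.1 - p.2.1‖⁻¹ • (p.1 - p.2.1)) (p.2.2 : Vel N)) * ‖p.1 - p.2.1‖ := by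
    funext p
    simp only [cker]
    rw [e _ (inner_unit_mem_Icc _ _)]
  rw [this]
  have hu : Measurable (fun p : Vel N × Vel N × Sph N => p.1 - p.2.1) :=
    (by fun_prop : Continuous _).measurable
  have hσ : Measurable (fun p : Vel N × Vel N × Sph N => (p.2.2 : Vel N)) :=
    (by fun_prop : Continuous _).measurable
  exact (m₂.comp ((hu.norm.inv.smul hu).inner hσ)).mul hu.norm

lemma cker_le {N : ℕ} {b : ℝ → ℝ} {bM : ℝ} (hM : ∀ x ∈ Icc (-1 : ℝ) 1, b x ≤ bM)
    (p : Vel N × Vel N × Sph N) : cker b p ≤ bM * ‖p.1 - p.2.1‖ :=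
  mul_le_mul_of_nonneg_right (hM _ (inner_unit_mem_Icc _ _)) (norm_nonneg _)

lemma le_cker {N : ℕ} {b : ℝ → ℝ} {bm : ℝ} (hm : ∀ x ∈ Icc (-1 : ℝ) 1, bm ≤ b x)
    (p : Vel N × Vel N × Sph N) : bm * ‖p.1 - p.2.1‖ ≤ cker b p :=
  mul_le_mul_of_nonneg_right (hm _ (inner_unit_mem_Icc _ _)) (norm_nonneg _)

/-- The measure `dv dvs dσ` of the collision integral. -/
abbrev cmeas (N : ℕ) : Measure (Vel N × Vel N × Sph N) :=
  (volume : Measure (Vel N)).prod ((volume : Measure (Vel N)).prod (surf N))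

/-- The cross-section together with its bounds `0 < bm ≤ b ≤ bM`. -/
structure CrossBounds (b : ℝ → ℝ) (bm bM : ℝ) : Prop where
  cross : IsCrossSection b
  pos : 0 < bm
  posM : 0 < bM
  lower : ∀ x ∈ Icc (-1 : ℝ) 1, bm ≤ b x
  upper : ∀ x ∈ Icc (-1 : ℝ) 1, b x ≤ bM

lemma CrossBounds.cker_nonneg {N : ℕ} {b : ℝ → ℝ} {bm bM : ℝ} (hb : CrossBounds b bm bM)
    (p : Vel N × Vel N × Sph N) : 0 ≤ cker b p :=
  (mul_nonneg hb.pos.le (norm_nonneg _)).trans (le_cker hb.lower p)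

/-- The product `(1+|v|²)|f(v)| (1+|vs|²)|g(vs)|` dominates every collision integrand. -/
lemma integrable_dominant {N : ℕ} {g f : Vel N → ℝ} (hg : WInt g) (hf : WInt f) (A : ℝ) :
    Integrable (fun p : Vel N × Vel N × Sph N =>
      A * (|wt p.1 * f p.1| * (|wt p.2.1 * g p.2.1| * 1))) (cmeas N) :=
  (hf.abs.mul_prod (hg.abs.mul_prod (integrable_const (1 : ℝ)))).const_mul A

lemma integral_dominant {N : ℕ} (g f : Vel N → ℝ) (A : ℝ) :
    ∫ p : Vel N × Vel N × Sph N,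
      A * (|wt p.1 * f p.1| * (|wt p.2.1 * g p.2.1| * 1)) ∂(cmeas N) =
    A * ((∫ v, |wt v * f v|) * ((∫ v, |wt v * g v|) * (surf N).real univ)) := by
  rw [integral_const_mul]
  congr 1
  rw [integral_prod_mul (fun v : Vel N => |wt v * f v|)
    (fun q : Vel N × Sph N => |wt q.1 * g q.1| * 1)]
  rw [integral_prod_mul (fun v : Vel N => |wt v * g v|) (fun _ : Sph N => (1 : ℝ))]
  simp

lemma aestronglyMeasurable_collision {N : ℕ} {b : ℝ → ℝ} (hb : IsCrossSection b)
    {g f : Vel N → ℝ} (hg : WInt g) (hf : WInt f) {Ψ : Vel N × Vel N × Sph N → ℝ}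
    (hΨ : Measurable Ψ) :
    AEStronglyMeasurable (fun p : Vel N × Vel N × Sph N =>
      cker b p * g p.2.1 * f p.1 * Ψ p) (cmeas N) := by
  have h1 : AEStronglyMeasurable (fun p : Vel N × Vel N × Sph N => f p.1) (cmeas N) :=
    hf.aestronglyMeasurable.comp_fst
  have h2 : AEStronglyMeasurable (fun p : Vel N × Vel N × Sph N => g p.2.1) (cmeas N) :=
    (hg.aestronglyMeasurable.comp_fst (ν := surf N)).comp_snd
      (f := fun q : Vel N × Sph N => g q.1)
  exact (((measurable_cker hb).aestronglyMeasurable.mul h2).mul h1).mul hΨ.aestronglyMeasurable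

lemma collision_integrand_le {N : ℕ} {b : ℝ → ℝ} {bm bM : ℝ} (hb : CrossBounds b bm bM)
    (g f : Vel N → ℝ) {Ψ : Vel N × Vel N × Sph N → ℝ} {M : ℝ}
    (hM : ∀ p, |Ψ p| ≤ M) (p : Vel N × Vel N × Sph N) :
    |cker b p * g p.2.1 * f p.1 * Ψ p| ≤
      (bM * M) * (|wt p.1 * f p.1| * (|wt p.2.1 * g p.2.1| * 1)) := by
  have h0 := hb.cker_nonneg p
  have h1 : cker b p ≤ bM * (wt p.1 * wt p.2.1) :=
    (cker_le hb.upper p).trans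
      (mul_le_mul_of_nonneg_left (norm_sub_le_wt_mul _ _) hb.posM.le)
  have h2 : 0 ≤ bM * (wt p.1 * wt p.2.1) := h0.trans h1
  rw [abs_mul, abs_mul, abs_mul, abs_of_nonneg h0, abs_mul, abs_mul, abs_of_pos (wt_pos p.1),
    abs_of_pos (wt_pos p.2.1)]
  calc cker b p * |g p.2.1| * |f p.1| * |Ψ p|
      ≤ (bM * (wt p.1 * wt p.2.1)) * |g p.2.1| * |f p.1| * M := by
        gcongr
        exact hM p
    _ = _ := by ring

lemma integrable_collision {N : ℕ} {b : ℝ → ℝ} {bm bM : ℝ} (hb : CrossBounds b bm bM)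
    {g f : Vel N → ℝ} (hg : WInt g) (hf : WInt f) {Ψ : Vel N × Vel N × Sph N → ℝ} {M : ℝ}
    (hΨ : Measurable Ψ) (hM : ∀ p, |Ψ p| ≤ M) :
    Integrable (fun p : Vel N × Vel N × Sph N => cker b p * g p.2.1 * f p.1 * Ψ p) (cmeas N) :=
  (integrable_dominant hg hf (bM * M)).mono'
    (aestronglyMeasurable_collision hb.cross hg hf hΨ)
    (Eventually.of_forall fun p => collision_integrand_le hb g f hM p)

lemma abs_integral_collision_le {N : ℕ} {b : ℝ → ℝ} {bm bM : ℝ} (hb : CrossBounds b bm bM)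
    {g f : Vel N → ℝ} (hg : WInt g) (hf : WInt f) {Ψ : Vel N × Vel N × Sph N → ℝ} {M : ℝ}
    (hM : ∀ p, |Ψ p| ≤ M) :
    |∫ p, cker b p * g p.2.1 * f p.1 * Ψ p ∂(cmeas N)| ≤
      (bM * M) * ((∫ v, |wt v * f v|) * ((∫ v, |wt v * g v|) * (surf N).real univ)) := by
  rw [← integral_dominant]
  exact norm_integral_le_of_norm_le (f := fun p => cker b p * g p.2.1 * f p.1 * Ψ p)
    (integrable_dominant hg hf (bM * M))
    (Eventually.of_forall fun p => collision_integrand_le hb g f hM p)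

lemma continuous_postVel {N : ℕ} (α : ℝ) :
    Continuous (fun p : Vel N × Vel N × Sph N => postVel α p.1 p.2.1 (p.2.2 : Vel N)) := by
  unfold postVel; fun_prop

/-- The gain part of the collision operator, tested against `ψ`. -/
def gain {N : ℕ} (α : ℝ) (b : ℝ → ℝ) (g ψ : Vel N → ℝ) : ℝ :=
  ∫ p, cker b p * g p.2.1 * g p.1 * ψ (postVel α p.1 p.2.1 (p.2.2 : Vel N)) ∂(cmeas N)

lemma collisionWeak_eq {N : ℕ} (α : ℝ) (b : ℝ → ℝ) (g f ψ : Vel N → ℝ) :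
    collisionWeak α b g f ψ =
      ∫ p, cker b p * g p.2.1 * f p.1 *
        (ψ (postVel α p.1 p.2.1 (p.2.2 : Vel N)) - ψ p.1) ∂(cmeas N) := rfl

lemma measurable_increment {N : ℕ} (α : ℝ) {ψ : Vel N → ℝ} (hψ : Continuous ψ) :
    Measurable (fun p : Vel N × Vel N × Sph N =>
      ψ (postVel α p.1 p.2.1 (p.2.2 : Vel N)) - ψ p.1) :=
  ((hψ.comp (continuous_postVel α)).sub (hψ.comp continuous_fst)).measurable

lemma abs_increment_le {N : ℕ} (α : ℝ) {ψ : Vel N → ℝ} {M : ℝ} (hM : ∀ v, |ψ v| ≤ M)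
    (p : Vel N × Vel N × Sph N) :
    |ψ (postVel α p.1 p.2.1 (p.2.2 : Vel N)) - ψ p.1| ≤ 2 * M := by
  have := abs_sub (ψ (postVel α p.1 p.2.1 (p.2.2 : Vel N))) (ψ p.1)
  linarith [hM (postVel α p.1 p.2.1 (p.2.2 : Vel N)), hM p.1]

/-- `Q` is quadratic, hence continuous in the weighted `L¹` space. -/
lemma abs_collisionWeak_sub_le {N : ℕ} {α : ℝ} {b : ℝ → ℝ} {bm bM : ℝ} (hb : CrossBounds b bm bM)
    {g f : Vel N → ℝ} (hg : WInt g) (hf : WInt f) {ψ : Vel N → ℝ} {M : ℝ} (hψ : Continuous ψ)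
    (hM : ∀ v, |ψ v| ≤ M) :
    |collisionWeak α b g g ψ - collisionWeak α b f f ψ| ≤
      (bM * (2 * M)) * (surf N).real univ *
        ((∫ v, |wt v * (g v - f v)|) * ((∫ v, |wt v * g v|) + ∫ v, |wt v * f v|)) := by
  have hd := hg.sub hf
  have e : collisionWeak α b g g ψ - collisionWeak α b f f ψ =
      collisionWeak α b (fun v => g v - f v) g ψ + collisionWeak α b f (fun v => g v - f v) ψ := by
    simp only [collisionWeak_eq]
    have i := fun (g f : Vel N → ℝ) (hg : WInt g) (hf : WInt f) =>
      integrable_collision hb hg hf (measurable_increment α hψ) (abs_increment_le α hM)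
    rw [← integral_sub (i g g hg hg) (i f f hf hf), ← integral_add (i _ g hd hg) (i f _ hf hd)]
    congr 1; funext p; ring
  rw [e]
  refine (abs_add_le _ _).trans ?_
  have h1 := abs_integral_collision_le hb hd hg
    (Ψ := fun p => ψ (postVel α p.1 p.2.1 (p.2.2 : Vel N)) - ψ p.1) (abs_increment_le α hM)
  have h2 := abs_integral_collision_le hb hf hd
    (Ψ := fun p => ψ (postVel α p.1 p.2.1 (p.2.2 : Vel N)) - ψ p.1) (abs_increment_le α hM)
  simp only [collisionWeak_eq]
  refine (add_le_add h1 h2).trans (le_of_eq ?_)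
  ring

/-- The loss term is bounded by a multiple of `∫ g ψ` if `ψ` is supported in a ball. -/
lemma gain_sub_le_collisionWeak {N : ℕ} {α : ℝ} {b : ℝ → ℝ} {bm bM : ℝ}
    (hb : CrossBounds b bm bM) {g : Vel N → ℝ} (hg : WInt g) (h0 : ∀ᵐ v, 0 ≤ g v)
    {C : ℝ} (hC : ∫ v, |wt v * g v| ≤ C) {ψ : Vel N → ℝ} {M R : ℝ} (hψ : Continuous ψ)
    (hψ0 : ∀ v, 0 ≤ ψ v) (hM : ∀ v, |ψ v| ≤ M) (hR : 0 ≤ R) (hs : ∀ v, R < ‖v‖ → ψ v = 0) :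
    gain α b g ψ - bM * (surf N).real univ * (1 + R) * C * ∫ v, g v * ψ v ≤
      collisionWeak α b g g ψ := by
  have m1 : Measurable (fun p : Vel N × Vel N × Sph N =>
      ψ (postVel α p.1 p.2.1 (p.2.2 : Vel N))) := (hψ.comp (continuous_postVel α)).measurable
  have m2 : Measurable (fun p : Vel N × Vel N × Sph N => ψ p.1) :=
    (hψ.comp continuous_fst).measurable
  have i1 := integrable_collision hb hg hg m1 (fun p => hM _)
  have i2 := integrable_collision hb hg hg m2 (fun p => hM _)
  have e : collisionWeak α b g g ψ = gain α b g ψ -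
      ∫ p, cker b p * g p.2.1 * g p.1 * ψ p.1 ∂(cmeas N) := by
    rw [collisionWeak_eq, gain, ← integral_sub i1 i2]
    congr 1; funext p; ring
  have hgψ : Integrable (fun v => g v * ψ v) := hg.integrable_mul hψ.aestronglyMeasurable hM
  have hI0 : 0 ≤ ∫ v, g v * ψ v := integral_nonneg_of_ae (by
    filter_upwards [h0] with v hv using mul_nonneg hv (hψ0 v))
  have i3 : Integrable (fun p : Vel N × Vel N × Sph N =>
      (bM * (1 + R)) * (|g p.1 * ψ p.1| * (|wt p.2.1 * g p.2.1| * 1))) (cmeas N) :=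
    (hgψ.abs.mul_prod (hg.abs.mul_prod (integrable_const (1 : ℝ)))).const_mul _
  have key : ∫ p, cker b p * g p.2.1 * g p.1 * ψ p.1 ∂(cmeas N) ≤
      bM * (surf N).real univ * (1 + R) * C * ∫ v, g v * ψ v := by
    calc ∫ p, cker b p * g p.2.1 * g p.1 * ψ p.1 ∂(cmeas N)
        ≤ ∫ p : Vel N × Vel N × Sph N,
          (bM * (1 + R)) * (|g p.1 * ψ p.1| * (|wt p.2.1 * g p.2.1| * 1)) ∂(cmeas N) := by
          refine integral_mono i2 i3 (fun p => ?_)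
          refine (le_abs_self _).trans ?_
          simp only
          by_cases hp : R < ‖p.1‖
          · simp [hs _ hp]
          push Not at hp
          have hk : cker b p ≤ bM * ((1 + R) * wt p.2.1) := by
            refine (cker_le hb.upper p).trans (mul_le_mul_of_nonneg_left ?_ hb.posM.le)
            have := norm_sub_le p.1 p.2.1
            have := norm_le_wt p.2.1
            have := one_le_wt p.2.1
            nlinarith
          rw [abs_mul, abs_mul, abs_mul, abs_of_nonneg (hb.cker_nonneg p), abs_mul, abs_mul,
            abs_of_pos (wt_pos p.2.1)]
          calc cker b p * |g p.2.1| * |g p.1| * |ψ p.1|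
              ≤ (bM * ((1 + R) * wt p.2.1)) * |g p.2.1| * |g p.1| * |ψ p.1| := by gcongr
            _ = _ := by ring
      _ = (bM * (1 + R)) * ((∫ v, |g v * ψ v|) *
            ((∫ v, |wt v * g v|) * (surf N).real univ)) := by
          rw [integral_const_mul]
          congr 1
          rw [integral_prod_mul (fun v : Vel N => |g v * ψ v|)
            (fun q : Vel N × Sph N => |wt q.1 * g q.1| * 1)]
          rw [integral_prod_mul (fun v : Vel N => |wt v * g v|) (fun _ : Sph N => (1 : ℝ))]
          simp
      _ = (bM * (1 + R)) * ((∫ v, g v * ψ v) *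
            ((∫ v, |wt v * g v|) * (surf N).real univ)) := by
          congr 2
          refine integral_congr_ae ?_
          filter_upwards [h0] with v hv using abs_of_nonneg (mul_nonneg hv (hψ0 v))
      _ ≤ (bM * (1 + R)) * ((∫ v, g v * ψ v) * (C * (surf N).real univ)) := by
          have := hb.posM
          gcongr
      _ = _ := by ring
  rw [e]; linarith

/-- A lower bound for the gain term: pairs of velocities `v ∈ S₁`, `w ∈ S₂ v` of which a
sufficient proportion of the post-collisional velocities is seen by `ψ`. -/
lemma le_gain {N : ℕ} {α : ℝ} {b : ℝ → ℝ} {bm bM : ℝ}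
    (hb : CrossBounds b bm bM) {g : Vel N → ℝ} (hg : WInt g) (h0 : ∀ᵐ v, 0 ≤ g v)
    {ψ : Vel N → ℝ} {M : ℝ} (hψ : Continuous ψ) (hψ0 : ∀ v, 0 ≤ ψ v) (hM : ∀ v, |ψ v| ≤ M)
    {S₁ : Set (Vel N)} {S₂ : Vel N → Set (Vel N)} (hS₁ : MeasurableSet S₁)
    (hS₂ : ∀ v ∈ S₁, MeasurableSet (S₂ v)) {κ₀ m₁ m₂ : ℝ} (hκ : 0 ≤ κ₀) (hm₂ : 0 ≤ m₂)
    (h1 : m₁ ≤ ∫ v in S₁, g v) (h2 : ∀ v ∈ S₁, m₂ ≤ ∫ w in S₂ v, g w)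
    (hk : ∀ v ∈ S₁, ∀ w ∈ S₂ v,
      κ₀ ≤ ‖v - w‖ * ∫ σ : Sph N, ψ (postVel α v w (σ : Vel N)) ∂(surf N)) :
    bm * κ₀ * m₁ * m₂ ≤ gain α b g ψ := by
  have m1 : Measurable (fun p : Vel N × Vel N × Sph N =>
      ψ (postVel α p.1 p.2.1 (p.2.2 : Vel N))) := (hψ.comp (continuous_postVel α)).measurable
  have i1 := integrable_collision hb hg hg m1 (fun p => hM _)
  have hpos : ∀ v w, 0 ≤ g v → 0 ≤ g w → ∀ σ : Sph N,
      0 ≤ cker b (v, w, σ) * g w * g v * ψ (postVel α v w (σ : Vel N)) := fun v w hv hw σ =>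
    mul_nonneg (mul_nonneg (mul_nonneg (hb.cker_nonneg _) hw) hv) (hψ0 _)
  have hb0 := hb.pos
  rw [gain, integral_prod _ i1]
  -- the integral over `σ`
  have hσ : ∀ v ∈ S₁, ∀ w ∈ S₂ v, 0 ≤ g v → 0 ≤ g w → bm * κ₀ * g v * g w ≤
      ∫ σ : Sph N, cker b (v, w, σ) * g w * g v * ψ (postVel α v w (σ : Vel N)) ∂(surf N) := by
    intro v hv w hw hgv hgw
    have hc : Continuous (fun σ : Sph N => ψ (postVel α v w (σ : Vel N))) :=
      (hψ.comp (continuous_postVel α)).comp (by fun_prop : Continuous fun σ : Sph N => (v, w, σ))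
    have hi : Integrable (fun σ : Sph N => ψ (postVel α v w (σ : Vel N))) (surf N) :=
      Integrable.of_bound hc.aestronglyMeasurable M (Eventually.of_forall fun σ => hM _)
    have hi2 : Integrable (fun σ : Sph N =>
        cker b (v, w, σ) * g w * g v * ψ (postVel α v w (σ : Vel N))) (surf N) := by
      refine Integrable.of_bound (C := (bM * ‖v - w‖) * g w * g v * M) ?_
        (Eventually.of_forall fun σ => ?_)
      · have : Measurable (fun σ : Sph N => cker b (v, w, σ)) :=
          (measurable_cker hb.cross).comp (by fun_prop)
        exact (((this.mul_const _).mul_const _).mul hc.measurable).aestronglyMeasurable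
      · rw [Real.norm_of_nonneg (hpos v w hgv hgw σ)]
        have := cker_le hb.upper (v, w, σ)
        have h3 := hb.cker_nonneg (v, w, σ)
        have h4 := (le_abs_self _).trans (hM (postVel α v w (σ : Vel N)))
        have h5 := hψ0 (postVel α v w (σ : Vel N))
        have h6 : 0 ≤ bM * ‖v - w‖ * g w * g v := by have := hb.posM; positivity
        simp only at this
        gcongr
    calc bm * κ₀ * g v * g w
        ≤ bm * (‖v - w‖ * ∫ σ : Sph N, ψ (postVel α v w (σ : Vel N)) ∂(surf N)) * g v * g w := by
          gcongr; exact hk v hv w hw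
      _ = ∫ σ : Sph N, (bm * ‖v - w‖) * g w * g v * ψ (postVel α v w (σ : Vel N)) ∂(surf N) := by
          rw [integral_const_mul]; ring
      _ ≤ _ := by
          refine integral_mono (hi.const_mul _) hi2 (fun σ => ?_)
          have := le_cker hb.lower (v, w, σ)
          have h5 := hψ0 (postVel α v w (σ : Vel N))
          simp only at this ⊢
          gcongr
  -- the integral over `w`
  have hw : ∀ᵐ v, v ∈ S₁ → bm * κ₀ * m₂ * g v ≤
      ∫ q : Vel N × Sph N, cker b (v, q.1, q.2) * g q.1 * g v *
        ψ (postVel α v q.1 (q.2 : Vel N)) ∂(volume.prod (surf N)) := by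
    filter_upwards [h0, i1.prod_right_ae] with v hgv hiv hv
    rw [integral_prod _ hiv]
    have hiw := hiv.integral_prod_left
    have hnn : 0 ≤ᵐ[volume] fun w => ∫ σ : Sph N,
        cker b (v, w, σ) * g w * g v * ψ (postVel α v w (σ : Vel N)) ∂(surf N) := by
      filter_upwards [h0] with w hgw using integral_nonneg (hpos v w hgv hgw)
    calc bm * κ₀ * m₂ * g v ≤ bm * κ₀ * g v * ∫ w in S₂ v, g w := by
          have : bm * κ₀ * m₂ * g v = bm * κ₀ * g v * m₂ := by ring
          rw [this]
          exact mul_le_mul_of_nonneg_left (h2 v hv) (by positivity)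
      _ = ∫ w in S₂ v, bm * κ₀ * g v * g w := by rw [integral_const_mul]
      _ ≤ ∫ w in S₂ v, ∫ σ : Sph N,
            cker b (v, w, σ) * g w * g v * ψ (postVel α v w (σ : Vel N)) ∂(surf N) := by
          refine setIntegral_mono_on_ae (hg.integrable.integrableOn.const_mul _)
            hiw.integrableOn (hS₂ v hv) ?_
          filter_upwards [h0] with w hgw hw using hσ v hv w hw hgv hgw
      _ ≤ _ := setIntegral_le_integral hiw hnn
  have hout := i1.integral_prod_left
  have hnn : 0 ≤ᵐ[volume] fun v => ∫ q : Vel N × Sph N, cker b (v, q.1, q.2) * g q.1 * g v *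
        ψ (postVel α v q.1 (q.2 : Vel N)) ∂(volume.prod (surf N)) := by
    filter_upwards [h0] with v hgv
    refine integral_nonneg_of_ae ?_
    have : ∀ᵐ q : Vel N × Sph N ∂(volume.prod (surf N)), 0 ≤ g q.1 :=
      Measure.quasiMeasurePreserving_fst.ae h0
    filter_upwards [this] with q hq using hpos v q.1 hgv hq q.2
  calc bm * κ₀ * m₁ * m₂ ≤ bm * κ₀ * m₂ * ∫ v in S₁, g v := by
        have : bm * κ₀ * m₁ * m₂ = bm * κ₀ * m₂ * m₁ := by ring
        rw [this]
        exact mul_le_mul_of_nonneg_left h1 (by positivity)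
    _ = ∫ v in S₁, bm * κ₀ * m₂ * g v := by rw [integral_const_mul]
    _ ≤ ∫ v in S₁, ∫ q : Vel N × Sph N, cker b (v, q.1, q.2) * g q.1 * g v *
        ψ (postVel α v q.1 (q.2 : Vel N)) ∂(volume.prod (surf N)) :=
        setIntegral_mono_on_ae (hg.integrable.integrableOn.const_mul _) hout.integrableOn hS₁ hw
    _ ≤ _ := setIntegral_le_integral hout hnn

/-! ### Solutions tested against time-dependent functions -/

lemma one_le_bracket {N : ℕ} (v : Vel N) : 1 ≤ bracket v := by
  unfold bracket; exact Real.one_le_sqrt.2 (by nlinarith [sq_nonneg ‖v‖])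

lemma wt_le_bracket_rpow {N : ℕ} (v : Vel N) : wt v ≤ bracket v ^ (3 : ℝ) := by
  have h1 := one_le_bracket v
  have h2 : bracket v ^ 2 = wt v := Real.sq_sqrt (by nlinarith [sq_nonneg ‖v‖])
  rw [← h2, ← Real.rpow_natCast]
  exact Real.rpow_le_rpow_of_exponent_le h1 (by norm_num)

lemma continuous_bracket {N : ℕ} : Continuous (bracket : Vel N → ℝ) := by
  unfold bracket; fun_prop

lemma continuous_bracket_rpow {N : ℕ} : Continuous (fun v : Vel N => bracket v ^ (3 : ℝ)) :=
  continuous_bracket.rpow_const fun v => Or.inr (by norm_num)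

lemma enorm_wt_mul_le {N : ℕ} (f : Vel N → ℝ) (v : Vel N) :
    ‖wt v * f v‖ₑ ≤ ‖bracket v ^ (3 : ℝ) * f v‖ₑ := by
  rw [enorm_mul, enorm_mul]
  gcongr
  rw [enorm_le_iff_norm_le, Real.norm_of_nonneg (wt_pos v).le]
  exact (wt_le_bracket_rpow v).trans (le_abs_self _)

lemma MemWeightedLp.wInt {N : ℕ} {f : Vel N → ℝ} (hf : MemWeightedLp 1 3 f) : WInt f := by
  have h1 : Integrable (fun v => bracket v ^ (3 : ℝ) * f v) := memLp_one_iff_integrable.1 hf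
  have hm : AEStronglyMeasurable (fun v : Vel N =>
      wt v * ((bracket v ^ (3 : ℝ))⁻¹ * (bracket v ^ (3 : ℝ) * f v))) volume :=
    continuous_wt.aestronglyMeasurable.mul
      ((continuous_bracket_rpow.inv₀ (fun v =>
        (lt_of_lt_of_le (wt_pos v) (wt_le_bracket_rpow v)).ne')).aestronglyMeasurable.mul h1.1)
  refine Integrable.mono h1 (hm.congr (Eventually.of_forall fun v => ?_))
    (Eventually.of_forall fun v => ?_)
  · have := (lt_of_lt_of_le (wt_pos v) (wt_le_bracket_rpow v)).ne'
    field_simp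
  · exact enorm_le_iff_norm_le.1 (enorm_wt_mul_le f v)

lemma ofReal_integral_wt_le {N : ℕ} {f : Vel N → ℝ} (hf : WInt f) :
    ENNReal.ofReal (∫ v, |wt v * f v|) ≤ weightedNorm 1 3 f := by
  rw [weightedNorm, eLpNorm_one_eq_lintegral_enorm]
  have : ENNReal.ofReal (∫ v, |wt v * f v|) = ∫⁻ v, ‖wt v * f v‖ₑ :=
    ofReal_integral_norm_eq_lintegral_enorm hf
  rw [this]
  exact lintegral_mono fun v => enorm_wt_mul_le f v

section Solution

variable {N : ℕ} {α ρ : ℝ} {b : ℝ → ℝ} {g : ℝ → Vel N → ℝ}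

lemma IsSolution.wInt (h : IsSolution α ρ b g) {t : ℝ} (ht : 0 ≤ t) : WInt (g t) :=
  (h.mem t ht).wInt

lemma IsSolution.tendsto_wt (h : IsSolution α ρ b g) {t : ℝ} (ht : 0 ≤ t) :
    Tendsto (fun s => ∫ v, |wt v * (g s v - g t v)|) (𝓝[Ici 0] t) (𝓝 0) := by
  have h1 := h.continuous t ht
  have h2 : Tendsto (fun s => (weightedNorm 1 3 (fun v => g s v - g t v)).toReal)
      (𝓝[Ici 0] t) (𝓝 0) := by
    have := (ENNReal.tendsto_toReal ENNReal.zero_ne_top).comp h1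
    rw [ENNReal.toReal_zero] at this
    exact this
  have hfin : ∀ᶠ s in 𝓝[Ici 0] t, weightedNorm 1 3 (fun v => g s v - g t v) < ⊤ :=
    h1.eventually (gt_mem_nhds ENNReal.zero_lt_top)
  refine squeeze_zero' (Eventually.of_forall fun s => integral_nonneg fun v => abs_nonneg _) ?_ h2
  filter_upwards [hfin, self_mem_nhdsWithin] with s hs hs0
  have := ofReal_integral_wt_le ((h.wInt hs0).sub (h.wInt ht))
  exact (ENNReal.ofReal_le_iff_le_toReal hs.ne).1 this

lemma abs_integral_mul_sub_le {f h ψ : Vel N → ℝ} (hf : WInt f) (hh : WInt h) {M : ℝ}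
    (hM : ∀ v, |ψ v| ≤ M) (hψ : Continuous ψ) :
    |(∫ v, f v * ψ v) - ∫ v, h v * ψ v| ≤ M * ∫ v, |wt v * (f v - h v)| := by
  rw [← integral_sub (hf.integrable_mul hψ.aestronglyMeasurable hM)
    (hh.integrable_mul hψ.aestronglyMeasurable hM), ← integral_const_mul]
  refine norm_integral_le_of_norm_le (f := fun v => f v * ψ v - h v * ψ v)
    ((Integrable.abs (hf.sub hh)).const_mul M)
    (Eventually.of_forall fun v => ?_)
  rw [← sub_mul, norm_mul, Real.norm_eq_abs, Real.norm_eq_abs, abs_mul, abs_of_pos (wt_pos v)]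
  have h1 := one_le_wt v
  have h2 := hM v
  have h3 : 0 ≤ M := (abs_nonneg _).trans h2
  calc |f v - h v| * |ψ v| ≤ |f v - h v| * M := by gcongr
    _ ≤ M * (wt v * |f v - h v|) := by nlinarith [mul_nonneg h3 (abs_nonneg (f v - h v))]

lemma IsSolution.continuousOn_integral (h : IsSolution α ρ b g) {ψ : Vel N → ℝ} {M : ℝ}
    (hψ : Continuous ψ) (hM : ∀ v, |ψ v| ≤ M) :
    ContinuousOn (fun s => ∫ v, g s v * ψ v) (Ici 0) := by
  intro t ht
  rw [ContinuousWithinAt, tendsto_iff_norm_sub_tendsto_zero]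
  have := (h.tendsto_wt ht).const_mul M
  rw [mul_zero] at this
  refine squeeze_zero' (Eventually.of_forall fun s => norm_nonneg _) ?_ this
  filter_upwards [self_mem_nhdsWithin] with s hs
  exact abs_integral_mul_sub_le (h.wInt hs) (h.wInt ht) hM hψ

lemma IsSolution.continuousOn_collisionWeak {bm bM : ℝ} (h : IsSolution α ρ b g)
    (hb : CrossBounds b bm bM) {ψ : Vel N → ℝ} {M : ℝ}
    (hψ : Continuous ψ) (hM : ∀ v, |ψ v| ≤ M) :
    ContinuousOn (fun s => collisionWeak α b (g s) (g s) ψ) (Ici 0) := by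
  intro t ht
  rw [ContinuousWithinAt, tendsto_iff_norm_sub_tendsto_zero]
  have h0 := h.tendsto_wt ht
  set A := ∫ v, |wt v * g t v| with hA
  have h1 : Tendsto (fun s => (bM * (2 * M)) * (surf N).real univ *
      ((∫ v, |wt v * (g s v - g t v)|) * ((∫ v, |wt v * (g s v - g t v)|) + A + A)))
      (𝓝[Ici 0] t) (𝓝 0) := by
    have := (h0.mul ((h0.add_const A).add_const A)).const_mul
      ((bM * (2 * M)) * (surf N).real univ)
    simpa using this
  have hM0 : 0 ≤ M := (abs_nonneg _).trans (hM 0)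
  refine squeeze_zero' (Eventually.of_forall fun s => norm_nonneg _) ?_ h1
  filter_upwards [self_mem_nhdsWithin] with s hs
  refine (abs_collisionWeak_sub_le hb (h.wInt hs) (h.wInt ht) hψ hM).trans ?_
  have h2 : ∫ v, |wt v * g s v| ≤ (∫ v, |wt v * (g s v - g t v)|) + A := by
    rw [hA, ← integral_add (Integrable.abs ((h.wInt hs).sub (h.wInt ht)))
      (Integrable.abs (h.wInt ht))]
    refine integral_mono (Integrable.abs (h.wInt hs))
      ((Integrable.abs ((h.wInt hs).sub (h.wInt ht))).add (Integrable.abs (h.wInt ht)))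
      fun v => ?_
    have := abs_add_le (wt v * (g s v - g t v)) (wt v * g t v)
    rwa [← mul_add, sub_add_cancel] at this
  have h3 : 0 ≤ ∫ v, |wt v * (g s v - g t v)| := integral_nonneg fun v => abs_nonneg _
  have := hb.posM
  gcongr

lemma continuous_laplacian {ψ : Vel N → ℝ} (hψ : ContDiff ℝ ∞ ψ) :
    Continuous (Laplacian.laplacian ψ) := by
  rw [InnerProductSpace.laplacian_eq_iteratedFDeriv_stdOrthonormalBasis]
  refine continuous_finsetSum _ fun i _ => ?_
  have := hψ.continuous_iteratedFDeriv (m := 2) (WithTop.coe_le_coe.2 le_top)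
  exact (ContinuousMultilinearMap.apply ℝ (fun _ : Fin 2 => Vel N) ℝ
    ![stdOrthonormalBasis ℝ (Vel N) i, stdOrthonormalBasis ℝ (Vel N) i]).continuous.comp this

lemma hasCompactSupport_laplacian {ψ : Vel N → ℝ} (hψ : HasCompactSupport ψ) :
    HasCompactSupport (Laplacian.laplacian ψ) := by
  rw [InnerProductSpace.laplacian_eq_iteratedFDeriv_stdOrthonormalBasis]
  have := hψ.iteratedFDeriv (𝕜 := ℝ) 2
  refine this.mono fun x hx => ?_
  contrapose! hx
  simp only [Function.mem_support, ne_eq, not_not] at hx ⊢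
  simp [hx]

lemma exists_bound_of_compact {φ : Vel N → ℝ} (hc : Continuous φ) (hs : HasCompactSupport φ) :
    ∃ M, ∀ v, |φ v| ≤ M := by
  obtain ⟨M, hM⟩ := hc.bounded_above_of_compact_support hs
  exact ⟨M, hM⟩

lemma hasCompactSupport_of_ball {ψ : Vel N → ℝ} {R : ℝ} (h : ∀ v, R < ‖v‖ → ψ v = 0) :
    HasCompactSupport ψ := by
  refine HasCompactSupport.intro (isCompact_closedBall (0 : Vel N) R) fun v hv => h v ?_
  simpa using hv

/-- The right-hand side of the equation, tested against `ψ`. -/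
def rhs (α ρ : ℝ) (b : ℝ → ℝ) (f ψ : Vel N → ℝ) : ℝ :=
  collisionWeak α b f f ψ + ρ * (1 - α) * ∫ v, f v * Laplacian.laplacian ψ v

lemma IsSolution.continuousOn_rhs {bm bM : ℝ} (h : IsSolution α ρ b g)
    (hb : CrossBounds b bm bM) {ψ : Vel N → ℝ} (hψ : ContDiff ℝ ∞ ψ)
    (hc : HasCompactSupport ψ) : ContinuousOn (fun s => rhs α ρ b (g s) ψ) (Ici 0) := by
  obtain ⟨M, hM⟩ := exists_bound_of_compact hψ.continuous hc
  obtain ⟨M', hM'⟩ := exists_bound_of_compact (continuous_laplacian hψ)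
    (hasCompactSupport_laplacian hc)
  exact (h.continuousOn_collisionWeak hb hψ.continuous hM).add
    ((h.continuousOn_integral (continuous_laplacian hψ) hM').const_smul (ρ * (1 - α)))

lemma IsSolution.hasDerivAt_integral {bm bM : ℝ} (h : IsSolution α ρ b g)
    (hb : CrossBounds b bm bM) {ψ : Vel N → ℝ} (hψ : ContDiff ℝ ∞ ψ)
    (hc : HasCompactSupport ψ) {t : ℝ} (ht : 0 < t) :
    HasDerivAt (fun s => ∫ v, g s v * ψ v) (rhs α ρ b (g t) ψ) t := by
  have hcont := h.continuousOn_rhs hb hψ hc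
  have hi : IntervalIntegrable (fun s => rhs α ρ b (g s) ψ) volume 0 t :=
    (hcont.mono (by rw [uIcc_of_le ht.le]; exact Icc_subset_Ici_self)).intervalIntegrable
  have hn : Ioi (0 : ℝ) ∈ 𝓝 t := Ioi_mem_nhds ht
  have hd := intervalIntegral.integral_hasDerivAt_right hi
    ((hcont.mono Ioi_subset_Ici_self).stronglyMeasurableAtFilter isOpen_Ioi t ht)
    ((hcont.mono Ioi_subset_Ici_self).continuousAt hn)
  refine (hd.const_add (∫ v, g 0 v * ψ v)).congr_of_eventuallyEq ?_
  filter_upwards [hn] with s hs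
  exact h.equation ψ hψ hc s (le_of_lt hs)

/-- The time derivative of `∫ g(s) ψ(s)` for a time-dependent test function. -/
lemma IsSolution.hasDerivAt_integral_mul {bm bM : ℝ} (h : IsSolution α ρ b g)
    (hb : CrossBounds b bm bM) {ψ ψ' : ℝ → Vel N → ℝ} {I : Set ℝ} (hI : IsOpen I) {R M M' : ℝ}
    (hψ : ∀ s ∈ I, ContDiff ℝ ∞ (ψ s)) (hs : ∀ s ∈ I, ∀ v, R < ‖v‖ → ψ s v = 0)
    (hM : ∀ s ∈ I, ∀ v, |ψ s v| ≤ M)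
    (hd : ∀ s ∈ I, ∀ v, HasDerivAt (fun s => ψ s v) (ψ' s v) s)
    (hc' : ∀ s ∈ I, Continuous (ψ' s)) (hM' : ∀ s ∈ I, ∀ v, |ψ' s v| ≤ M')
    {t : ℝ} (ht : 0 < t) (htI : t ∈ I) :
    HasDerivAt (fun s => ∫ v, g s v * ψ s v)
      ((∫ v, g t v * ψ' t v) + rhs α ρ b (g t) (ψ t)) t := by
  have hM'0 : 0 ≤ M' := (abs_nonneg _).trans (hM' t htI 0)
  obtain ⟨ε, hε, hεI⟩ := Metric.isOpen_iff.1 hI t htI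
  have hw := h.wInt ht.le
  have h1 : HasDerivAt (fun s => ∫ v, g t v * ψ s v) (∫ v, g t v * ψ' t v) t := by
    refine (hasDerivAt_integral_of_dominated_loc_of_deriv_le
      (F := fun s v => g t v * ψ s v) (F' := fun s v => g t v * ψ' s v)
      (bound := fun v => |g t v| * M') (Metric.ball_mem_nhds t hε) ?_ ?_ ?_ ?_ ?_ ?_).2
    · filter_upwards [hI.mem_nhds htI] with s hs'
      exact hw.aestronglyMeasurable.mul (hψ s hs').continuous.aestronglyMeasurable
    · exact hw.integrable_mul (hψ t htI).continuous.aestronglyMeasurable (hM t htI)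
    · exact hw.aestronglyMeasurable.mul (hc' t htI).aestronglyMeasurable
    · refine Eventually.of_forall fun v s hs' => ?_
      rw [norm_mul]
      exact mul_le_mul_of_nonneg_left (hM' s (hεI hs') v) (norm_nonneg _)
    · exact hw.integrable.abs.mul_const _
    · exact Eventually.of_forall fun v s hs' => (hd s (hεI hs') v).const_mul _
  have h2 := h.hasDerivAt_integral hb (hψ t htI) (hasCompactSupport_of_ball (hs t htI)) ht
  -- the cross term is `o(s - t)` since `g` is continuous and `ψ` Lipschitz in time
  have h3 : HasDerivAt (fun s => (∫ v, g s v * (ψ s v - ψ t v)) -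
      ∫ v, g t v * (ψ s v - ψ t v)) 0 t := by
    rw [hasDerivAt_iff_isLittleO]
    have hlip : ∀ s ∈ Metric.ball t ε, ∀ v, |ψ s v - ψ t v| ≤ M' * |s - t| := by
      intro s hs' v
      exact (convex_ball t ε).norm_image_sub_le_of_norm_hasDerivWithin_le
        (f := fun s => ψ s v) (fun x hx => (hd x (hεI hx) v).hasDerivWithinAt)
        (fun x hx => hM' x (hεI hx) v) (Metric.mem_ball_self hε) hs'
    have hten : Tendsto (fun s => M' * ∫ v, |wt v * (g s v - g t v)|) (𝓝 t) (𝓝 0) := by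
      have := (h.tendsto_wt ht.le).const_mul M'
      rw [mul_zero, nhdsWithin_eq_nhds.2 (Ici_mem_nhds ht)] at this
      exact this
    rw [Asymptotics.isLittleO_iff]
    intro c hc
    filter_upwards [Metric.ball_mem_nhds t hε, Ioi_mem_nhds ht, hten.eventually (gt_mem_nhds hc)]
      with s hs' hs0 hsc
    have hcont : Continuous (fun v => ψ s v - ψ t v) :=
      (hψ s (hεI hs')).continuous.sub (hψ t htI).continuous
    have := abs_integral_mul_sub_le (h.wInt (le_of_lt hs0)) hw (hlip s hs') hcont
    simp only [sub_self, mul_zero, integral_zero, smul_zero, sub_zero]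
    refine this.trans ?_
    rw [Real.norm_eq_abs]
    calc M' * |s - t| * ∫ v, |wt v * (g s v - g t v)|
        = (M' * ∫ v, |wt v * (g s v - g t v)|) * |s - t| := by ring
      _ ≤ c * |s - t| := by gcongr
  refine ((((h1.add h2).add h3).sub_const (∫ v, g t v * ψ t v)).congr_deriv
    (by ring)).congr_of_eventuallyEq ?_
  filter_upwards [hI.mem_nhds htI, Ioi_mem_nhds ht] with s hs' hs0
  have hws := h.wInt (le_of_lt hs0)
  have i1 := hws.integrable_mul (hψ s hs').continuous.aestronglyMeasurable (hM s hs')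
  have i2 := hws.integrable_mul (hψ t htI).continuous.aestronglyMeasurable (hM t htI)
  have i3 := hw.integrable_mul (hψ s hs').continuous.aestronglyMeasurable (hM s hs')
  have i4 := hw.integrable_mul (hψ t htI).continuous.aestronglyMeasurable (hM t htI)
  simp only [Pi.add_apply, mul_sub]
  rw [integral_sub i1 i2, integral_sub i3 i4]
  ring

end Solution

/-- A solution `g` together with the bounds available on `[0, T]`. -/
structure Bounded {N : ℕ} (b : ℝ → ℝ) (bm bM ρ C α T : ℝ) (g : ℝ → Vel N → ℝ) : Prop where
  cross : CrossBounds b bm bM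
  hρ : 0 < ρ
  hC : 0 < C
  hα0 : 0 < α
  hα1 : α < 1
  sol : IsSolution α ρ b g
  moment : ∀ t ∈ Icc 0 T, ∫ v, |wt v * g t v| ≤ C
  l2 : ∀ t ∈ Icc 0 T, weightedNorm 2 0 (g t) ≤ ENNReal.ofReal C

/-- The rate at which collisions and diffusion can deplete a ball of radius `R`. -/
def rate (N : ℕ) (bM C R : ℝ) : ℝ := bM * (surf N).real univ * (1 + R) * C

lemma rate_nonneg {N : ℕ} {bM C R : ℝ} (hb : 0 ≤ bM) (hC : 0 ≤ C) (hR : 0 ≤ R) :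
    0 ≤ rate N bM C R := by unfold rate; positivity

/-- Duhamel's inequality in dual form. If `ψ` is a nonnegative subsolution of the backward heat
equation, then `F(s) = ∫ g(s) ψ(s)` satisfies `F' ≥ Γ - λ F`, where `Γ` bounds the gain term from
below and `λ` is the loss rate on the support of `ψ`. -/
theorem Bounded.duhamel {N : ℕ} {b : ℝ → ℝ} {bm bM ρ C α T : ℝ} {g : ℝ → Vel N → ℝ}
    (h : Bounded b bm bM ρ C α T g) {a t : ℝ} (ha : 0 < a) (hat : a ≤ t) (htT : t ≤ T)
    {ψ ψ' : ℝ → Vel N → ℝ} {I : Set ℝ} (hI : IsOpen I) (hIcc : Icc a t ⊆ I) {R M M' Γ : ℝ}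
    (hR : 0 ≤ R)
    (hψ : ∀ s ∈ I, ContDiff ℝ ∞ (ψ s)) (hs : ∀ s ∈ I, ∀ v, R < ‖v‖ → ψ s v = 0)
    (hM : ∀ s ∈ I, ∀ v, |ψ s v| ≤ M)
    (hd : ∀ s ∈ I, ∀ v, HasDerivAt (fun s => ψ s v) (ψ' s v) s)
    (hc' : ∀ s ∈ I, Continuous (ψ' s)) (hM' : ∀ s ∈ I, ∀ v, |ψ' s v| ≤ M')
    (hψ0 : ∀ s ∈ Icc a t, ∀ v, 0 ≤ ψ s v)
    (hsub : ∀ s ∈ Icc a t, ∀ v, 0 ≤ ψ' s v + ρ * (1 - α) * Laplacian.laplacian (ψ s) v)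
    (hΓ0 : 0 ≤ Γ) (hΓ : ∀ s ∈ Icc a t, Γ ≤ gain α b (g s) (ψ s)) :
    Real.exp (-rate N bM C R * (t - a)) * ((∫ v, g a v * ψ a v) + Γ * (t - a)) ≤
      ∫ v, g t v * ψ t v := by
  set lam := rate N bM C R with hlam
  have hlam0 : 0 ≤ lam := rate_nonneg h.cross.posM.le h.hC.le hR
  set F : ℝ → ℝ := fun s => ∫ v, g s v * ψ s v with hF
  set F' : ℝ → ℝ := fun s => (∫ v, g s v * ψ' s v) + rhs α ρ b (g s) (ψ s) with hF'
  have hder : ∀ s ∈ Icc a t, HasDerivAt F (F' s) s := fun s hs' =>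
    h.sol.hasDerivAt_integral_mul h.cross hI hψ hs hM hd hc' hM' (ha.trans_le hs'.1) (hIcc hs')
  have hlow : ∀ s ∈ Icc a t, Γ - lam * F s ≤ F' s := by
    intro s hs'
    have hs0 : 0 ≤ s := ha.le.trans hs'.1
    have hw := h.sol.wInt hs0
    have hg0 := h.sol.nonneg s hs0
    have hsI := hIcc hs'
    have k1 := gain_sub_le_collisionWeak (α := α) h.cross hw hg0
      (h.moment s ⟨hs0, hs'.2.trans htT⟩) (hψ s hsI).continuous (hψ0 s hs') (hM s hsI) hR (hs s hsI)
    have hcs := hasCompactSupport_of_ball (hs s hsI)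
    obtain ⟨M₂, hM₂⟩ := exists_bound_of_compact (continuous_laplacian (hψ s hsI))
      (hasCompactSupport_laplacian hcs)
    have k2 : 0 ≤ (∫ v, g s v * ψ' s v) +
        ρ * (1 - α) * ∫ v, g s v * Laplacian.laplacian (ψ s) v := by
      rw [← integral_const_mul, ← integral_add
        (hw.integrable_mul (hc' s hsI).aestronglyMeasurable (hM' s hsI))
        ((hw.integrable_mul (continuous_laplacian (hψ s hsI)).aestronglyMeasurable hM₂).const_mul
          _)]
      refine integral_nonneg_of_ae ?_
      filter_upwards [hg0] with v hv
      have := mul_nonneg hv (hsub s hs' v)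
      simp only [Pi.zero_apply]
      linarith
    have k3 := hΓ s hs'
    simp only [hF', rhs, hF, hlam, rate]
    linarith
  set E : ℝ → ℝ := fun s => Real.exp (lam * (s - a)) * F s - Γ * (s - a) with hE
  have hEd : ∀ s ∈ Icc a t, HasDerivAt E
      (Real.exp (lam * (s - a)) * lam * F s + Real.exp (lam * (s - a)) * F' s - Γ) s := by
    intro s hs'
    have e1 : HasDerivAt (fun s => Real.exp (lam * (s - a)))
        (Real.exp (lam * (s - a)) * lam) s := by
      have := (((hasDerivAt_id s).sub_const a).const_mul lam).exp
      simpa using this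
    have e2 : HasDerivAt (fun s => Γ * (s - a)) Γ s := by
      have := ((hasDerivAt_id s).sub_const a).const_mul Γ
      simpa using this
    exact (e1.mul (hder s hs')).sub e2
  have hmono : MonotoneOn E (Icc a t) := by
    refine monotoneOn_of_hasDerivWithinAt_nonneg (convex_Icc a t)
      (fun s hs' => (hEd s hs').continuousAt.continuousWithinAt)
      (fun s hs' => (hEd s (interior_subset hs')).hasDerivWithinAt) (fun s hs' => ?_)
    have hs'' := interior_subset hs'
    have k := hlow s hs''
    have e1 : 1 ≤ Real.exp (lam * (s - a)) :=
      Real.one_le_exp (mul_nonneg hlam0 (sub_nonneg.2 hs''.1))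
    nlinarith
  have key := hmono (left_mem_Icc.2 hat) (right_mem_Icc.2 hat) hat
  simp only [hE, sub_self, mul_zero, Real.exp_zero, one_mul, sub_zero] at key
  have e3 : Real.exp (-lam * (t - a)) * Real.exp (lam * (t - a)) = 1 := by
    rw [← Real.exp_add]; simp
  calc Real.exp (-lam * (t - a)) * (F a + Γ * (t - a))
      ≤ Real.exp (-lam * (t - a)) * (Real.exp (lam * (t - a)) * F t) := by
        gcongr; linarith
    _ = F t := by rw [← mul_assoc, e3, one_mul]

/-! ### Compactly supported subsolutions of the heat equation -/

/-- A smooth convex nondecreasing function vanishing on `(-∞, 0]` and asymptotic to `x`. -/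
def phi (x : ℝ) : ℝ := x * expNegInvGlue x

lemma phi_of_nonpos {x : ℝ} (hx : x ≤ 0) : phi x = 0 := by
  simp [phi, expNegInvGlue.zero_of_nonpos hx]

lemma phi_of_pos {x : ℝ} (hx : 0 < x) : phi x = x * Real.exp (-x⁻¹) := by
  simp [phi, expNegInvGlue, not_le.2 hx]

lemma phi_nonneg (x : ℝ) : 0 ≤ phi x := by
  rcases le_or_gt x 0 with hx | hx
  · rw [phi_of_nonpos hx]
  · rw [phi_of_pos hx]; positivity

lemma sub_one_le_phi (x : ℝ) : x - 1 ≤ phi x := by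
  rcases le_or_gt x 0 with hx | hx
  · rw [phi_of_nonpos hx]; linarith
  · rw [phi_of_pos hx]
    have h := Real.add_one_le_exp (-x⁻¹)
    have h2 : x * x⁻¹ = 1 := mul_inv_cancel₀ hx.ne'
    nlinarith

lemma phi_sub_one_le {A : ℝ} (hA : 0 ≤ A) : phi (A - 1) ≤ A := by
  rcases le_or_gt (A - 1) 0 with hx | hx
  · rw [phi_of_nonpos hx]; exact hA
  · rw [phi_of_pos hx]
    have : Real.exp (-(A - 1)⁻¹) ≤ 1 := Real.exp_le_one_iff.2 (by
      have := inv_pos.2 hx; linarith)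
    nlinarith

lemma contDiff_phi : ContDiff ℝ ∞ phi := contDiff_id.mul (expNegInvGlue.contDiff (n := ⊤))

lemma deriv_phi_of_neg {x : ℝ} (hx : x < 0) : deriv phi x = 0 := by
  have : phi =ᶠ[𝓝 x] fun _ => 0 := by
    filter_upwards [Iio_mem_nhds hx] with y hy using phi_of_nonpos (le_of_lt hy)
  rw [this.deriv_eq, deriv_const]

lemma deriv_phi_of_nonpos {x : ℝ} (hx : x ≤ 0) : deriv phi x = 0 := by
  have hc : IsClosed {x | deriv phi x = 0} :=
    isClosed_eq (contDiff_phi.continuous_deriv (by simp)) continuous_const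
  have h2 := closure_minimal (fun x hx => deriv_phi_of_neg hx : Iio (0 : ℝ) ⊆ _) hc
  rw [closure_Iio] at h2
  exact h2 hx

lemma deriv_phi_of_pos {x : ℝ} (hx : 0 < x) :
    deriv phi x = Real.exp (-x⁻¹) * (1 + x⁻¹) := by
  have : phi =ᶠ[𝓝 x] fun y => y * Real.exp (-y⁻¹) := by
    filter_upwards [Ioi_mem_nhds hx] with y hy using phi_of_pos hy
  rw [this.deriv_eq]
  have h1 := (hasDerivAt_id x).mul ((hasDerivAt_inv hx.ne').neg.exp)
  refine (h1.congr_deriv ?_).deriv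
  simp only [id, Pi.neg_apply]
  field_simp

lemma deriv2_phi_of_pos {x : ℝ} (hx : 0 < x) :
    deriv (deriv phi) x = Real.exp (-x⁻¹) * (x⁻¹) ^ 3 := by
  have : deriv phi =ᶠ[𝓝 x] fun y => Real.exp (-y⁻¹) * (1 + y⁻¹) := by
    filter_upwards [Ioi_mem_nhds hx] with y hy using deriv_phi_of_pos hy
  rw [this.deriv_eq]
  have h1 := ((hasDerivAt_inv hx.ne').neg.exp).mul ((hasDerivAt_inv hx.ne').const_add 1)
  refine (h1.congr_deriv ?_).deriv
  simp only [Pi.neg_apply]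
  field_simp
  ring

lemma contDiff_deriv_phi : ContDiff ℝ ∞ (deriv phi) :=
  (contDiff_infty_iff_deriv.1 contDiff_phi).2

lemma contDiff_deriv2_phi : ContDiff ℝ ∞ (deriv (deriv phi)) :=
  (contDiff_infty_iff_deriv.1 contDiff_deriv_phi).2

lemma forall_of_forall_ne_zero {P : Set ℝ} (hP : IsClosed P) (h : ∀ x, x ≠ 0 → x ∈ P) (x : ℝ) :
    x ∈ P := by
  have h1 : ({0}ᶜ : Set ℝ) ⊆ P := fun y hy => h y hy
  have h2 := (dense_compl_singleton (0 : ℝ)).closure_eq ▸ closure_minimal h1 hP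
  exact h2 (mem_univ x)

lemma deriv_phi_mem_Icc (x : ℝ) : deriv phi x ∈ Icc (0 : ℝ) 1 := by
  refine forall_of_forall_ne_zero (P := deriv phi ⁻¹' Icc 0 1)
    (isClosed_Icc.preimage contDiff_deriv_phi.continuous) (fun x hx => ?_) x
  rcases lt_or_gt_of_ne hx with hx | hx
  · simp [deriv_phi_of_neg hx]
  · have hi := inv_pos.2 hx
    rw [mem_preimage, deriv_phi_of_pos hx]
    refine ⟨by positivity, ?_⟩
    have h1 := Real.add_one_le_exp (x⁻¹)
    calc Real.exp (-x⁻¹) * (1 + x⁻¹) ≤ Real.exp (-x⁻¹) * Real.exp (x⁻¹) := by gcongr; linarith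
      _ = 1 := by rw [← Real.exp_add]; simp

lemma deriv2_phi_nonneg (x : ℝ) : 0 ≤ deriv (deriv phi) x := by
  refine forall_of_forall_ne_zero (P := deriv (deriv phi) ⁻¹' Ici 0)
    (isClosed_Ici.preimage contDiff_deriv2_phi.continuous) (fun x hx => ?_) x
  rcases lt_or_gt_of_ne hx with hx | hx
  · have : deriv phi =ᶠ[𝓝 x] fun _ => 0 := by
      filter_upwards [Iio_mem_nhds hx] with y hy using deriv_phi_of_neg hy
    simp [this.deriv_eq]
  · have hi := inv_pos.2 hx
    rw [mem_preimage, deriv2_phi_of_pos hx, mem_Ici]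
    positivity

/-- The one-dimensional heat kernel of variance `2θ`, normalised so that it equals `4` at the
origin when `θ = Θ`. -/
def amp (Θ θ z : ℝ) : ℝ := 4 * (√Θ / √θ) * Real.exp (-z ^ 2 / (4 * θ))

/-- A convex function of the heat kernel is a subsolution; this one vanishes where the kernel is
at most `1`, so that it is compactly supported. -/
def prof (Θ θ z : ℝ) : ℝ := phi (amp Θ θ z - 1)

lemma amp_nonneg (Θ θ z : ℝ) : 0 ≤ amp Θ θ z := by unfold amp; positivity

lemma amp_le {Θ θ : ℝ} (hθ : 0 < θ) (z : ℝ) : amp Θ θ z ≤ 4 * (√Θ / √θ) := by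
  unfold amp
  have : Real.exp (-z ^ 2 / (4 * θ)) ≤ 1 := Real.exp_le_one_iff.2 (by
    apply div_nonpos_of_nonpos_of_nonneg <;> nlinarith [sq_nonneg z])
  have h0 : 0 ≤ 4 * (√Θ / √θ) := by positivity
  nlinarith

lemma prof_nonneg (Θ θ z : ℝ) : 0 ≤ prof Θ θ z := phi_nonneg _

lemma prof_le_amp (Θ θ z : ℝ) : prof Θ θ z ≤ amp Θ θ z := phi_sub_one_le (amp_nonneg _ _ _)

lemma amp_le_one {Θ θ z : ℝ} (hΘ : 0 < Θ) (hθ : 0 < θ) (hz : 16 * √(Θ * θ) ≤ z ^ 2) :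
    amp Θ θ z ≤ 1 := by
  set x := 4 * (√Θ / √θ) with hx
  have hx0 : 0 < x := by positivity
  have h1 : x ≤ z ^ 2 / (4 * θ) := by
    rw [le_div_iff₀ (by positivity)]
    refine le_trans (le_of_eq ?_) hz
    rw [hx, Real.sqrt_mul hΘ.le]
    have := Real.mul_self_sqrt hθ.le
    have h0 : √θ ≠ 0 := by positivity
    field_simp
    nlinarith
  have h2 : x ≤ Real.exp x := by linarith [Real.add_one_le_exp x]
  unfold amp
  rw [← hx]
  calc x * Real.exp (-z ^ 2 / (4 * θ)) ≤ Real.exp x * Real.exp (-x) := by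
        gcongr
        rw [neg_div]; linarith
    _ = 1 := by rw [← Real.exp_add]; simp

lemma prof_eq_zero {Θ θ z : ℝ} (hΘ : 0 < Θ) (hθ : 0 < θ) (hz : 16 * √(Θ * θ) ≤ z ^ 2) :
    prof Θ θ z = 0 := phi_of_nonpos (by linarith [amp_le_one hΘ hθ hz])

lemma le_prof {Θ θ z : ℝ} (hθ : 0 < θ) (hθΘ : θ ≤ Θ) (hz : |z| ≤ √θ) :
    √Θ / √θ ≤ prof Θ θ z := by
  have hs : 0 < √θ := Real.sqrt_pos.2 hθ
  have h1 : 1 ≤ √Θ / √θ := by rw [one_le_div hs]; exact Real.sqrt_le_sqrt hθΘ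
  have h2 : z ^ 2 ≤ θ := by
    rw [← sq_abs, ← Real.sq_sqrt hθ.le]; gcongr
  have h3 : 3 / 4 ≤ Real.exp (-z ^ 2 / (4 * θ)) := by
    have := Real.add_one_le_exp (-z ^ 2 / (4 * θ))
    have h4 : z ^ 2 / (4 * θ) ≤ 1 / 4 := by
      rw [div_le_div_iff₀ (by positivity) (by norm_num)]; linarith
    rw [neg_div] at this ⊢
    linarith
  have h4 : 3 * (√Θ / √θ) ≤ amp Θ θ z := by
    unfold amp; nlinarith
  have := sub_one_le_phi (amp Θ θ z - 1)
  unfold prof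
  linarith

/-- The common value of `∂_θ` and `∂_z²` of the heat kernel. -/
def ampD (Θ θ z : ℝ) : ℝ := (z ^ 2 / (4 * θ ^ 2) - 1 / (2 * θ)) * amp Θ θ z

lemma hasDerivAt_amp (Θ : ℝ) {θ : ℝ} (hθ : 0 < θ) (z : ℝ) :
    HasDerivAt (fun z => amp Θ θ z) (-z / (2 * θ) * amp Θ θ z) z := by
  have h1 : HasDerivAt (fun z : ℝ => -z ^ 2 / (4 * θ)) (-z / (2 * θ)) z := by
    have := ((hasDerivAt_pow 2 z).neg).div_const (4 * θ)
    refine this.congr_deriv ?_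
    field_simp
    push_cast
    ring
  refine (h1.exp.const_mul (4 * (√Θ / √θ))).congr_deriv ?_
  unfold amp; ring

lemma hasDerivAt_amp2 (Θ : ℝ) {θ : ℝ} (hθ : 0 < θ) (z : ℝ) :
    HasDerivAt (fun z => -z / (2 * θ) * amp Θ θ z) (ampD Θ θ z) z := by
  have h1 : HasDerivAt (fun z : ℝ => -z / (2 * θ)) (-1 / (2 * θ)) z :=
    ((hasDerivAt_id z).neg).div_const (2 * θ)
  refine (h1.mul (hasDerivAt_amp Θ hθ z)).congr_deriv ?_
  unfold ampD
  field_simp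
  ring

lemma hasDerivAt_amp_theta (Θ : ℝ) {θ : ℝ} (hθ : 0 < θ) (z : ℝ) :
    HasDerivAt (fun θ => amp Θ θ z) (ampD Θ θ z) θ := by
  have hs : 0 < √θ := Real.sqrt_pos.2 hθ
  have h1 : HasDerivAt (fun θ : ℝ => 4 * (√Θ / √θ)) (4 * (-(√Θ * (1 / (2 * √θ))) / √θ ^ 2)) θ := by
    have := ((hasDerivAt_const θ (√Θ)).div (Real.hasDerivAt_sqrt hθ.ne') hs.ne').const_mul 4
    refine this.congr_deriv ?_
    simp
  have h2 : HasDerivAt (fun θ : ℝ => -z ^ 2 / (4 * θ)) (z ^ 2 / (4 * θ ^ 2)) θ := by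
    have := (hasDerivAt_const θ (-z ^ 2)).div ((hasDerivAt_id θ).const_mul 4)
      (by simp [hθ.ne'])
    refine this.congr_deriv ?_
    simp only [id]
    field_simp
    norm_num
  refine (h1.mul h2.exp).congr_deriv ?_
  unfold ampD amp
  rw [Real.sq_sqrt hθ.le]
  field_simp
  ring

/-- `∂_θ` of the profile. -/
def profT (Θ θ z : ℝ) : ℝ := deriv phi (amp Θ θ z - 1) * ampD Θ θ z

lemma hasDerivAt_phi (x : ℝ) : HasDerivAt phi (deriv phi x) x :=
  (contDiff_phi.differentiable (by simp) x).hasDerivAt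

lemma hasDerivAt_prof_theta (Θ : ℝ) {θ : ℝ} (hθ : 0 < θ) (z : ℝ) :
    HasDerivAt (fun θ => prof Θ θ z) (profT Θ θ z) θ :=
  (hasDerivAt_phi _).comp θ ((hasDerivAt_amp_theta Θ hθ z).sub_const 1)

lemma contDiff_amp (Θ θ : ℝ) : ContDiff ℝ ∞ (amp Θ θ) := by
  unfold amp; fun_prop

lemma contDiff_prof (Θ θ : ℝ) : ContDiff ℝ ∞ (prof Θ θ) :=
  contDiff_phi.comp ((contDiff_amp Θ θ).sub contDiff_const)

lemma continuous_profT (Θ θ : ℝ) : Continuous (profT Θ θ) := by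
  have h1 := contDiff_deriv_phi.continuous.comp ((contDiff_amp Θ θ).continuous.sub
    (continuous_const (y := (1 : ℝ))))
  have h2 : Continuous (ampD Θ θ) := by
    unfold ampD
    have := (contDiff_amp Θ θ).continuous
    fun_prop
  exact h1.mul h2

/-- The profile is a subsolution of the heat equation: `∂_θ f ≤ ∂_z² f`. -/
lemma profT_le_deriv2 (Θ : ℝ) {θ : ℝ} (hθ : 0 < θ) (z : ℝ) :
    profT Θ θ z ≤ deriv (deriv (prof Θ θ)) z := by
  have h1 : deriv (prof Θ θ) = fun z => deriv phi (amp Θ θ z - 1) * (-z / (2 * θ) * amp Θ θ z) :=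
    funext fun z => ((hasDerivAt_phi _).comp z ((hasDerivAt_amp Θ hθ z).sub_const 1)).deriv
  have h2 : HasDerivAt (deriv phi) (deriv (deriv phi) (amp Θ θ z - 1)) (amp Θ θ z - 1) :=
    (contDiff_deriv_phi.differentiable (by simp) _).hasDerivAt
  have h3 := (h2.comp z ((hasDerivAt_amp Θ hθ z).sub_const 1)).mul (hasDerivAt_amp2 Θ hθ z)
  rw [h1]
  have h4 := h3.deriv
  simp only [Function.comp_def] at h4
  erw [h4]
  unfold profT
  have := mul_nonneg (deriv2_phi_nonneg (amp Θ θ z - 1)) (sq_nonneg (-z / (2 * θ) * amp Θ θ z))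
  nlinarith

lemma abs_profT_le {Θ θ θ₀ : ℝ} (hΘ : 0 < Θ) (hθ₀ : 0 < θ₀) (hθ : θ₀ ≤ θ) (hθΘ : θ ≤ 2 * Θ)
    (z : ℝ) :
    |profT Θ θ z| ≤ (25 * Θ / (4 * θ₀ ^ 2) + 1 / (2 * θ₀)) * (4 * (√Θ / √θ₀)) := by
  have hθp : 0 < θ := hθ₀.trans_le hθ
  have hR0 : 0 ≤ (25 * Θ / (4 * θ₀ ^ 2) + 1 / (2 * θ₀)) * (4 * (√Θ / √θ₀)) := by positivity
  rcases le_or_gt (16 * √(Θ * θ)) (z ^ 2) with hz | hz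
  · have h1 := amp_le_one hΘ hθp hz
    have : deriv phi (amp Θ θ z - 1) = 0 := deriv_phi_of_nonpos (by linarith)
    rw [profT, this, zero_mul, abs_zero]
    exact hR0
  · have hz2 : z ^ 2 ≤ 25 * Θ := by
      have : √(Θ * θ) ≤ 25 / 16 * Θ := by
        rw [Real.sqrt_le_left (by positivity)]
        nlinarith
      linarith
    have hp := deriv_phi_mem_Icc (amp Θ θ z - 1)
    rw [profT, ampD, abs_mul, abs_mul, abs_of_nonneg hp.1, abs_of_nonneg (amp_nonneg _ _ _)]
    have h1 : |z ^ 2 / (4 * θ ^ 2) - 1 / (2 * θ)| ≤ 25 * Θ / (4 * θ₀ ^ 2) + 1 / (2 * θ₀) := by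
      refine (abs_sub _ _).trans ?_
      rw [abs_of_nonneg (by positivity), abs_of_nonneg (by positivity)]
      gcongr
    have h2 : amp Θ θ z ≤ 4 * (√Θ / √θ₀) := by
      refine (amp_le hθp z).trans ?_
      gcongr
    calc deriv phi (amp Θ θ z - 1) * (|z ^ 2 / (4 * θ ^ 2) - 1 / (2 * θ)| * amp Θ θ z)
        ≤ 1 * (|z ^ 2 / (4 * θ ^ 2) - 1 / (2 * θ)| * amp Θ θ z) := by
          gcongr
          · exact mul_nonneg (abs_nonneg _) (amp_nonneg _ _ _)
          · exact hp.2
      _ ≤ _ := by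
          rw [one_mul]
          gcongr
          exact amp_nonneg _ _ _

/-! ### Product kernels -/

lemma iteratedFDeriv_two_line {N : ℕ} {ψ : Vel N → ℝ} (hψ : ContDiff ℝ ∞ ψ) (w v : Vel N) :
    iteratedFDeriv ℝ 2 ψ w ![v, v] = deriv (deriv (fun s : ℝ => ψ (w + s • v))) 0 := by
  have hl : ∀ s : ℝ, HasDerivAt (fun s : ℝ => w + s • v) v s := fun s => by
    simpa using ((hasDerivAt_id s).smul_const v).const_add w
  have h1 : deriv (fun s : ℝ => ψ (w + s • v)) = fun s => fderiv ℝ ψ (w + s • v) v :=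
    funext fun s => (((hψ.differentiable (by simp) _).hasFDerivAt).comp_hasDerivAt s (hl s)).deriv
  have hd : ContDiff ℝ ∞ (fderiv ℝ ψ) := (contDiff_infty_iff_fderiv.1 hψ).2
  have h2 : HasDerivAt (fun s : ℝ => fderiv ℝ ψ (w + s • v))
      (fderiv ℝ (fderiv ℝ ψ) (w + (0 : ℝ) • v) v) 0 :=
    ((hd.differentiable (by simp) _).hasFDerivAt).comp_hasDerivAt 0 (hl 0)
  have h3 := (h2.clm_apply (hasDerivAt_const (0 : ℝ) v)).deriv
  rw [h1, h3, iteratedFDeriv_two_apply]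
  simp

lemma contDiff_coord {N : ℕ} (v y : Vel N) :
    ContDiff ℝ ∞ (fun w : Vel N => inner ℝ v (w - y)) :=
  contDiff_const.inner ℝ (contDiff_id.sub contDiff_const)

/-- The Laplacian of a product of functions of the coordinates in an orthonormal basis. -/
lemma laplacian_prod {N : ℕ} (e : OrthonormalBasis (Fin N) ℝ (Vel N)) (y : Vel N)
    {u : Fin N → ℝ → ℝ} (hu : ∀ i, ContDiff ℝ ∞ (u i)) (w : Vel N) :
    Laplacian.laplacian (fun w : Vel N => ∏ i, u i (inner ℝ (e i) (w - y))) w =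
      ∑ i, (∏ j ∈ Finset.univ.erase i, u j (inner ℝ (e j) (w - y))) *
        deriv (deriv (u i)) (inner ℝ (e i) (w - y)) := by
  have hc : ContDiff ℝ ∞ (fun w : Vel N => ∏ i, u i (inner ℝ (e i) (w - y))) :=
    contDiff_prod fun i _ => (hu i).comp (contDiff_coord _ _)
  rw [InnerProductSpace.laplacian_eq_iteratedFDeriv_orthonormalBasis _ e]
  refine Finset.sum_congr rfl fun i _ => ?_
  rw [iteratedFDeriv_two_line hc]
  set P := ∏ j ∈ Finset.univ.erase i, u j (inner ℝ (e j) (w - y)) with hP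
  set z := inner ℝ (e i) (w - y) with hz
  have h1 : (fun s : ℝ => ∏ j, u j (inner ℝ (e j) (w + s • e i - y))) =
      fun s => P * u i (z + s) := by
    funext s
    rw [← Finset.mul_prod_erase _ _ (Finset.mem_univ i), mul_comm]
    have hin : ∀ j, inner ℝ (e j) (w + s • e i - y) =
        inner ℝ (e j) (w - y) + s * (if j = i then 1 else 0) := by
      intro j
      rw [add_sub_right_comm, inner_add_right, inner_smul_right,
        orthonormal_iff_ite.1 e.orthonormal]
    congr 1
    · refine Finset.prod_congr rfl fun j hj => ?_
      rw [hin, if_neg (Finset.ne_of_mem_erase hj), mul_zero, add_zero]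
    · rw [hin, if_pos rfl, mul_one]
  rw [h1]
  have h2 : deriv (fun s => P * u i (z + s)) = fun s => P * deriv (u i) (z + s) := by
    funext s
    rw [deriv_const_mul_field, deriv_comp_const_add]
  rw [h2, deriv_const_mul_field, deriv_comp_const_add (deriv (u i)), add_zero]

/-- The test function at time `s`: a product of profiles over the coordinates centred at `y` in
an orthonormal basis, whose widths decrease to `ε i` at the final time `t`. -/
def kern {N : ℕ} (e : OrthonormalBasis (Fin N) ℝ (Vel N)) (Θ τ t : ℝ) (ε : Fin N → ℝ) (y : Vel N)
    (s : ℝ) (w : Vel N) : ℝ :=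
  ∏ i, prof Θ (ε i ^ 2 + τ * (t - s)) (inner ℝ (e i) (w - y))

section Kernel

variable {N : ℕ} (e : OrthonormalBasis (Fin N) ℝ (Vel N)) (Θ τ t : ℝ) (ε : Fin N → ℝ) (y : Vel N)

lemma kern_nonneg (s : ℝ) (w : Vel N) : 0 ≤ kern e Θ τ t ε y s w :=
  Finset.prod_nonneg fun _ _ => prof_nonneg _ _ _

lemma contDiff_kern (s : ℝ) : ContDiff ℝ ∞ (kern e Θ τ t ε y s) :=
  contDiff_prod fun _ _ => (contDiff_prof Θ _).comp (contDiff_coord _ _)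

/-- The time derivative of `kern`. -/
def kernT (s : ℝ) (w : Vel N) : ℝ :=
  ∑ i, (∏ j ∈ Finset.univ.erase i, prof Θ (ε j ^ 2 + τ * (t - s)) (inner ℝ (e j) (w - y))) *
    (-τ * profT Θ (ε i ^ 2 + τ * (t - s)) (inner ℝ (e i) (w - y)))

lemma continuous_kernT (s : ℝ) : Continuous (kernT e Θ τ t ε y s) := by
  unfold kernT
  refine continuous_finsetSum _ fun i _ => ?_
  refine Continuous.mul (continuous_finsetProd _ fun j _ => ?_) (Continuous.mul continuous_const ?_)
  · exact (contDiff_prof Θ _).continuous.comp (by fun_prop)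
  · exact (continuous_profT Θ _).comp (by fun_prop)

variable {Θ τ t ε}

lemma hasDerivAt_kern {s : ℝ} (hs : ∀ i, 0 < ε i ^ 2 + τ * (t - s)) (w : Vel N) :
    HasDerivAt (fun s => kern e Θ τ t ε y s w) (kernT e Θ τ t ε y s w) s := by
  have h1 : ∀ i ∈ (Finset.univ : Finset (Fin N)),
      HasDerivAt (fun s => prof Θ (ε i ^ 2 + τ * (t - s)) (inner ℝ (e i) (w - y)))
        (-τ * profT Θ (ε i ^ 2 + τ * (t - s)) (inner ℝ (e i) (w - y))) s := by
    intro i _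
    have h2 : HasDerivAt (fun s => ε i ^ 2 + τ * (t - s)) (-τ) s := by
      have := (((hasDerivAt_id s).const_sub t).const_mul τ).const_add (ε i ^ 2)
      simpa using this
    have h3 := (hasDerivAt_prof_theta Θ (hs i) (inner ℝ (e i) (w - y))).comp s h2
    rw [mul_comm] at h3
    exact h3
  have := HasDerivAt.fun_finsetProd h1
  refine this.congr_deriv ?_
  simp [kernT]

lemma kern_subsolution {s : ℝ} (hτ : 0 ≤ τ) (hs : ∀ i, 0 < ε i ^ 2 + τ * (t - s)) (w : Vel N) :
    0 ≤ kernT e Θ τ t ε y s w + τ * Laplacian.laplacian (kern e Θ τ t ε y s) w := by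
  have h1 := laplacian_prod e y (u := fun i => prof Θ (ε i ^ 2 + τ * (t - s)))
    (fun i => contDiff_prof Θ _) w
  have h2 : kern e Θ τ t ε y s = fun w : Vel N =>
      ∏ i, prof Θ (ε i ^ 2 + τ * (t - s)) (inner ℝ (e i) (w - y)) := rfl
  rw [h2, h1, kernT, Finset.mul_sum, ← Finset.sum_add_distrib]
  refine Finset.sum_nonneg fun i _ => ?_
  have h3 := profT_le_deriv2 Θ (hs i) (inner ℝ (e i) (w - y))
  have h4 : 0 ≤ ∏ j ∈ Finset.univ.erase i,
      prof Θ (ε j ^ 2 + τ * (t - s)) (inner ℝ (e j) (w - y)) :=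
    Finset.prod_nonneg fun _ _ => prof_nonneg _ _ _
  have := mul_nonneg (mul_nonneg hτ h4) (sub_nonneg.2 h3)
  linarith

lemma norm_sq_eq_sum (v : Vel N) : ‖v‖ ^ 2 = ∑ i, inner ℝ (e i) v ^ 2 := by
  have := e.sum_sq_norm_inner_right v
  simp only [Real.norm_eq_abs, sq_abs] at this
  exact this.symm

lemma norm_le_of_coords {v : Vel N} {A : ℝ} (hA : ∀ i, inner ℝ (e i) v ^ 2 ≤ A) :
    ‖v‖ ≤ √(N * A) := by
  refine Real.le_sqrt_of_sq_le ?_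
  rw [norm_sq_eq_sum e]
  calc ∑ i, inner ℝ (e i) v ^ 2 ≤ ∑ _i : Fin N, A := Finset.sum_le_sum fun i _ => hA i
    _ = N * A := by simp

lemma abs_inner_le_norm' (v : Vel N) (i : Fin N) : |inner ℝ (e i) v| ≤ ‖v‖ := by
  have := abs_real_inner_le_norm (e i) v
  simpa using this

lemma kern_eq_zero {s : ℝ} (hΘ : 0 < Θ) (hs : ∀ i, 0 < ε i ^ 2 + τ * (t - s))
    (hs' : ∀ i, ε i ^ 2 + τ * (t - s) ≤ 2 * Θ) {w : Vel N} (hw : √(N * (25 * Θ)) < ‖w - y‖) :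
    kern e Θ τ t ε y s w = 0 := by
  by_contra hne
  have h1 : ∀ i, inner ℝ (e i) (w - y) ^ 2 ≤ 25 * Θ := by
    intro i
    by_contra hlt
    push Not at hlt
    refine hne (Finset.prod_eq_zero (Finset.mem_univ i) (prof_eq_zero hΘ (hs i) ?_))
    have : √(Θ * (ε i ^ 2 + τ * (t - s))) ≤ 25 / 16 * Θ := by
      rw [Real.sqrt_le_left (by positivity)]
      nlinarith [hs' i]
    linarith
  exact absurd (norm_le_of_coords e h1) (not_le.2 hw)

lemma kern_le {s θ₀ : ℝ} (hθ₀ : 0 < θ₀) (hs : ∀ i, θ₀ ≤ ε i ^ 2 + τ * (t - s))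
    (w : Vel N) : |kern e Θ τ t ε y s w| ≤ (4 * (√Θ / √θ₀)) ^ N := by
  rw [abs_of_nonneg (kern_nonneg ..), kern]
  calc ∏ i, prof Θ (ε i ^ 2 + τ * (t - s)) (inner ℝ (e i) (w - y))
      ≤ ∏ _i : Fin N, 4 * (√Θ / √θ₀) := by
        refine Finset.prod_le_prod (fun _ _ => prof_nonneg _ _ _) fun i _ => ?_
        refine (prof_le_amp _ _ _).trans ((amp_le (hθ₀.trans_le (hs i)) _).trans ?_)
        gcongr
        exact hs i
    _ = _ := by simp

lemma exists_bound_kernT {θ₀ : ℝ} (hΘ : 0 < Θ) (hθ₀ : 0 < θ₀) :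
    ∃ M', ∀ s, (∀ i, θ₀ ≤ ε i ^ 2 + τ * (t - s)) → (∀ i, ε i ^ 2 + τ * (t - s) ≤ 2 * Θ) →
      ∀ w : Vel N, |kernT e Θ τ t ε y s w| ≤ M' := by
  set A := 4 * (√Θ / √θ₀) with hA
  set B := (25 * Θ / (4 * θ₀ ^ 2) + 1 / (2 * θ₀)) * (4 * (√Θ / √θ₀)) with hB
  refine ⟨∑ i : Fin N, (∏ _j ∈ Finset.univ.erase i, A) * (|τ| * B), fun s hs hs' w => ?_⟩
  refine (Finset.abs_sum_le_sum_abs _ _).trans (Finset.sum_le_sum fun i _ => ?_)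
  rw [abs_mul, abs_mul, abs_neg, Finset.abs_prod]
  have h1 := abs_profT_le hΘ hθ₀ (hs i) (hs' i) (inner ℝ (e i) (w - y))
  have h2 : ∏ j ∈ Finset.univ.erase i,
      |prof Θ (ε j ^ 2 + τ * (t - s)) (inner ℝ (e j) (w - y))| ≤ ∏ _j ∈ Finset.univ.erase i, A := by
    refine Finset.prod_le_prod (fun _ _ => abs_nonneg _) fun j _ => ?_
    rw [abs_of_nonneg (prof_nonneg _ _ _)]
    refine (prof_le_amp _ _ _).trans ((amp_le (hθ₀.trans_le (hs j)) _).trans ?_)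
    rw [hA]
    gcongr
    exact hs j
  have h3 : 0 ≤ ∏ _j ∈ Finset.univ.erase i, A := Finset.prod_nonneg fun _ _ => by positivity
  gcongr

end Kernel

/-- Duhamel's inequality for the product kernels. -/
theorem Bounded.kern_duhamel {N : ℕ} {b : ℝ → ℝ} {bm bM ρ C α T : ℝ} {g : ℝ → Vel N → ℝ}
    (h : Bounded b bm bM ρ C α T g) {a t : ℝ} (ha : 0 < a) (hat : a ≤ t) (htT : t ≤ T)
    (e : OrthonormalBasis (Fin N) ℝ (Vel N)) {l : ℝ} (hl : 0 < l) (hla : ρ * (t - a) ≤ l ^ 2)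
    {ε : Fin N → ℝ} (hε : ∀ i, 0 < ε i) (hεl : ∀ i, ε i ≤ l) {y : Vel N} {R Γ : ℝ}
    (hR : ‖y‖ + √(N * (25 * (2 * l ^ 2))) ≤ R) (hΓ0 : 0 ≤ Γ)
    (hΓ : ∀ s ∈ Icc a t, Γ ≤ gain α b (g s) (kern e (2 * l ^ 2) (ρ * (1 - α)) t ε y s)) :
    Real.exp (-rate N bM C R * (t - a)) *
        ((∫ v, g a v * kern e (2 * l ^ 2) (ρ * (1 - α)) t ε y a v) + Γ * (t - a)) ≤
      ∫ v, g t v * kern e (2 * l ^ 2) (ρ * (1 - α)) t ε y t v := by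
  set Θ := 2 * l ^ 2 with hΘ
  set τ := ρ * (1 - α) with hτ
  have hΘ0 : 0 < Θ := by positivity
  have hτ0 : 0 ≤ τ := mul_nonneg h.hρ.le (by linarith [h.hα1])
  have hτρ : τ ≤ ρ := by rw [hτ]; nlinarith [h.hρ, h.hα0]
  obtain ⟨ε₀, hε₀, hε₀'⟩ : ∃ ε₀ > 0, ∀ i, ε₀ ≤ ε i := by
    by_cases hN : Nonempty (Fin N)
    · obtain ⟨i, hi⟩ := Finite.exists_min ε
      exact ⟨ε i, hε i, hi⟩
    · exact ⟨1, one_pos, fun i => absurd ⟨i⟩ hN⟩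
  set θ₀ := ε₀ ^ 2 / 2 with hθ₀
  have hθ₀0 : 0 < θ₀ := by positivity
  set I : Set ℝ := {s | ∀ i, θ₀ < ε i ^ 2 + τ * (t - s) ∧ ε i ^ 2 + τ * (t - s) < 2 * Θ} with hI
  have hIo : IsOpen I := by
    have : I = ⋂ i, {s | θ₀ < ε i ^ 2 + τ * (t - s) ∧ ε i ^ 2 + τ * (t - s) < 2 * Θ} := by
      ext s; simp [hI]
    rw [this]
    refine isOpen_iInter_of_finite fun i => ?_
    have hc : Continuous fun s => ε i ^ 2 + τ * (t - s) := by fun_prop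
    exact (isOpen_lt continuous_const hc).inter (isOpen_lt hc continuous_const)
  have hsub : Icc a t ⊆ I := by
    intro s hs i
    have h1 : 0 ≤ τ * (t - s) := mul_nonneg hτ0 (sub_nonneg.2 hs.2)
    have h2 : τ * (t - s) ≤ ρ * (t - a) :=
      mul_le_mul hτρ (by linarith [hs.1]) (sub_nonneg.2 hs.2) h.hρ.le
    have h3 : ε i ^ 2 ≤ l ^ 2 := pow_le_pow_left₀ (hε i).le (hεl i) 2
    have h4 : ε₀ ^ 2 ≤ ε i ^ 2 := pow_le_pow_left₀ hε₀.le (hε₀' i) 2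
    have h5 : 0 < ε₀ ^ 2 := by positivity
    have h6 : 0 < l ^ 2 := by positivity
    constructor
    · rw [hθ₀]; linarith
    · rw [hΘ]; linarith
  have hIpos : ∀ s ∈ I, ∀ i, 0 < ε i ^ 2 + τ * (t - s) := fun s hs i => hθ₀0.trans (hs i).1
  obtain ⟨M', hM'⟩ := exists_bound_kernT e y (Θ := Θ) (τ := τ) (t := t) (ε := ε) hΘ0 hθ₀0
  refine h.duhamel ha hat htT hIo hsub (R := R) (M := (4 * (√Θ / √θ₀)) ^ N) (M' := M')
    (ψ' := kernT e Θ τ t ε y) ?_ (fun s _ => contDiff_kern ..) (fun s hs v hv => ?_)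
    (fun s hs v => kern_le e y hθ₀0 (fun i => (hs i).1.le) v)
    (fun s hs v => hasDerivAt_kern e y (hIpos s hs) v)
    (fun s _ => continuous_kernT ..) (fun s hs => hM' s (fun i => (hs i).1.le)
      (fun i => (hs i).2.le)) (fun s _ v => kern_nonneg ..)
    (fun s hs v => kern_subsolution e y hτ0 (hIpos s (hsub hs)) v) hΓ0 hΓ
  · exact le_trans (by positivity) hR
  · refine kern_eq_zero e y hΘ0 (hIpos s hs) (fun i => (hs i).2.le) ?_
    have := norm_sub_norm_le v y
    linarith

/-! ### Boxes, spherical caps and spherical slabs -/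

lemma exists_basis {N : ℕ} (i₀ : Fin N) {n : Vel N} (hn : ‖n‖ = 1) :
    ∃ e : OrthonormalBasis (Fin N) ℝ (Vel N), e i₀ = n := by
  have h : Orthonormal ℝ (({i₀} : Set (Fin N)).domRestrict (fun _ => n)) := by
    constructor
    · intro i; simpa using hn
    · intro i j hij
      exact absurd (Subsingleton.elim i j) hij
  obtain ⟨e, he⟩ := h.exists_orthonormalBasis_extension_of_card_eq (by simp)
  exact ⟨e, he i₀ rfl⟩

lemma measurePreserving_coords {N : ℕ} (e : OrthonormalBasis (Fin N) ℝ (Vel N)) :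
    MeasurePreserving (fun w : Vel N => fun i => (inner ℝ (e i) w : ℝ)) := by
  have h := (PiLp.volume_preserving_ofLp (Fin N)).comp e.measurePreserving_repr
  have he : (fun w : Vel N => fun i => (inner ℝ (e i) w : ℝ)) = WithLp.ofLp ∘ e.repr := by
    funext w i
    simp [e.repr_apply_apply]
  rw [he]
  exact h

/-- The box with centre `y` and half-sides `r i` along an orthonormal basis. -/
def box {N : ℕ} (e : OrthonormalBasis (Fin N) ℝ (Vel N)) (y : Vel N) (r : Fin N → ℝ) :
    Set (Vel N) := {w | ∀ i, |inner ℝ (e i) (w - y)| ≤ r i}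

lemma box_eq_preimage {N : ℕ} (e : OrthonormalBasis (Fin N) ℝ (Vel N)) (y : Vel N)
    (r : Fin N → ℝ) : box e y r = (fun w : Vel N => fun i => (inner ℝ (e i) w : ℝ)) ⁻¹'
      Icc (fun i => inner ℝ (e i) y - r i) (fun i => inner ℝ (e i) y + r i) := by
  ext w
  simp only [box, mem_ofPred_eq, mem_preimage, mem_Icc, Pi.le_def, inner_sub_right, abs_le]
  constructor
  · intro h
    exact ⟨fun i => by linarith [(h i).1], fun i => by linarith [(h i).2]⟩
  · rintro ⟨h1, h2⟩ i
    exact ⟨by linarith [h1 i], by linarith [h2 i]⟩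

lemma measurableSet_box {N : ℕ} (e : OrthonormalBasis (Fin N) ℝ (Vel N)) (y : Vel N)
    (r : Fin N → ℝ) : MeasurableSet (box e y r) := by
  rw [box_eq_preimage]
  exact (measurePreserving_coords e).measurable measurableSet_Icc

lemma volume_box {N : ℕ} (e : OrthonormalBasis (Fin N) ℝ (Vel N)) (y : Vel N)
    (r : Fin N → ℝ) : volume (box e y r) = ∏ i, ENNReal.ofReal (2 * r i) := by
  rw [box_eq_preimage, (measurePreserving_coords e).measure_preimage
    measurableSet_Icc.nullMeasurableSet, Real.volume_Icc_pi]
  refine Finset.prod_congr rfl fun i _ => ?_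
  congr 1; ring

/-- The surface measure of `S` is bounded below by the volume of a part of the cone over `S`. -/
lemma le_surf_of_cone {N : ℕ} {S : Set (Sph N)} (hS : MeasurableSet S) {D : Set (Vel N)}
    (hD0 : ∀ x ∈ D, x ≠ 0) (hD1 : ∀ x ∈ D, ‖x‖ < 1)
    (hD : ∀ x ∈ D, ∀ σ : Sph N, x = ‖x‖ • (σ : Vel N) → σ ∈ S) :
    (N : ℝ≥0∞) * volume D ≤ surf N S := by
  rw [surf, Measure.toSphere_apply' _ hS]
  simp only [finrank_euclideanSpace, Fintype.card_fin]
  gcongr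
  intro x hx
  have hx0 : 0 < ‖x‖ := norm_pos_iff.2 (hD0 x hx)
  have hu : ‖‖x‖⁻¹ • x‖ = 1 := by
    rw [norm_smul, norm_inv, norm_norm, inv_mul_cancel₀ hx0.ne']
  have e : x = ‖x‖ • (‖x‖⁻¹ • x) := by rw [smul_smul, mul_inv_cancel₀ hx0.ne', one_smul]
  refine Set.mem_smul.2 ⟨‖x‖, ⟨hx0, hD1 x hx⟩, ‖x‖⁻¹ • x,
    ⟨⟨‖x‖⁻¹ • x, by simpa using hu⟩, hD x hx _ e, rfl⟩, e.symm⟩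

/-- A spherical cap of radius `a` has measure at least of order `a ^ (N - 1)`. -/
lemma exists_le_surf_cap (N : ℕ) (hN : 0 < N) : ∃ c > 0, ∀ (σ₀ : Vel N), ‖σ₀‖ = 1 →
    ∀ a : ℝ, 0 < a → a ≤ 1 →
      c * a ^ (N - 1) ≤ (surf N).real {σ : Sph N | ‖(σ : Vel N) - σ₀‖ ≤ a} := by
  have hNr : (0 : ℝ) < N := by exact_mod_cast hN
  have hsN : 0 < √(N : ℝ) := Real.sqrt_pos.2 hNr
  refine ⟨N * (1 / 2 * (1 / (4 * √N)) ^ (N - 1)), by positivity, fun σ₀ hσ₀ a ha ha1 => ?_⟩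
  obtain ⟨e, he⟩ := exists_basis (⟨0, hN⟩ : Fin N) hσ₀
  set i₀ : Fin N := ⟨0, hN⟩
  set r : Fin N → ℝ := fun i => if i = i₀ then 1 / 4 else a / (8 * √N) with hr
  have hS : MeasurableSet {σ : Sph N | ‖(σ : Vel N) - σ₀‖ ≤ a} :=
    (isClosed_le (by fun_prop) continuous_const).measurableSet
  -- coordinates of the points of the box
  have hz : ∀ x ∈ box e ((1 / 2 : ℝ) • σ₀) r, |inner ℝ σ₀ x - 1 / 2| ≤ 1 / 4 ∧
      ‖x - (inner ℝ σ₀ x : ℝ) • σ₀‖ ≤ a / 8 := by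
    intro x hx
    constructor
    · have h := hx i₀
      simp only [hr, if_true, he, inner_sub_right, inner_smul_right,
        real_inner_self_eq_norm_sq, hσ₀] at h
      simpa using h
    · have h1 : ∀ i, inner ℝ (e i) (x - (inner ℝ σ₀ x : ℝ) • σ₀) ^ 2 ≤ (a / (8 * √N)) ^ 2 := by
        intro i
        rw [inner_sub_right, inner_smul_right, ← he, orthonormal_iff_ite.1 e.orthonormal]
        by_cases hi : i = i₀
        · subst hi; simp; positivity
        · have h := hx i
          simp only [hr, if_neg hi, inner_sub_right, inner_smul_right, ← he,
            orthonormal_iff_ite.1 e.orthonormal] at h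
          rw [if_neg hi]
          simp only [mul_zero, sub_zero] at h ⊢
          rw [← sq_abs]
          gcongr
      have h2 := norm_le_of_coords e h1
      have h3 : √(N * (a / (8 * √N)) ^ 2) = a / 8 := by
        rw [Real.sqrt_eq_iff_mul_self_eq (by positivity) (by positivity)]
        have := Real.mul_self_sqrt hNr.le
        field_simp
        nlinarith
      rwa [h3] at h2
  have hnorm : ∀ x ∈ box e ((1 / 2 : ℝ) • σ₀) r, 1 / 4 ≤ ‖x‖ ∧ ‖x‖ < 1 := by
    intro x hx
    obtain ⟨h1, h2⟩ := hz x hx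
    rw [abs_le] at h1
    have h3 : inner ℝ σ₀ x ≤ ‖x‖ := by
      have := real_inner_le_norm σ₀ x
      rwa [hσ₀, one_mul] at this
    have h4 : ‖x‖ ≤ ‖x - (inner ℝ σ₀ x : ℝ) • σ₀‖ + ‖(inner ℝ σ₀ x : ℝ) • σ₀‖ := by
      have := norm_add_le (x - (inner ℝ σ₀ x : ℝ) • σ₀) ((inner ℝ σ₀ x : ℝ) • σ₀)
      rwa [sub_add_cancel] at this
    rw [norm_smul, hσ₀, mul_one, Real.norm_of_nonneg (by linarith)] at h4
    constructor <;> linarith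
  have key := le_surf_of_cone hS (D := box e ((1 / 2 : ℝ) • σ₀) r)
    (fun x hx h0 => by have := (hnorm x hx).1; rw [h0, norm_zero] at this; linarith)
    (fun x hx => (hnorm x hx).2) (fun x hx σ hσ => by
      obtain ⟨h1, h2⟩ := hz x hx
      obtain ⟨h3, -⟩ := hnorm x hx
      rw [abs_le] at h1
      -- `‖x‖ (σ - σ₀) = (x - z σ₀) + (z - ‖x‖) σ₀` with `|z - ‖x‖| ≤ |x - z σ₀|`
      set z : ℝ := inner ℝ σ₀ x with hzdef
      have h4 : |z - ‖x‖| ≤ a / 8 := by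
        have := abs_norm_sub_norm_le (z • σ₀) x
        rw [norm_smul, hσ₀, mul_one, Real.norm_of_nonneg (by linarith), norm_sub_rev] at this
        exact this.trans h2
      have h5 : ‖x‖ • ((σ : Vel N) - σ₀) = (x - z • σ₀) + (z - ‖x‖) • σ₀ := by
        rw [smul_sub, ← hσ, sub_smul]; abel
      have h6 : ‖x‖ * ‖(σ : Vel N) - σ₀‖ ≤ a / 4 := by
        have := norm_add_le (x - z • σ₀) ((z - ‖x‖) • σ₀)
        rw [← h5, norm_smul, norm_norm, norm_smul, hσ₀, mul_one, Real.norm_eq_abs] at this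
        linarith
      change ‖(σ : Vel N) - σ₀‖ ≤ a
      nlinarith [norm_nonneg ((σ : Vel N) - σ₀)])
  rw [volume_box] at key
  have h1 : ∏ i, ENNReal.ofReal (2 * r i) =
      ENNReal.ofReal (1 / 2 * (a / (4 * √N)) ^ (N - 1)) := by
    rw [← ENNReal.ofReal_prod_of_nonneg]
    · congr 1
      rw [← Finset.mul_prod_erase _ _ (Finset.mem_univ i₀)]
      have : ∀ i ∈ Finset.univ.erase i₀, 2 * r i = a / (4 * √N) := by
        intro i hi
        simp only [hr, if_neg (Finset.ne_of_mem_erase hi)]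
        field_simp; norm_num
      rw [Finset.prod_congr rfl this, Finset.prod_const, Finset.card_erase_of_mem
        (Finset.mem_univ _), Finset.card_univ, Fintype.card_fin]
      simp only [hr, if_true]
      norm_num
    · intro i _
      simp only [hr]
      split_ifs <;> positivity
  rw [h1, ← ENNReal.ofReal_natCast, ← ENNReal.ofReal_mul hNr.le] at key
  have := (ENNReal.ofReal_le_iff_le_toReal (measure_ne_top _ _)).1 key
  refine le_trans (le_of_eq ?_) this
  rw [div_eq_mul_one_div a, mul_pow]
  ring

/-- The cone over a slab of the sphere near its boundary: here `z` is the coordinate along the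
normal, `S` the square of the distance to the axis and `Q` the norm of the point of the cone
`z = P ‖x‖` with the same `S`. -/
lemma slab_arith {P S Q z X a : ℝ} (hX : 0 ≤ X) (hXz : X ^ 2 = z ^ 2 + S) (hS : 1 / 72 ≤ S)
    (hS' : S ≤ 1 / 9) (hQ0 : 0 ≤ Q) (hQ2 : Q ^ 2 * (1 - P ^ 2) = S) (hP : |P| ≤ 3 / 4)
    (ha : 0 < a) (ha1 : a ≤ 1) (hz : |z - P * Q| ≤ a / 18) :
    1 / 9 ≤ X ∧ X < 1 ∧ |z - P * X| ≤ a * X := by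
  have hP2 : P ^ 2 ≤ 9 / 16 := by
    rw [← sq_abs]; nlinarith [abs_nonneg P]
  have hQ1 : Q ≤ 51 / 100 := by
    by_contra hlt
    push Not at hlt
    nlinarith
  have hx9 : 1 / 9 ≤ X := by nlinarith [sq_nonneg z]
  have hlip : |X - Q| ≤ |z - P * Q| := by
    have h1 : (X - Q) * (X + Q) = (z - P * Q) * (z + P * Q) := by linear_combination hXz - hQ2
    have h2 : |z + P * Q| ≤ X + Q := by
      have hz1 : |z| ≤ X := abs_le_of_sq_le_sq (by linarith) hX
      have hP1 : |P * Q| ≤ Q := by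
        rw [abs_mul, abs_of_nonneg hQ0]
        nlinarith
      exact (abs_add_le _ _).trans (add_le_add hz1 hP1)
    have h3 : |X - Q| * (X + Q) = |z - P * Q| * |z + P * Q| := by
      rw [← abs_mul, ← h1, abs_mul, abs_of_nonneg (by linarith : 0 ≤ X + Q)]
    have h4 : |X - Q| * (X + Q) ≤ |z - P * Q| * (X + Q) := by
      rw [h3]; gcongr
    exact le_of_mul_le_mul_right h4 (by linarith)
  refine ⟨hx9, ?_, ?_⟩
  · have := (le_abs_self _).trans (hlip.trans hz)
    linarith
  · have h1 : z - P * X = (z - P * Q) - P * (X - Q) := by ring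
    have h2 : |P * (X - Q)| ≤ a / 18 := by
      rw [abs_mul]
      have := hlip.trans hz
      nlinarith [abs_nonneg P, abs_nonneg (X - Q)]
    rw [h1]
    refine (abs_sub _ _).trans ?_
    nlinarith

/-- The part of the sphere within distance `a` of a hyperplane cutting it well inside has measure
at least of order `a`. -/
lemma exists_le_surf_slab (N : ℕ) (hN : 2 ≤ N) : ∃ c > 0, ∀ (n : Vel N), ‖n‖ = 1 →
    ∀ P a : ℝ, |P| ≤ 3 / 4 → 0 < a → a ≤ 1 →
      c * a ≤ (surf N).real {σ : Sph N | |inner ℝ n (σ : Vel N) - P| ≤ a} := by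
  obtain ⟨k, rfl⟩ : ∃ k, N = k + 1 := ⟨N - 1, by omega⟩
  have hk1 : (1 : ℝ) ≤ k := by exact_mod_cast (by omega : 1 ≤ k)
  set s : ℝ := √((k + 1 : ℕ) : ℝ) with hs
  have hs0 : 0 < s := Real.sqrt_pos.2 (by positivity)
  have hs2 : s ^ 2 = k + 1 := by rw [hs, Real.sq_sqrt (by positivity)]; push_cast; ring
  refine ⟨((k + 1 : ℕ) : ℝ) * (1 / 9 * (1 / (6 * s)) ^ k), by positivity,
    fun n hn P a hP ha ha1 => ?_⟩
  obtain ⟨e, he⟩ := exists_basis (0 : Fin (k + 1)) hn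
  have hS : MeasurableSet {σ : Sph (k + 1) | |inner ℝ n (σ : Vel (k + 1)) - P| ≤ a} :=
    (isClosed_le (by
      have : Continuous fun σ : Sph (k + 1) => (inner ℝ n (σ : Vel (k + 1)) : ℝ) :=
        continuous_const.inner continuous_subtype_val
      fun_prop) continuous_const).measurableSet
  set q : (Fin k → ℝ) → ℝ := fun x => √((∑ i, x i ^ 2) / (1 - P ^ 2)) with hq
  have hqc : Continuous q := by
    have : Continuous fun x : Fin k → ℝ => ∑ i, x i ^ 2 := by fun_prop
    exact (this.div_const _).sqrt
  set A : Set (Fin k → ℝ) := Icc (fun _ => 1 / (6 * s)) (fun _ => 1 / (3 * s)) with hA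
  set η : ℝ := a / 18 with hη
  set D : Set (ℝ × (Fin k → ℝ)) := {p | p.2 ∈ A ∧ |p.1 - P * q p.2| ≤ η} with hD
  have hDm : MeasurableSet D := by
    have hc : Continuous fun p : ℝ × (Fin k → ℝ) => |p.1 - P * q p.2| := by
      have := hqc.comp (continuous_snd (X := ℝ) (Y := Fin k → ℝ))
      simp only [Function.comp_def] at this
      fun_prop
    exact (measurableSet_Icc.preimage measurable_snd).inter
      (isClosed_le hc continuous_const).measurableSet
  have hDv : volume D = ENNReal.ofReal (2 * η) * ENNReal.ofReal ((1 / (6 * s)) ^ k) := by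
    have hA' : volume A = ENNReal.ofReal ((1 / (6 * s)) ^ k) := by
      rw [hA, Real.volume_Icc_pi]
      rw [Finset.prod_const, Finset.card_univ, Fintype.card_fin, ← ENNReal.ofReal_pow]
      · congr 2; field_simp; norm_num
      · rw [sub_nonneg]; gcongr; norm_num
    rw [Measure.volume_eq_prod, Measure.prod_apply_symm hDm]
    have : ∀ x : Fin k → ℝ, volume ((fun z : ℝ => (z, x)) ⁻¹' D) =
        A.indicator (fun _ => ENNReal.ofReal (2 * η)) x := by
      intro x
      by_cases hx : x ∈ A
      · rw [indicator_of_mem hx]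
        have : (fun z : ℝ => (z, x)) ⁻¹' D = Metric.closedBall (P * q x) η := by
          ext z
          simp [hD, hx, Real.dist_eq]
        rw [this, Real.volume_closedBall]
      · rw [indicator_of_notMem hx]
        have : (fun z : ℝ => (z, x)) ⁻¹' D = ∅ := by
          ext z; simp [hD, hx]
        rw [this, measure_empty]
    simp only [this]
    rw [lintegral_indicator_const measurableSet_Icc, ← hA, hA']
  have hm := ((volume_preserving_piFinSuccAbove (fun _ : Fin (k + 1) => ℝ) 0).comp
    (measurePreserving_coords e))
  set m : Vel (k + 1) → ℝ × (Fin k → ℝ) :=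
    (MeasurableEquiv.piFinSuccAbove (fun _ : Fin (k + 1) => ℝ) 0)
    ∘ (fun w : Vel (k + 1) => fun i => (inner ℝ (e i) w : ℝ)) with hmdef
  have hm1 : ∀ x, (m x).1 = inner ℝ n x := fun x => by
    simp [hmdef, MeasurableEquiv.piFinSuccAbove, ← he]
  have hm2 : ∀ x i, (m x).2 i = inner ℝ (e i.succ) x := fun x i => by
    simp [hmdef, MeasurableEquiv.piFinSuccAbove, Fin.tail]
  have hnorm : ∀ x, ‖x‖ ^ 2 = (m x).1 ^ 2 + ∑ i, (m x).2 i ^ 2 := fun x => by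
    rw [norm_sq_eq_sum e, Fin.sum_univ_succ, hm1, he]
    simp only [hm2]
  have hP2 : P ^ 2 ≤ 9 / 16 := by
    rw [← sq_abs]; nlinarith [abs_nonneg P]
  have main : ∀ x ∈ m ⁻¹' D, 1 / 9 ≤ ‖x‖ ∧ ‖x‖ < 1 ∧ |(m x).1 - P * ‖x‖| ≤ a * ‖x‖ := by
    intro x hx
    obtain ⟨hx1, hx2⟩ := hx
    set z := (m x).1 with hz
    set S := ∑ i, (m x).2 i ^ 2 with hSdef
    have hlow : k * (1 / (6 * s)) ^ 2 ≤ S := by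
      have : ∑ _i : Fin k, (1 / (6 * s)) ^ 2 ≤ S := Finset.sum_le_sum fun i _ => by
        have := hx1.1 i
        gcongr
      simpa using this
    have hupp : S ≤ k * (1 / (3 * s)) ^ 2 := by
      have : S ≤ ∑ _i : Fin k, (1 / (3 * s)) ^ 2 := Finset.sum_le_sum fun i _ => by
        have h1 := hx1.1 i
        have h2 := hx1.2 i
        have : 0 < 1 / (6 * s) := by positivity
        have h3 : 0 ≤ (m x).2 i := this.le.trans h1
        gcongr
      simpa using this
    have hlow' : 1 / 72 ≤ S := by
      refine le_trans ?_ hlow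
      rw [div_pow, mul_pow, hs2, mul_div_assoc', div_le_div_iff₀ (by norm_num) (by positivity)]
      nlinarith
    have hupp' : S ≤ 1 / 9 := by
      refine hupp.trans ?_
      rw [div_pow, mul_pow, hs2, mul_div_assoc', div_le_div_iff₀ (by positivity) (by norm_num)]
      nlinarith
    have hQ2 : q (m x).2 ^ 2 * (1 - P ^ 2) = S := by
      rw [hq]
      simp only
      rw [Real.sq_sqrt (div_nonneg (by linarith) (by linarith)),
        div_mul_cancel₀ _ (by linarith : 1 - P ^ 2 ≠ 0)]
    exact slab_arith (norm_nonneg x) (hnorm x) hlow' hupp' (Real.sqrt_nonneg _) hQ2 hP ha ha1 hx2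
  have key := le_surf_of_cone hS (D := m ⁻¹' D)
    (fun x hx h0 => by have := (main x hx).1; rw [h0, norm_zero] at this; linarith)
    (fun x hx => (main x hx).2.1) (fun x hx σ hσ => by
      obtain ⟨h1, -, h3⟩ := main x hx
      change |inner ℝ n (σ : Vel (k + 1)) - P| ≤ a
      have hx0 : 0 < ‖x‖ := by linarith
      have h4 : (m x).1 = ‖x‖ * inner ℝ n (σ : Vel (k + 1)) := by
        rw [hm1]
        conv_lhs => rw [hσ]
        rw [inner_smul_right]
      rw [h4, mul_comm P, ← mul_sub, abs_mul, abs_of_pos hx0, mul_comm a] at h3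
      exact le_of_mul_le_mul_left h3 hx0)
  rw [hm.measure_preimage hDm.nullMeasurableSet, hDv, ← ENNReal.ofReal_mul (by positivity),
    ← ENNReal.ofReal_natCast, ← ENNReal.ofReal_mul (by positivity)] at key
  have := (ENNReal.ofReal_le_iff_le_toReal (measure_ne_top _ _)).1 key
  refine le_trans (le_of_eq ?_) this
  rw [hη]
  ring

/-! ### From kernels to pointwise and slab bounds -/

/-- If `∫ f K y ≥ Γ` for all parameters `y`, where the kernels `K y` live on `S` and have total
weight at most `D` at each point, then `f` has mass at least `Γ μ(Y) / D` on `S`. -/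
lemma le_setIntegral_of_kernel {N : ℕ} {Y : Type*} [MeasurableSpace Y] {μ : Measure Y}
    [IsFiniteMeasure μ] {f : Vel N → ℝ} (hf : Integrable f) (hf0 : ∀ᵐ v, 0 ≤ f v)
    {K : Y → Vel N → ℝ} (hK : Measurable (Function.uncurry K)) (hK0 : ∀ y v, 0 ≤ K y v)
    {S : Set (Vel N)} (hS : MeasurableSet S) {D Γ : ℝ} (hD : 0 ≤ D) (hΓ0 : 0 ≤ Γ)
    (hKD : ∀ v, ∫⁻ y, ENNReal.ofReal (K y v) ∂μ ≤ ENNReal.ofReal D)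
    (hKS : ∀ᵐ y ∂μ, ∀ v, v ∉ S → K y v = 0)
    (hΓ : ∀ᵐ y ∂μ, Γ ≤ ∫ v, f v * K y v) :
    Γ * μ.real univ ≤ D * ∫ v in S, f v := by
  have hKm : ∀ y, Measurable (K y) := fun y => hK.comp measurable_prodMk_left
  have h1 : ENNReal.ofReal Γ * μ univ ≤
      ∫⁻ y, (∫⁻ v, ENNReal.ofReal (f v) * ENNReal.ofReal (K y v)) ∂μ := by
    rw [← lintegral_const]
    refine lintegral_mono_ae ?_
    filter_upwards [hΓ] with y hy
    refine (ENNReal.ofReal_le_ofReal hy).trans ?_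
    rw [integral_eq_lintegral_of_nonneg_ae (f := fun v => f v * K y v)
      (by filter_upwards [hf0] with v hv using mul_nonneg hv (hK0 y v))
      (hf.1.mul (hKm y).aestronglyMeasurable)]
    refine ENNReal.ofReal_toReal_le.trans (lintegral_mono_ae ?_)
    filter_upwards [hf0] with v hv
    rw [ENNReal.ofReal_mul hv]
  have h2 : ∫⁻ y, (∫⁻ v, ENNReal.ofReal (f v) * ENNReal.ofReal (K y v)) ∂μ =
      ∫⁻ y, (∫⁻ v in S, ENNReal.ofReal (f v) * ENNReal.ofReal (K y v)) ∂μ := by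
    refine lintegral_congr_ae ?_
    filter_upwards [hKS] with y hy
    rw [← lintegral_indicator hS]
    refine lintegral_congr fun v => ?_
    by_cases hv : v ∈ S
    · rw [indicator_of_mem hv]
    · rw [indicator_of_notMem hv, hy v hv]; simp
  have h3 : ∫⁻ y, (∫⁻ v in S, ENNReal.ofReal (f v) * ENNReal.ofReal (K y v)) ∂μ =
      ∫⁻ v in S, ∫⁻ y, ENNReal.ofReal (f v) * ENNReal.ofReal (K y v) ∂μ := by
    refine lintegral_lintegral_swap ?_
    refine AEMeasurable.mul ?_ (hK.ennreal_ofReal).aemeasurable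
    exact (hf.1.aemeasurable.ennreal_ofReal.restrict).comp_snd
  have h4 : ∫⁻ v in S, ∫⁻ y, ENNReal.ofReal (f v) * ENNReal.ofReal (K y v) ∂μ ≤
      ∫⁻ v in S, ENNReal.ofReal (f v) * ENNReal.ofReal D := by
    refine lintegral_mono fun v => ?_
    rw [lintegral_const_mul' _ _ ENNReal.ofReal_ne_top]
    gcongr
    exact hKD v
  have h5 : ∫⁻ v in S, ENNReal.ofReal (f v) * ENNReal.ofReal D =
      ENNReal.ofReal (D * ∫ v in S, f v) := by
    rw [lintegral_mul_const' _ _ ENNReal.ofReal_ne_top, ENNReal.ofReal_mul hD, mul_comm,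
      ofReal_integral_eq_lintegral_ofReal hf.integrableOn (ae_restrict_of_ae hf0)]
  have h6 : ENNReal.ofReal (Γ * μ.real univ) ≤ ENNReal.ofReal (D * ∫ v in S, f v) := by
    rw [ENNReal.ofReal_mul hΓ0, Measure.real, ENNReal.ofReal_toReal (measure_ne_top _ _)]
    exact (h1.trans (h2.trans h3).le).trans (h4.trans h5.le)
  refine (ENNReal.ofReal_le_ofReal_iff (mul_nonneg hD ?_)).1 h6
  exact integral_nonneg_of_ae (ae_restrict_of_ae hf0)

lemma kern_final {N : ℕ} (e : OrthonormalBasis (Fin N) ℝ (Vel N)) (Θ τ t : ℝ) (ε : Fin N → ℝ)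
    (y w : Vel N) : kern e Θ τ t ε y t w = ∏ i, prof Θ (ε i ^ 2) (inner ℝ (e i) (w - y)) := by
  simp [kern]

lemma measurable_kern_final {N : ℕ} {Y : Type*} [MeasurableSpace Y] [TopologicalSpace Y]
    [OpensMeasurableSpace Y] [SecondCountableTopologyEither Y (Vel N)]
    (e : OrthonormalBasis (Fin N) ℝ (Vel N)) (Θ τ t : ℝ) (ε : Fin N → ℝ)
    {y : Y → Vel N} (hy : Continuous y) :
    Measurable (Function.uncurry fun p w => kern e Θ τ t ε (y p) t w) := by
  refine Continuous.measurable ?_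
  simp only [Function.uncurry_def, kern]
  refine continuous_finsetProd _ fun i _ => (contDiff_prof Θ _).continuous.comp ?_
  exact continuous_const.inner (continuous_snd.sub (hy.comp continuous_fst))

lemma prod_amp {N : ℕ} (e : OrthonormalBasis (Fin N) ℝ (Vel N)) (Θ : ℝ) {ε : ℝ} (hε : 0 < ε)
    (v : Vel N) : ∏ i, amp Θ (ε ^ 2) (inner ℝ (e i) v) =
      (4 * (√Θ / ε)) ^ N * Real.exp (-(1 / (4 * ε ^ 2)) * ‖v‖ ^ 2) := by
  simp only [amp, Real.sqrt_sq hε.le]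
  rw [Finset.prod_mul_distrib, ← Real.exp_sum, norm_sq_eq_sum e, Finset.mul_sum]
  simp only [Finset.prod_const, Finset.card_univ, Fintype.card_fin]
  congr 2
  refine Finset.sum_congr rfl fun i _ => ?_
  field_simp

lemma lintegral_gaussian_le {N : ℕ} (Θ : ℝ) {ε : ℝ} (hε : 0 < ε) (w : Vel N) (A : Set (Vel N)) :
    ∫⁻ y in A, ENNReal.ofReal
      ((4 * (√Θ / ε)) ^ N * Real.exp (-(1 / (4 * ε ^ 2)) * ‖w - y‖ ^ 2)) ≤
      ENNReal.ofReal ((8 * √(Real.pi * Θ)) ^ N) := by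
  refine (setLIntegral_le_lintegral _ _).trans ?_
  rw [lintegral_sub_left_eq_self (fun v : Vel N => ENNReal.ofReal
      ((4 * (√Θ / ε)) ^ N * Real.exp (-(1 / (4 * ε ^ 2)) * ‖v‖ ^ 2))) w]
  have hb : 0 < 1 / (4 * ε ^ 2) := by positivity
  have h1 := GaussianFourier.integral_rexp_neg_mul_sq_norm (V := Vel N) hb
  have h2 : Integrable (fun v : Vel N => Real.exp (-(1 / (4 * ε ^ 2)) * ‖v‖ ^ 2)) := by
    by_contra hni
    rw [integral_undef hni] at h1
    have : 0 < (Real.pi / (1 / (4 * ε ^ 2))) ^ ((Module.finrank ℝ (Vel N) : ℝ) / 2) :=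
      Real.rpow_pos_of_pos (by positivity) _
    linarith
  rw [← ofReal_integral_eq_lintegral_ofReal (h2.const_mul _)
    (Eventually.of_forall fun v => by positivity), integral_const_mul, h1]
  refine ENNReal.ofReal_le_ofReal (le_of_eq ?_)
  have h3 : (Real.pi / (1 / (4 * ε ^ 2))) ^ ((Module.finrank ℝ (Vel N) : ℝ) / 2) =
      (2 * ε * √Real.pi) ^ N := by
    have h4 : Real.pi / (1 / (4 * ε ^ 2)) = (2 * ε * √Real.pi) ^ (2 : ℕ) := by
      rw [mul_pow, Real.sq_sqrt Real.pi_pos.le]; field_simp; ring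
    rw [h4, ← Real.rpow_natCast, ← Real.rpow_mul (by positivity), finrank_euclideanSpace,
      Fintype.card_fin, ← Real.rpow_natCast]
    congr 1
    push_cast; ring
  rw [h3, ← mul_pow, Real.sqrt_mul Real.pi_pos.le]
  congr 1
  field_simp
  ring

/-- Lower bounds against concentrating kernels are pointwise lower bounds almost everywhere. -/
lemma ae_le_of_kern {N : ℕ} (e : OrthonormalBasis (Fin N) ℝ (Vel N)) {Θ : ℝ} (hΘ : 0 < Θ)
    (τ t : ℝ) {f : Vel N → ℝ} (hf : Integrable f) (hf0 : ∀ᵐ v, 0 ≤ f v) {U : Set (Vel N)}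
    (hU : IsOpen U) {Γ ε₁ : ℝ} (hΓ0 : 0 ≤ Γ) (hε₁ : 0 < ε₁)
    (hΓ : ∀ y ∈ U, ∀ ε, 0 < ε → ε ≤ ε₁ → Γ ≤ ∫ v, f v * kern e Θ τ t (fun _ => ε) y t v) :
    ∀ᵐ v, v ∈ U → Γ / (16 * √(Real.pi * Θ)) ^ N ≤ f v := by
  have hsΘ : 0 < √Θ := Real.sqrt_pos.2 hΘ
  have hball : ∀ x r, 0 < r → Metric.closedBall x r ⊆ U →
      Γ / (16 * √(Real.pi * Θ)) ^ N ≤ ⨍ v in Metric.closedBall x (2 * r), f v := by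
    intro x r hr hxU
    set ε := min ε₁ (r ^ 2 / (16 * (N + 1) * √Θ)) with hε
    have hε0 : 0 < ε := lt_min hε₁ (by positivity)
    have h1 : N * (16 * (ε * √Θ)) ≤ r ^ 2 := by
      have h := min_le_right ε₁ (r ^ 2 / (16 * (N + 1) * √Θ))
      rw [← hε, le_div_iff₀ (by positivity)] at h
      nlinarith [mul_pos hε0 hsΘ]
    have : IsFiniteMeasure ((volume : Measure (Vel N)).restrict (Metric.closedBall x r)) :=
      ⟨by rw [Measure.restrict_apply_univ]; exact measure_closedBall_lt_top⟩
    have key := le_setIntegral_of_kernel (μ := volume.restrict (Metric.closedBall x r)) hf hf0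
      (K := fun y w => kern e Θ τ t (fun _ => ε) y t w)
      (S := Metric.closedBall x (2 * r)) (D := (8 * √(Real.pi * Θ)) ^ N) (Γ := Γ)
      (measurable_kern_final e Θ τ t _ continuous_id) (fun y v => kern_nonneg ..)
      Metric.isClosed_closedBall.measurableSet (by positivity) hΓ0 ?_ ?_ ?_
    · rw [measureReal_restrict_apply_univ] at key
      have hv : (volume : Measure (Vel N)).real (Metric.closedBall x (2 * r)) =
          2 ^ N * (volume : Measure (Vel N)).real (Metric.closedBall x r) := by
        rw [Measure.real, Measure.real, Measure.addHaar_closedBall _ _ (by positivity),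
          Measure.addHaar_closedBall _ _ hr.le, finrank_euclideanSpace, Fintype.card_fin, mul_pow,
          ENNReal.ofReal_mul (by positivity), mul_assoc, ENNReal.toReal_mul,
          ENNReal.toReal_ofReal (by positivity)]
      have hv0 : 0 < (volume : Measure (Vel N)).real (Metric.closedBall x r) :=
        ENNReal.toReal_pos (Metric.measure_closedBall_pos _ _ hr).ne' measure_closedBall_lt_top.ne
      rw [setAverage_eq, hv, smul_eq_mul, div_le_iff₀ (by positivity)]
      have h16 : (16 * √(Real.pi * Θ)) ^ N = 2 ^ N * (8 * √(Real.pi * Θ)) ^ N := by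
        rw [← mul_pow]; congr 1; ring
      rw [h16, inv_mul_eq_div, div_mul_eq_mul_div, le_div_iff₀ (by positivity)]
      nlinarith [key, pow_pos (two_pos : (0 : ℝ) < 2) N]
    · intro w
      refine le_trans ?_ (lintegral_gaussian_le Θ hε0 w (Metric.closedBall x r))
      refine lintegral_mono fun y => ENNReal.ofReal_le_ofReal ?_
      rw [kern_final, ← prod_amp e Θ hε0]
      exact Finset.prod_le_prod (fun _ _ => prof_nonneg _ _ _) fun _ _ => prof_le_amp _ _ _
    · refine (ae_restrict_iff' Metric.isClosed_closedBall.measurableSet).2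
        (Eventually.of_forall fun y hy w hw => ?_)
      by_contra hne
      rw [kern_final] at hne
      have h2 : ∀ i, inner ℝ (e i) (w - y) ^ 2 ≤ 16 * (ε * √Θ) := by
        intro i
        by_contra hlt
        push Not at hlt
        refine hne (Finset.prod_eq_zero (Finset.mem_univ i) (prof_eq_zero hΘ (by positivity) ?_))
        rw [Real.sqrt_mul hΘ.le, Real.sqrt_sq hε0.le, mul_comm (√Θ)]
        exact hlt.le
      have h3 := norm_le_of_coords e h2
      have h4 : √(N * (16 * (ε * √Θ))) ≤ r := by
        rw [Real.sqrt_le_left hr.le]; exact h1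
      refine hw ?_
      rw [Metric.mem_closedBall] at hy ⊢
      have := dist_triangle w y x
      rw [dist_eq_norm w y] at this
      linarith
    · refine (ae_restrict_iff' Metric.isClosed_closedBall.measurableSet).2
        (Eventually.of_forall fun y hy => hΓ y (hxU hy) ε hε0 (min_le_left _ _))
  filter_upwards [IsUnifLocDoublingMeasure.ae_tendsto_average volume hf.locallyIntegrable 1]
    with x hx hxU
  obtain ⟨δ, hδ, hδU⟩ := Metric.isOpen_iff.1 hU x hxU
  have ht : Tendsto (fun n : ℕ => 2 * (δ / 2 * (1 / ((n : ℝ) + 1)))) atTop (𝓝[>] 0) := by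
    refine tendsto_nhdsWithin_iff.2 ⟨?_, Eventually.of_forall fun n => ?_⟩
    · have := (tendsto_one_div_add_atTop_nhds_zero_nat (𝕜 := ℝ)).const_mul (δ / 2) |>.const_mul 2
      simpa using this
    · rw [mem_Ioi]; positivity
  refine ge_of_tendsto (hx (fun _ => x) _ ht (Eventually.of_forall fun n => ?_))
    (Eventually.of_forall fun n => hball x (δ / 2 * (1 / ((n : ℝ) + 1))) (by positivity) ?_)
  · exact Metric.mem_closedBall_self (by positivity)
  · refine (Metric.closedBall_subset_ball ?_).trans hδU
    have : 1 / ((n : ℝ) + 1) ≤ 1 := by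
      rw [div_le_one (by positivity)]; linarith [Nat.cast_nonneg (α := ℝ) n]
    nlinarith

/-- Widths of a kernel concentrating, as `ε → 0`, on the hyperplane orthogonal to the basis vector
of index `i₀`. -/
def slabWidth {N : ℕ} (i₀ : Fin N) (l ε : ℝ) (i : Fin N) : ℝ := if i = i₀ then ε else l

lemma lintegral_amp_le (Θ : ℝ) {ε : ℝ} (hε : 0 < ε) (c : ℝ) (A : Set ℝ) :
    ∫⁻ p in A, ENNReal.ofReal (amp Θ (ε ^ 2) (c - p)) ≤ ENNReal.ofReal (8 * √(Real.pi * Θ)) := by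
  refine (setLIntegral_le_lintegral _ _).trans ?_
  rw [lintegral_sub_left_eq_self (fun v : ℝ => ENNReal.ofReal (amp Θ (ε ^ 2) v)) c]
  have e1 : amp Θ (ε ^ 2) = fun v => 4 * (√Θ / ε) * Real.exp (-(1 / (4 * ε ^ 2)) * v ^ 2) := by
    funext v
    rw [amp, Real.sqrt_sq hε.le]
    congr 2
    field_simp
  have hi : Integrable (amp Θ (ε ^ 2)) := by
    rw [e1]
    exact (integrable_exp_neg_mul_sq (by positivity)).const_mul _
  rw [← ofReal_integral_eq_lintegral_ofReal hi (Eventually.of_forall fun v => amp_nonneg _ _ _)]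
  refine ENNReal.ofReal_le_ofReal (le_of_eq ?_)
  rw [e1, integral_const_mul, integral_gaussian]
  have h4 : Real.pi / (1 / (4 * ε ^ 2)) = (2 * ε * √Real.pi) ^ 2 := by
    rw [mul_pow, Real.sq_sqrt Real.pi_pos.le]; field_simp; ring
  rw [h4, Real.sqrt_sq (by positivity), Real.sqrt_mul Real.pi_pos.le]
  field_simp
  ring

/-- Lower bounds against kernels concentrating on hyperplanes are lower bounds for the mass of
slabs. -/
lemma le_slab_of_kern {N : ℕ} (e : OrthonormalBasis (Fin N) ℝ (Vel N)) (i₀ : Fin N) {l : ℝ}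
    (hl : 0 < l) (τ t : ℝ) {f : Vel N → ℝ} (hf : Integrable f) (hf0 : ∀ᵐ v, 0 ≤ f v)
    {q : Vel N} {Γ ε₁ η : ℝ} (hΓ0 : 0 ≤ Γ) (hε₁ : 0 < ε₁) (hη : 0 < η)
    (hΓ : ∀ p : ℝ, |p| ≤ η / 2 → ∀ ε, 0 < ε → ε ≤ ε₁ →
      Γ ≤ ∫ v, f v * kern e (2 * l ^ 2) τ t (slabWidth i₀ l ε) (q + p • e i₀) t v) :
    Γ * η ≤ (8 * √(Real.pi * (2 * l ^ 2)) * 8 ^ (N - 1)) *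
      ∫ v in {v | |inner ℝ (e i₀) (v - q)| ≤ η ∧
        ‖v - q‖ ≤ √(N * (25 * (2 * l ^ 2))) + η}, f v := by
  set Θ := 2 * l ^ 2 with hΘdef
  have hΘ : 0 < Θ := by positivity
  have hsΘ : 0 < √Θ := Real.sqrt_pos.2 hΘ
  set ε := min (min ε₁ l) ((η / 2) ^ 2 / (16 * √Θ)) with hε
  have hε0 : 0 < ε := lt_min (lt_min hε₁ hl) (by positivity)
  have hεη : 16 * (ε * √Θ) ≤ (η / 2) ^ 2 := by
    have h := min_le_right (min ε₁ l) ((η / 2) ^ 2 / (16 * √Θ))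
    rw [← hε, le_div_iff₀ (by positivity)] at h
    linarith
  have hεl : ε ≤ l := (min_le_left _ _).trans (min_le_right _ _)
  have hin : ∀ (p : ℝ) (w : Vel N) (i : Fin N), inner ℝ (e i) (w - (q + p • e i₀)) =
      inner ℝ (e i) (w - q) - p * (if i = i₀ then 1 else 0) := by
    intro p w i
    rw [← sub_sub, inner_sub_right _ (w - q), inner_smul_right,
      orthonormal_iff_ite.1 e.orthonormal]
  have hpos : ∀ i, 0 < slabWidth i₀ l ε i ^ 2 := by
    intro i; unfold slabWidth; split_ifs <;> positivity
  have hle : ∀ i, slabWidth i₀ l ε i ^ 2 ≤ l ^ 2 := by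
    intro i; unfold slabWidth
    split_ifs
    · exact pow_le_pow_left₀ hε0.le hεl 2
    · exact le_rfl
  set S : Set (Vel N) := {v | |inner ℝ (e i₀) (v - q)| ≤ η ∧ ‖v - q‖ ≤ √(N * (25 * Θ)) + η} with hS
  have hSm : MeasurableSet S := by
    have hc : Continuous fun v : Vel N => |(inner ℝ (e i₀) (v - q) : ℝ)| :=
      (contDiff_coord _ _).continuous.abs
    have hc' : Continuous fun v : Vel N => ‖v - q‖ := by fun_prop
    exact ((isClosed_le hc continuous_const).inter
      (isClosed_le hc' continuous_const)).measurableSet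
  have hIcc : ∀ p ∈ Icc (-(η / 2)) (η / 2), |p| ≤ η / 2 := fun p hp => abs_le.2 hp
  have key := le_setIntegral_of_kernel (μ := volume.restrict (Icc (-(η / 2)) (η / 2))) hf hf0
    (K := fun p w => kern e Θ τ t (slabWidth i₀ l ε) (q + p • e i₀) t w)
    (S := S) (D := 8 * √(Real.pi * Θ) * 8 ^ (N - 1)) (Γ := Γ)
    (measurable_kern_final e Θ τ t _ (y := fun p : ℝ => q + p • e i₀) (by fun_prop))
    (fun y v => kern_nonneg ..)
    hSm (by positivity) hΓ0 ?_ ?_ ?_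
  · rw [measureReal_restrict_apply_univ, Real.volume_real_Icc_of_le (by linarith)] at key
    convert key using 2
    ring
  · intro w
    have h1 : ∀ p, kern e Θ τ t (slabWidth i₀ l ε) (q + p • e i₀) t w ≤
        amp Θ (ε ^ 2) (inner ℝ (e i₀) (w - q) - p) * 8 ^ (N - 1) := by
      intro p
      rw [kern_final, ← Finset.mul_prod_erase _ _ (Finset.mem_univ i₀)]
      have h8 : ∏ i ∈ Finset.univ.erase i₀, prof Θ (slabWidth i₀ l ε i ^ 2)
          (inner ℝ (e i) (w - (q + p • e i₀))) ≤ 8 ^ (N - 1) := by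
        have : ∏ i ∈ Finset.univ.erase i₀, prof Θ (slabWidth i₀ l ε i ^ 2)
            (inner ℝ (e i) (w - (q + p • e i₀))) ≤ ∏ _i ∈ Finset.univ.erase i₀, (8 : ℝ) := by
          refine Finset.prod_le_prod (fun _ _ => prof_nonneg _ _ _) fun i hi => ?_
          refine (prof_le_amp _ _ _).trans ((amp_le (hpos i) _).trans ?_)
          rw [slabWidth, if_neg (Finset.ne_of_mem_erase hi), Real.sqrt_sq hl.le, hΘdef,
            Real.sqrt_mul (by norm_num), Real.sqrt_sq hl.le, mul_div_assoc, div_self hl.ne']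
          have : √2 ≤ 2 := by rw [Real.sqrt_le_left] <;> norm_num
          linarith
        refine this.trans (le_of_eq ?_)
        rw [Finset.prod_const, Finset.card_erase_of_mem (Finset.mem_univ _), Finset.card_univ,
          Fintype.card_fin]
      have ha : prof Θ (slabWidth i₀ l ε i₀ ^ 2) (inner ℝ (e i₀) (w - (q + p • e i₀))) ≤
          amp Θ (ε ^ 2) (inner ℝ (e i₀) (w - q) - p) := by
        have := prof_le_amp Θ (slabWidth i₀ l ε i₀ ^ 2) (inner ℝ (e i₀) (w - (q + p • e i₀)))
        rw [hin, if_pos rfl, mul_one] at this ⊢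
        simpa [slabWidth] using this
      exact mul_le_mul ha h8 (Finset.prod_nonneg fun _ _ => prof_nonneg _ _ _) (amp_nonneg _ _ _)
    refine (lintegral_mono fun p => ENNReal.ofReal_le_ofReal (h1 p)).trans ?_
    simp only [ENNReal.ofReal_mul (amp_nonneg _ _ _)]
    rw [lintegral_mul_const' _ _ ENNReal.ofReal_ne_top, ENNReal.ofReal_mul (by positivity)]
    gcongr
    exact lintegral_amp_le Θ hε0 _ _
  · refine (ae_restrict_iff' measurableSet_Icc).2 (Eventually.of_forall fun p hp w hw => ?_)
    by_contra hne
    refine hw ⟨?_, ?_⟩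
    · by_contra hlt
      push Not at hlt
      rw [kern_final] at hne
      refine hne (Finset.prod_eq_zero (Finset.mem_univ i₀) (prof_eq_zero hΘ (hpos i₀) ?_))
      rw [hin, if_pos rfl, mul_one, slabWidth, if_pos rfl, Real.sqrt_mul hΘ.le,
        Real.sqrt_sq hε0.le, mul_comm (√Θ)]
      refine hεη.trans ?_
      rw [← sq_abs (_ - p)]
      have := abs_sub_abs_le_abs_sub (inner ℝ (e i₀) (w - q) : ℝ) p
      have := hIcc p hp
      gcongr
      linarith
    · by_contra hlt
      push Not at hlt
      refine hne (kern_eq_zero e _ hΘ (fun i => by simpa using hpos i) (fun i => ?_) ?_)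
      · have := hle i
        simp only [sub_self, mul_zero, add_zero]
        linarith [sq_nonneg l]
      · have h1 : w - q = (w - (q + p • e i₀)) + p • e i₀ := by abel
        have h2 := norm_add_le (w - (q + p • e i₀)) (p • e i₀)
        rw [← h1, norm_smul, e.norm_eq_one, mul_one, Real.norm_eq_abs] at h2
        have := hIcc p hp
        linarith
  · exact (ae_restrict_iff' measurableSet_Icc).2
      (Eventually.of_forall fun p hp => hΓ p (hIcc p hp) ε hε0
        ((min_le_left _ _).trans (min_le_left _ _)))

/-! ### Lower bounds created by one collision -/

/-- `κ = (1 + α) / 4`: the velocity `v'` runs over the sphere with centre `(1 - κ) v + κ w` and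
radius `κ |v - w|`. -/
def kap (α : ℝ) : ℝ := (1 + α) / 4

lemma postVel_eq {N : ℕ} (α : ℝ) (v w σ : Vel N) :
    postVel α v w σ = ((1 - kap α) • v + kap α • w) + (kap α * ‖v - w‖) • σ := by
  unfold postVel kap
  module

lemma kap_mem {α : ℝ} (h0 : 0 < α) (h1 : α < 1) : 1 / 4 ≤ kap α ∧ kap α ≤ 1 / 2 := by
  unfold kap; constructor <;> linarith

lemma integrable_postVel {N : ℕ} {ψ : Vel N → ℝ} (hψ : Continuous ψ) {M : ℝ}
    (hM : ∀ v, |ψ v| ≤ M) (α : ℝ) (v w : Vel N) :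
    Integrable (fun σ : Sph N => ψ (postVel α v w (σ : Vel N))) (surf N) := by
  have hc : Continuous (fun σ : Sph N => ψ (postVel α v w (σ : Vel N))) :=
    (hψ.comp (continuous_postVel α)).comp (by fun_prop : Continuous fun σ : Sph N => (v, w, σ))
  exact Integrable.of_bound hc.aestronglyMeasurable M (Eventually.of_forall fun σ => hM _)

lemma mul_measure_le_integral {N : ℕ} {φ : Sph N → ℝ} (hφ : Integrable φ (surf N))
    (h0 : ∀ σ, 0 ≤ φ σ) {S : Set (Sph N)} (hS : MeasurableSet S) {A : ℝ}
    (hA : ∀ σ ∈ S, A ≤ φ σ) : A * (surf N).real S ≤ ∫ σ, φ σ ∂(surf N) := by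
  calc A * (surf N).real S = ∫ σ in S, A ∂(surf N) := by
        rw [setIntegral_const, smul_eq_mul, mul_comm]
    _ ≤ ∫ σ in S, φ σ ∂(surf N) :=
        setIntegral_mono_on (integrableOn_const (measure_ne_top _ _)) hφ.integrableOn hS hA
    _ ≤ _ := setIntegral_le_integral hφ (Eventually.of_forall h0)

/-- A fixed proportion of the sphere of post-collisional velocities is seen by a kernel
concentrated on a hyperplane cutting this sphere well inside. -/
lemma exists_le_integral_slab (N : ℕ) (hN : 2 ≤ N) : ∃ c > 0, ∀ {α : ℝ}, 0 < α → α < 1 →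
    ∀ (e : OrthonormalBasis (Fin N) ℝ (Vel N)) (i₀ : Fin N) {l τ t s ε : ℝ} {v w y : Vel N},
      0 < ε → ε ≤ l → 0 ≤ τ * (t - s) → τ * (t - s) ≤ l ^ 2 → v ≠ w →
      |inner ℝ (e i₀) (y - ((1 - kap α) • v + kap α • w))| ≤ 3 / 4 * (kap α * ‖v - w‖) →
      (∀ σ : Sph N, ‖postVel α v w (σ : Vel N) - y‖ ≤ l) → kap α * ‖v - w‖ ≤ l →
      c ≤ ∫ σ : Sph N, kern e (2 * l ^ 2) τ t (slabWidth i₀ l ε) y s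
        (postVel α v w (σ : Vel N)) ∂(surf N) := by
  obtain ⟨c, hc, hslab⟩ := exists_le_surf_slab N hN
  refine ⟨c, hc, ?_⟩
  intro α hα0 hα1 e i₀ l τ t s ε v w y hε hεl hs0 hs1 hvw hP hl hul
  have hl0 : 0 < l := hε.trans_le hεl
  obtain ⟨hκ, -⟩ := kap_mem hα0 hα1
  have hu : 0 < ‖v - w‖ := norm_pos_iff.2 (sub_ne_zero.2 hvw)
  set r := kap α * ‖v - w‖ with hr
  have hr0 : 0 < r := by positivity
  set θ : Fin N → ℝ := fun i => slabWidth i₀ l ε i ^ 2 + τ * (t - s) with hθ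
  have hε2 : ε ^ 2 ≤ l ^ 2 := pow_le_pow_left₀ hε.le hεl 2
  have hθ0 : ∀ i, 0 < θ i := by
    intro i; simp only [hθ, slabWidth]; split_ifs <;> positivity
  have hθ1 : ∀ i, θ i ≤ 2 * l ^ 2 := by
    intro i; simp only [hθ, slabWidth]; split_ifs <;> linarith
  set Θ := 2 * l ^ 2 with hΘ
  have hΘ0 : 0 < √Θ := by positivity
  set a := √(θ i₀) / √Θ with ha
  have hs00 : 0 < √(θ i₀) := Real.sqrt_pos.2 (hθ0 i₀)
  have ha0 : 0 < a := by positivity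
  have ha1 : a ≤ 1 := by
    rw [ha, div_le_one hΘ0]; exact Real.sqrt_le_sqrt (hθ1 i₀)
  set cc := (1 - kap α) • v + kap α • w with hcc
  set P := inner ℝ (e i₀) (y - cc) / r with hPdef
  have hP' : |P| ≤ 3 / 4 := by
    rw [hPdef, abs_div, abs_of_pos hr0, div_le_iff₀ hr0]; exact hP
  have hM := kern_le e y (Θ := Θ) (τ := τ) (t := t) (ε := slabWidth i₀ l ε) (s := s)
    (θ₀ := ε ^ 2) (by positivity) (fun i => by
      unfold slabWidth; split_ifs <;> linarith)
  have hlΘ : l ≤ √Θ := by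
    apply Real.le_sqrt_of_sq_le; rw [hΘ]; nlinarith
  have hS : MeasurableSet {σ : Sph N | |inner ℝ (e i₀) (σ : Vel N) - P| ≤ a} := by
    have hc : Continuous fun σ : Sph N => (inner ℝ (e i₀) (σ : Vel N) : ℝ) :=
      continuous_const.inner continuous_subtype_val
    exact (isClosed_le (by fun_prop) continuous_const).measurableSet
  have key := mul_measure_le_integral (A := √Θ / √(θ i₀))
    (integrable_postVel (contDiff_kern e Θ τ t (slabWidth i₀ l ε) y s).continuous hM α v w)
    (fun σ => kern_nonneg ..) hS (fun σ hσ => by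
      have h1 : ∀ i, √Θ / √(θ i) ≤
          prof Θ (θ i) (inner ℝ (e i) (postVel α v w (σ : Vel N) - y)) := by
        intro i
        refine le_prof (hθ0 i) (hθ1 i) ?_
        by_cases hi : i = i₀
        · subst hi
          have h2 : postVel α v w (σ : Vel N) - y = r • (σ : Vel N) - (y - cc) := by
            rw [postVel_eq, ← hcc, ← hr]; abel
          rw [h2, inner_sub_right, inner_smul_right]
          have h3 : inner ℝ (e i) (y - cc) = r * P := by
            rw [hPdef]; field_simp
          rw [h3, ← mul_sub, abs_mul, abs_of_pos hr0]
          have h4 : |inner ℝ (e i) (σ : Vel N) - P| ≤ a := hσ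
          calc r * |inner ℝ (e i) (σ : Vel N) - P| ≤ √Θ * a := by
                gcongr
                exact hul.trans hlΘ
            _ = √(θ i) := by rw [ha]; field_simp
        · refine (abs_inner_le_norm' e _ i).trans ((hl σ).trans ?_)
          apply Real.le_sqrt_of_sq_le
          simp only [hθ, slabWidth, if_neg hi]
          linarith
      have h2 : ∀ i, 1 ≤ √Θ / √(θ i) := fun i => by
        rw [one_le_div (Real.sqrt_pos.2 (hθ0 i))]; exact Real.sqrt_le_sqrt (hθ1 i)
      rw [kern, ← Finset.mul_prod_erase _ _ (Finset.mem_univ i₀)]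
      have h3 : 1 ≤ ∏ i ∈ Finset.univ.erase i₀,
          prof Θ (θ i) (inner ℝ (e i) (postVel α v w (σ : Vel N) - y)) := by
        have := Finset.prod_le_prod (s := Finset.univ.erase i₀) (f := fun _ : Fin N => (1 : ℝ))
          (fun _ _ => zero_le_one) (fun i _ => (h2 i).trans (h1 i))
        simpa using this
      calc √Θ / √(θ i₀) = √Θ / √(θ i₀) * 1 := (mul_one _).symm
        _ ≤ _ := mul_le_mul (h1 i₀) h3 zero_le_one (prof_nonneg _ _ _))
  refine le_trans ?_ key
  have h5 := hslab (e i₀) (by simp) P a hP' ha0 ha1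
  calc c = √Θ / √(θ i₀) * (c * a) := by rw [ha]; field_simp
    _ ≤ _ := by gcongr

/-- The sphere of post-collisional velocities passes within distance `4η` of `y` if `w` lies within
distance `η` of the hyperplane `⟨n, w - v⟩ = |y - v| / (2κ)`, `n = (y - v) / |y - v|`. -/
lemma exists_near_postVel {N : ℕ} {α : ℝ} (h0 : 0 < α) (h1 : α < 1) {v w y : Vel N} {η : ℝ}
    (hd : 0 < ‖y - v‖) (hη : 64 * η ≤ ‖y - v‖) (hη0 : 0 < η)
    (hw : |inner ℝ (‖y - v‖⁻¹ • (y - v)) (w - v) - ‖y - v‖ / (2 * kap α)| ≤ η) :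
    ‖y - v‖ / 2 ≤ ‖v - w‖ ∧ ∃ σ₀ : Vel N, ‖σ₀‖ = 1 ∧ ‖postVel α v w σ₀ - y‖ ≤ 4 * η := by
  obtain ⟨hκ1, hκ2⟩ := kap_mem h0 h1
  set κ := kap α with hκ
  have hκ0 : 0 < κ := by linarith
  set d := ‖y - v‖ with hdd
  set x := inner ℝ (d⁻¹ • (y - v)) (w - v) with hx
  have hxin : inner ℝ (y - v) (v - w) = -(d * x) := by
    rw [hx, inner_smul_left, ← neg_sub w v, inner_neg_right]
    simp only [conj_trivial]
    field_simp
  have hdκ : d ≤ d / (2 * κ) := by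
    rw [le_div_iff₀ (by positivity)]; nlinarith
  have hxu : x ≤ ‖v - w‖ := by
    have := real_inner_le_norm (d⁻¹ • (y - v)) (w - v)
    rwa [norm_smul, norm_inv, Real.norm_of_nonneg hd.le, ← hdd, inv_mul_cancel₀ hd.ne', one_mul,
      norm_sub_rev w v] at this
  rw [abs_le] at hw
  have hu : d / 2 ≤ ‖v - w‖ := by linarith
  refine ⟨hu, ?_⟩
  set u := ‖v - w‖ with hudef
  have hu0 : 0 < u := by linarith
  set z := (y - v) + κ • (v - w) with hz
  have hz2 : ‖z‖ ^ 2 = d ^ 2 + 2 * (κ * (-(d * x))) + (κ * u) ^ 2 := by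
    rw [hz, norm_add_sq_real, inner_smul_right, hxin, norm_smul, Real.norm_of_nonneg hκ0.le]
  have herr : |‖z‖ ^ 2 - (κ * u) ^ 2| ≤ 2 * κ * d * η := by
    have : ‖z‖ ^ 2 - (κ * u) ^ 2 = -(2 * κ * d * (x - d / (2 * κ))) := by
      rw [hz2]; field_simp; ring
    rw [this, abs_neg, abs_mul, abs_of_pos (by positivity)]
    gcongr
    exact abs_le.2 hw
  have hzκ : |‖z‖ - κ * u| ≤ 4 * η := by
    have h2 : |‖z‖ - κ * u| * (‖z‖ + κ * u) ≤ 2 * κ * d * η := by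
      rw [← abs_of_nonneg (by positivity : 0 ≤ ‖z‖ + κ * u), ← abs_mul]
      have h7 : (‖z‖ - κ * u) * (‖z‖ + κ * u) = ‖z‖ ^ 2 - (κ * u) ^ 2 := by ring
      rw [h7]
      exact herr
    have h3 : |‖z‖ - κ * u| * (κ * u) ≤ |‖z‖ - κ * u| * (‖z‖ + κ * u) := by
      gcongr; linarith [norm_nonneg z]
    have h4 : 2 * κ * d * η ≤ 4 * η * (κ * u) := by
      have : 0 ≤ κ * η * (u - d / 2) :=
        mul_nonneg (by positivity) (by linarith)
      nlinarith
    exact le_of_mul_le_mul_right (h3.trans (h2.trans h4)) (by positivity)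
  have hz0 : 0 < ‖z‖ := by
    rw [abs_le] at hzκ
    nlinarith
  refine ⟨‖z‖⁻¹ • z, by rw [norm_smul, norm_inv, norm_norm, inv_mul_cancel₀ hz0.ne'], ?_⟩
  have h5 : postVel α v w (‖z‖⁻¹ • z) - y = (κ * u - ‖z‖) • (‖z‖⁻¹ • z) := by
    have h6 : ‖z‖ • (‖z‖⁻¹ • z) = z := by rw [smul_smul, mul_inv_cancel₀ hz0.ne', one_smul]
    rw [sub_smul, h6, postVel_eq, ← hκ, ← hudef, hz]
    module
  rw [h5, norm_smul, norm_smul, norm_inv, norm_norm, inv_mul_cancel₀ hz0.ne', mul_one,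
    Real.norm_eq_abs, abs_sub_comm]
  exact hzκ

/-- The proportion of the sphere of post-collisional velocities seen by a kernel concentrated
near a point of this sphere. -/
lemma exists_le_integral_cap (N : ℕ) (hN : 0 < N) : ∃ c > 0, ∀ {α : ℝ}, 0 < α → α < 1 →
    ∀ (e : OrthonormalBasis (Fin N) ℝ (Vel N)) {Θ τ t s ε θ R : ℝ} {v w y : Vel N},
      0 < θ → ε ^ 2 + τ * (t - s) = θ → θ ≤ Θ → √θ ≤ R → 4 * √θ ≤ ‖y - v‖ → ‖v - w‖ ≤ R →
      |inner ℝ (‖y - v‖⁻¹ • (y - v)) (w - v) - ‖y - v‖ / (2 * kap α)| ≤ √θ / 16 →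
      ‖y - v‖ / 2 ≤ ‖v - w‖ ∧ (√Θ / √θ) ^ N * (c * (√θ / R) ^ (N - 1)) ≤
        ∫ σ : Sph N, kern e Θ τ t (fun _ => ε) y s (postVel α v w (σ : Vel N)) ∂(surf N) := by
  obtain ⟨c, hc, hcap⟩ := exists_le_surf_cap N hN
  refine ⟨c, hc, ?_⟩
  intro α hα0 hα1 e Θ τ t s ε θ R v w y hθ hεθ hθΘ hθR hd hR hw
  have hs0 : 0 < √θ := Real.sqrt_pos.2 hθ
  have hR0 : 0 < R := hs0.trans_le hθR
  obtain ⟨-, hκ2⟩ := kap_mem hα0 hα1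
  obtain ⟨hu, σ₀, hσ₀, hσy⟩ := exists_near_postVel (y := y) hα0 hα1 (η := √θ / 16)
    (by linarith) (by linarith) (by positivity) hw
  refine ⟨hu, ?_⟩
  have hM := kern_le e y (Θ := Θ) (τ := τ) (t := t) (ε := fun _ => ε) (s := s)
    (θ₀ := θ) hθ (fun i => hεθ.ge)
  have hS : MeasurableSet {σ : Sph N | ‖(σ : Vel N) - σ₀‖ ≤ √θ / R} :=
    (isClosed_le (by fun_prop) continuous_const).measurableSet
  have key := mul_measure_le_integral (A := (√Θ / √θ) ^ N)
    (integrable_postVel (contDiff_kern e Θ τ t (fun _ => ε) y s).continuous hM α v w)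
    (fun σ => kern_nonneg ..) hS (fun σ hσ => by
      have h1 : ‖postVel α v w (σ : Vel N) - y‖ ≤ √θ := by
        have h2 : postVel α v w (σ : Vel N) - y =
            (kap α * ‖v - w‖) • ((σ : Vel N) - σ₀) + (postVel α v w σ₀ - y) := by
          rw [postVel_eq, postVel_eq]; module
        rw [h2]
        refine (norm_add_le _ _).trans ?_
        have hκ0 : 0 ≤ kap α := by unfold kap; linarith
        rw [norm_smul, Real.norm_of_nonneg (by positivity)]
        have h3 : ‖(σ : Vel N) - σ₀‖ ≤ √θ / R := hσ
        have h4 : kap α * ‖v - w‖ * ‖(σ : Vel N) - σ₀‖ ≤ 1 / 2 * R * (√θ / R) := by gcongr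
        have h5 : 1 / 2 * R * (√θ / R) = √θ / 2 := by field_simp
        linarith
      rw [kern]
      calc (√Θ / √θ) ^ N = ∏ _i : Fin N, (√Θ / √θ) := by
            rw [Finset.prod_const, Finset.card_univ, Fintype.card_fin]
        _ ≤ _ := by
            refine Finset.prod_le_prod (fun _ _ => by positivity) fun i _ => ?_
            rw [hεθ]
            exact le_prof hθ hθΘ ((abs_inner_le_norm' e _ i).trans h1))
  refine le_trans ?_ key
  have := hcap σ₀ hσ₀ (√θ / R) (by positivity) (by rw [div_le_one hR0]; exact hθR)
  gcongr

section Collision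

variable {N : ℕ} {b : ℝ → ℝ} {bm bM ρ C α T : ℝ} {g : ℝ → Vel N → ℝ}

lemma Bounded.tau_bounds (h : Bounded b bm bM ρ C α T g) {a t s l : ℝ} (hs : s ∈ Icc a t)
    (hla : ρ * (t - a) ≤ l ^ 2) :
    0 ≤ ρ * (1 - α) * (t - s) ∧ ρ * (1 - α) * (t - s) ≤ l ^ 2 := by
  have h1 := h.hα1
  have h2 := h.hα0
  have h3 := h.hρ
  have h4 : 0 ≤ t - s := sub_nonneg.2 hs.2
  have h5 : ρ * (1 - α) ≤ ρ := by nlinarith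
  refine ⟨mul_nonneg (mul_nonneg h3.le (by linarith)) h4, le_trans ?_ hla⟩
  calc ρ * (1 - α) * (t - s) ≤ ρ * (t - s) := by gcongr
    _ ≤ ρ * (t - a) := by
      have := hs.1
      gcongr

lemma Bounded.integral_kern_nonneg (h : Bounded b bm bM ρ C α T g) {s : ℝ} (hs : 0 ≤ s)
    (e : OrthonormalBasis (Fin N) ℝ (Vel N)) (Θ τ t : ℝ) (ε : Fin N → ℝ) (y : Vel N) (s' : ℝ) :
    0 ≤ ∫ v, g s v * kern e Θ τ t ε y s' v :=
  integral_nonneg_of_ae (by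
    filter_upwards [h.sol.nonneg s hs] with v hv using mul_nonneg hv (kern_nonneg ..))

end Collision

/-- Collisions between two lumps of mass spread the mass over spheres, and hence charge every slab
around a hyperplane that cuts these spheres well inside. -/
theorem exists_slab_lower (N : ℕ) (hN : 2 ≤ N) {bm : ℝ} (hbm : 0 < bm) : ∃ c > 0,
    ∀ {b : ℝ → ℝ} {bM ρ C α T : ℝ} {g : ℝ → Vel N → ℝ}, Bounded b bm bM ρ C α T g →
    ∀ {a t l R₀ R d m η : ℝ} {S₁ S₂ : Set (Vel N)} {n q : Vel N},
      0 < a → a ≤ t → t ≤ T → ρ * (t - a) ≤ l ^ 2 → MeasurableSet S₁ → MeasurableSet S₂ →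
      0 ≤ m → 0 < d → 0 < η → 8 * η ≤ d → ‖n‖ = 1 →
      (∀ s ∈ Icc a t, m ≤ ∫ v in S₁, g s v) → (∀ s ∈ Icc a t, m ≤ ∫ v in S₂, g s v) →
      (∀ v ∈ S₁, ‖v‖ ≤ R₀) → (∀ v ∈ S₂, ‖v‖ ≤ R₀) → ‖q‖ ≤ R₀ → 4 * R₀ ≤ l → η ≤ R₀ →
      R₀ + η + √(N * (25 * (2 * l ^ 2))) ≤ R →
      (∀ v ∈ S₁, ∀ w ∈ S₂, d ≤ ‖v - w‖ ∧
        |inner ℝ n (q - ((1 - kap α) • v + kap α • w))| ≤ 1 / 2 * (kap α * ‖v - w‖)) →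
      c * m ^ 2 * d * (t - a) * Real.exp (-rate N bM C R * (t - a)) / l * η ≤
        ∫ v in {v | |inner ℝ n (v - q)| ≤ η ∧ ‖v - q‖ ≤ √(N * (25 * (2 * l ^ 2))) + η}, g t v := by
  obtain ⟨c, hc, hint⟩ := exists_le_integral_slab N hN
  refine ⟨bm * c / (8 * √(Real.pi * 2) * 8 ^ (N - 1)), by positivity, ?_⟩
  intro b bM ρ C α T g h a t l R₀ R d m η S₁ S₂ n q ha hat htT hla hS₁ hS₂ hm hd hη hηd hn
    hm₁ hm₂ hR₁ hR₂ hq hl hηR hR hcol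
  have hR₀ : 0 < R₀ := hη.trans_le hηR
  have hl0 : 0 < l := by linarith
  set i₀ : Fin N := ⟨0, by omega⟩
  obtain ⟨e, he⟩ := exists_basis i₀ hn
  obtain ⟨hκ1, hκ2⟩ := kap_mem h.hα0 h.hα1
  have ht0 : 0 < t := ha.trans_le hat
  set E := Real.exp (-rate N bM C R * (t - a)) with hE
  have hEpos : 0 < E := Real.exp_pos _
  have hta : 0 ≤ t - a := sub_nonneg.2 hat
  set Γ := bm * (d * c) * m * m with hΓ
  have hΓ0 : 0 ≤ Γ := by positivity
  have key := le_slab_of_kern e i₀ hl0 (ρ * (1 - α)) t (h.sol.wInt ht0.le).integrable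
    (h.sol.nonneg t ht0.le) (q := q) (Γ := E * (Γ * (t - a))) (ε₁ := l) (η := η) (by positivity)
    hl0 hη (fun p hp ε hε hεl => by
      have hy : ‖q + p • e i₀‖ ≤ R₀ + η := by
        refine (norm_add_le _ _).trans ?_
        rw [norm_smul, e.norm_eq_one, mul_one, Real.norm_eq_abs]
        linarith
      have := h.kern_duhamel ha hat htT e hl0 hla (ε := slabWidth i₀ l ε) (y := q + p • e i₀)
        (R := R) (Γ := Γ) (fun i => by unfold slabWidth; split_ifs <;> assumption)
        (fun i => by unfold slabWidth; split_ifs <;> first | assumption | exact le_rfl)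
        (by linarith) hΓ0 (fun s hs => by
          have hs0 : 0 ≤ s := ha.le.trans hs.1
          obtain ⟨hτ0, hτ1⟩ := h.tau_bounds hs hla
          have hM := kern_le e (q + p • e i₀) (Θ := 2 * l ^ 2) (τ := ρ * (1 - α)) (t := t)
            (ε := slabWidth i₀ l ε) (s := s) (θ₀ := ε ^ 2) (by positivity) (fun i => by
              have : ε ^ 2 ≤ l ^ 2 := pow_le_pow_left₀ hε.le hεl 2
              unfold slabWidth; split_ifs <;> linarith)
          refine le_gain h.cross (h.sol.wInt hs0) (h.sol.nonneg s hs0)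
            (contDiff_kern ..).continuous (fun v => kern_nonneg ..) hM hS₁ (S₂ := fun _ => S₂)
            (fun _ _ => hS₂) (by positivity) hm (hm₁ s hs) (fun _ _ => hm₂ s hs) ?_
          intro v hv w hw
          obtain ⟨hdu, hin⟩ := hcol v hv w hw
          have hvw : v ≠ w := by
            rintro rfl
            rw [sub_self, norm_zero] at hdu
            linarith
          have hu : ‖v - w‖ ≤ 2 * R₀ := by
            have := norm_sub_le v w
            linarith [hR₁ v hv, hR₂ w hw]
          have hu0 := norm_nonneg (v - w)
          have hi := hint h.hα0 h.hα1 e i₀ (l := l) (τ := ρ * (1 - α)) (t := t) (s := s) (ε := ε)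
            (v := v) (w := w) (y := q + p • e i₀) hε hεl hτ0 hτ1 hvw ?_ ?_ ?_
          · gcongr
          · have h1 : q + p • e i₀ - ((1 - kap α) • v + kap α • w) =
                (q - ((1 - kap α) • v + kap α • w)) + p • e i₀ := by abel
            rw [h1, inner_add_right, inner_smul_right, real_inner_self_eq_norm_sq, e.norm_eq_one,
              he]
            refine (abs_add_le _ _).trans ?_
            have h2 : |p * 1 ^ 2| ≤ η / 2 := by simpa using hp
            have h3 : 1 / 4 * d ≤ kap α * ‖v - w‖ := by gcongr
            linarith
          · intro σ
            have h1 : ‖postVel α v w (σ : Vel N)‖ ≤ 2 * R₀ := by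
              rw [postVel_eq]
              refine (norm_add_le _ _).trans ((add_le_add (norm_add_le _ _) le_rfl).trans ?_)
              rw [norm_smul, norm_smul, norm_smul, Real.norm_of_nonneg (by linarith),
                Real.norm_of_nonneg (by linarith), Real.norm_of_nonneg (by positivity)]
              have h2 : ‖(σ : Vel N)‖ = 1 := by simp
              have := hR₁ v hv
              have := hR₂ w hw
              rw [h2]
              nlinarith
            have := norm_sub_le (postVel α v w (σ : Vel N)) (q + p • e i₀)
            linarith
          · nlinarith)
      refine le_trans ?_ this
      rw [← hE]
      have := h.integral_kern_nonneg ha.le e (2 * l ^ 2) (ρ * (1 - α)) t (slabWidth i₀ l ε)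
        (q + p • e i₀) a
      gcongr
      linarith)
  rw [he] at key
  have hsq : √(Real.pi * (2 * l ^ 2)) = √(Real.pi * 2) * l := by
    rw [← mul_assoc, Real.sqrt_mul (by positivity), Real.sqrt_sq hl0.le]
  rw [hsq] at key
  have hD : 0 < 8 * (√(Real.pi * 2) * l) * 8 ^ (N - 1) := by positivity
  rw [← div_le_iff₀' hD] at key
  refine le_trans (le_of_eq ?_) key
  rw [hΓ]
  field_simp

/-- Collisions of a lump of mass near `S₁` with mass charging all the slabs around the hyperplanes
`⟨n, w - v⟩ = |y - v| / (2κ)` produce a pointwise lower bound at `y`. -/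
theorem exists_point_lower (N : ℕ) (hN : 2 ≤ N) {bm : ℝ} (hbm : 0 < bm) : ∃ c > 0,
    ∀ {b : ℝ → ℝ} {bM ρ C α T : ℝ} {g : ℝ → Vel N → ℝ}, Bounded b bm bM ρ C α T g →
    ∀ {a t l R R' d m₁ m₂ : ℝ} {U : Set (Vel N)},
      0 < a → a ≤ t → t ≤ T → 0 < l → ρ * (t - a) ≤ l ^ 2 → IsOpen U →
      0 ≤ m₁ → 0 ≤ m₂ → 8 * l ≤ d → 2 * l ≤ R' →
      (∀ y ∈ U, ‖y‖ + √(N * (25 * (2 * l ^ 2))) ≤ R) →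
      (∀ y ∈ U, ∃ S₁ : Set (Vel N), MeasurableSet S₁ ∧ (∀ s ∈ Icc a t, m₁ ≤ ∫ v in S₁, g s v) ∧
        ∀ v ∈ S₁, d ≤ ‖y - v‖ ∧ ∀ s ∈ Icc a t, ∀ η, 0 < η → 8 * η ≤ l →
          m₂ * η ≤ ∫ w in {w | |inner ℝ (‖y - v‖⁻¹ • (y - v)) (w - v) -
            ‖y - v‖ / (2 * kap α)| ≤ η ∧ ‖v - w‖ ≤ R'}, g s w) →
      ∀ᵐ y, y ∈ U → c * m₁ * m₂ * d / R' ^ (N - 1) * (t - a) *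
        Real.exp (-rate N bM C R * (t - a)) ≤ g t y := by
  obtain ⟨c, hc, hint⟩ := exists_le_integral_cap N (by omega)
  refine ⟨bm * c / (32 * (16 * √Real.pi) ^ N), by positivity, ?_⟩
  intro b bM ρ C α T g h a t l R R' d m₁ m₂ U ha hat htT hl hla hU hm₁ hm₂ hld hlR hR hy
  have ht0 : 0 < t := ha.trans_le hat
  have hd : 0 < d := by linarith
  have hR'0 : 0 < R' := by linarith
  set e := EuclideanSpace.basisFun (Fin N) ℝ
  set Θ := 2 * l ^ 2 with hΘ
  have hΘ0 : 0 < Θ := by positivity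
  have hsΘ : √Θ ≤ 2 * l := by
    rw [Real.sqrt_le_left (by positivity)]; rw [hΘ]; nlinarith
  set E := Real.exp (-rate N bM C R * (t - a)) with hE
  have hEpos : 0 < E := Real.exp_pos _
  have hta : 0 ≤ t - a := sub_nonneg.2 hat
  set Γ := bm * c * m₁ * m₂ * d / 32 * √Θ ^ N / R' ^ (N - 1) with hΓ
  have hΓ0 : 0 ≤ Γ := by positivity
  have key := ae_le_of_kern e hΘ0 (ρ * (1 - α)) t (h.sol.wInt ht0.le).integrable
    (h.sol.nonneg t ht0.le) hU (Γ := E * (Γ * (t - a))) (ε₁ := l) (by positivity) hl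
    (fun y hyU ε hε hεl => by
      obtain ⟨S₁, hS₁, hS₁m, hS₁y⟩ := hy y hyU
      have := h.kern_duhamel ha hat htT e hl hla (ε := fun _ => ε) (y := y)
        (R := R) (Γ := Γ) (fun _ => hε) (fun _ => hεl) (hR y hyU) hΓ0 (fun s hs => by
          have hs0 : 0 ≤ s := ha.le.trans hs.1
          obtain ⟨hτ0, hτ1⟩ := h.tau_bounds hs hla
          have hε2 : ε ^ 2 ≤ l ^ 2 := pow_le_pow_left₀ hε.le hεl 2
          have hM := kern_le e y (Θ := Θ) (τ := ρ * (1 - α)) (t := t)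
            (ε := fun _ => ε) (s := s) (θ₀ := ε ^ 2) (by positivity) (fun i => by linarith)
          set θ := ε ^ 2 + ρ * (1 - α) * (t - s) with hθ
          have hθ0 : 0 < θ := by positivity
          have hθΘ : θ ≤ Θ := by rw [hθ, hΘ]; linarith
          have hsθ : √θ ≤ √Θ := Real.sqrt_le_sqrt hθΘ
          have hsθ0 : 0 < √θ := Real.sqrt_pos.2 hθ0
          have hlt : √θ / 16 * 8 ≤ l := by linarith
          have := le_gain (α := α) (κ₀ := d / 2 * ((√Θ / √θ) ^ N * (c * (√θ / R') ^ (N - 1))))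
            (m₁ := m₁) (m₂ := m₂ * (√θ / 16)) h.cross (h.sol.wInt hs0) (h.sol.nonneg s hs0)
            (contDiff_kern e Θ (ρ * (1 - α)) t (fun _ => ε) y s).continuous
            (fun v => kern_nonneg ..) hM hS₁
            (S₂ := fun v => {w | |inner ℝ (‖y - v‖⁻¹ • (y - v)) (w - v) -
              ‖y - v‖ / (2 * kap α)| ≤ √θ / 16 ∧ ‖v - w‖ ≤ R'})
            (fun v _ => ?_) (by positivity) (by positivity) (hS₁m s hs)
            (fun v hv => (hS₁y v hv).2 s hs _ (by positivity) (by linarith)) ?_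
          · refine le_trans (le_of_eq ?_) this
            have hpow : (√Θ / √θ) ^ N * (√θ / R') ^ (N - 1) * √θ = √Θ ^ N / R' ^ (N - 1) := by
              obtain ⟨k, rfl⟩ : ∃ k, N = k + 1 := ⟨N - 1, by omega⟩
              simp only [Nat.add_sub_cancel, div_pow]
              field_simp
              ring
            rw [hΓ]
            calc bm * c * m₁ * m₂ * d / 32 * √Θ ^ N / R' ^ (N - 1)
                = bm * c * m₁ * m₂ * d / 32 * (√Θ ^ N / R' ^ (N - 1)) := by ring
              _ = _ := by rw [← hpow]; ring
          · have hc1 : Continuous fun w : Vel N =>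
                |(inner ℝ (‖y - v‖⁻¹ • (y - v)) (w - v) : ℝ) - ‖y - v‖ / (2 * kap α)| :=
              ((contDiff_coord _ _).continuous.sub continuous_const).abs
            have hc2 : Continuous fun w : Vel N => ‖v - w‖ := by fun_prop
            exact ((isClosed_le hc1 continuous_const).inter
              (isClosed_le hc2 continuous_const)).measurableSet
          · intro v hv w hw
            have hdv := (hS₁y v hv).1
            obtain ⟨h1, h2⟩ := hint h.hα0 h.hα1 e (Θ := Θ) (τ := ρ * (1 - α)) (t := t) (s := s)
              (ε := ε) (θ := θ) (R := R') (v := v) (w := w) (y := y) hθ0 rfl hθΘ (by linarith)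
              (by linarith) hw.2 hw.1
            have h3 : d / 2 ≤ ‖v - w‖ := by linarith
            gcongr)
      refine le_trans ?_ this
      have := h.integral_kern_nonneg ha.le e Θ (ρ * (1 - α)) t (fun _ => ε) y a
      gcongr
      linarith)
  filter_upwards [key] with y hky hyU
  refine le_trans (le_of_eq ?_) (hky hyU)
  rw [hΓ, Real.sqrt_mul Real.pi_pos.le, ← mul_assoc 16, mul_pow _ (√Θ)]
  have : √Θ ≠ 0 := by positivity
  field_simp

/-! ### Spreading of a lower bound -/

lemma exists_unit_inner {N : ℕ} (hN : 2 ≤ N) (Y : Vel N) :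
    ∃ n : Vel N, ‖n‖ = 1 ∧ inner ℝ n Y = 3 / 5 * ‖Y‖ := by
  set i₀ : Fin N := ⟨0, by omega⟩
  set i₁ : Fin N := ⟨1, by omega⟩
  by_cases hY : Y = 0
  · exact ⟨EuclideanSpace.basisFun (Fin N) ℝ i₀, by simp, by simp [hY]⟩
  have hY0 : 0 < ‖Y‖ := norm_pos_iff.2 hY
  obtain ⟨e, he⟩ := exists_basis i₀ (n := ‖Y‖⁻¹ • Y)
    (by rw [norm_smul, norm_inv, norm_norm, inv_mul_cancel₀ hY0.ne'])
  have h01 : inner ℝ (e i₀) (e i₁) = (0 : ℝ) := by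
    rw [orthonormal_iff_ite.1 e.orthonormal, if_neg (by simp [i₀, i₁])]
  have hYe : Y = ‖Y‖ • e i₀ := by rw [he, smul_smul, mul_inv_cancel₀ hY0.ne', one_smul]
  refine ⟨(3 / 5 : ℝ) • e i₀ + (4 / 5 : ℝ) • e i₁, ?_, ?_⟩
  · have : ‖(3 / 5 : ℝ) • e i₀ + (4 / 5 : ℝ) • e i₁‖ ^ 2 = 1 := by
      rw [norm_add_sq_real, inner_smul_left, inner_smul_right, h01, norm_smul, norm_smul,
        e.norm_eq_one, e.norm_eq_one]
      norm_num
    nlinarith [norm_nonneg ((3 / 5 : ℝ) • e i₀ + (4 / 5 : ℝ) • e i₁)]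
  · conv_lhs => rw [hYe]
    rw [inner_smul_right, inner_add_left, inner_smul_left, inner_smul_left,
      real_inner_self_eq_norm_sq, e.norm_eq_one, real_inner_comm, h01]
    simp only [conj_trivial]
    ring

/-- The geometry of the spreading: a point `y` slightly outside the ball of radius `r` around `x₀`
is reached from velocities `v`, `w` inside this ball, for every `α`. The hyperplane of the
admissible `w` is at distance at most `0.97 r` from `x₀`. -/
lemma exists_spread_center {N : ℕ} (hN : 2 ≤ N) {x₀ y : Vel N} {r : ℝ} (hr : 0 < r)
    (hy : ‖y - x₀‖ ^ 2 ≤ 6 / 5 * r ^ 2) :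
    ∃ x₁ : Vel N, ∀ v ∈ Metric.closedBall x₁ (r / 1000), ‖v - x₀‖ < r ∧ r / 4 ≤ ‖y - v‖ ∧
      ∀ α : ℝ, 0 < α → α < 1 →
        |‖y - v‖ / (2 * kap α) + inner ℝ (‖y - v‖⁻¹ • (y - v)) (v - x₀)| ≤ 97 / 100 * r := by
  set Y := y - x₀ with hY
  obtain ⟨n, hn, hnY⟩ := exists_unit_inner hN Y
  have hY0 := norm_nonneg Y
  have hY1 : ‖Y‖ ≤ 1096 / 1000 * r := by
    by_contra hlt
    push Not at hlt
    nlinarith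
  refine ⟨y - (3 / 10 * r) • n, fun v hv => ?_⟩
  rw [Metric.mem_closedBall, dist_eq_norm] at hv
  set f := v - (y - (3 / 10 * r) • n) with hf
  have hyv : y - v = (3 / 10 * r) • n - f := by rw [hf]; abel
  have hnr : ‖(3 / 10 * r) • n‖ = 3 / 10 * r := by
    rw [norm_smul, hn, mul_one, Real.norm_of_nonneg (by positivity)]
  have hD1 : ‖y - v‖ ≤ 301 / 1000 * r := by
    have := norm_sub_le ((3 / 10 * r) • n) f
    rw [← hyv, hnr] at this
    linarith
  have hD2 : 299 / 1000 * r ≤ ‖y - v‖ := by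
    have := norm_sub_norm_le ((3 / 10 * r) • n) f
    rw [← hyv, hnr] at this
    linarith
  have hD0 : 0 < ‖y - v‖ := by nlinarith
  refine ⟨?_, by linarith, fun α hα0 hα1 => ?_⟩
  · have h1 : ‖Y - (3 / 10 * r) • n‖ ^ 2 ≤ (947 / 1000 * r) ^ 2 := by
      rw [norm_sub_sq_real, hnr, inner_smul_right, real_inner_comm, hnY]
      have h2 : 0 ≤ ‖Y‖ * (1096 / 1000 * r - ‖Y‖) := mul_nonneg hY0 (by linarith)
      nlinarith
    have h2 : ‖Y - (3 / 10 * r) • n‖ ≤ 947 / 1000 * r :=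
      le_of_sq_le_sq h1 (by positivity)
    have h3 : v - x₀ = (Y - (3 / 10 * r) • n) + f := by rw [hf, hY]; abel
    rw [h3]
    have := norm_add_le (Y - (3 / 10 * r) • n) f
    linarith
  · obtain ⟨hκ1, hκ2⟩ := kap_mem hα0 hα1
    set κ := kap α
    set D := ‖y - v‖ with hD
    set m := D⁻¹ • (y - v) with hm
    have hmv : inner ℝ m (y - v) = D := by
      rw [hm, inner_smul_left, real_inner_self_eq_norm_sq, ← hD]
      simp only [conj_trivial]
      field_simp
    have h1 : inner ℝ m (v - x₀) = inner ℝ m Y - D := by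
      rw [← hmv, ← inner_sub_right, hY]; congr 1; abel
    have h2 : D * inner ℝ m Y = 3 / 10 * r * (3 / 5 * ‖Y‖) - inner ℝ f Y := by
      rw [hm, inner_smul_left, hyv, inner_sub_left, inner_smul_left, hnY]
      simp only [conj_trivial]
      field_simp
    have h3 : |inner ℝ f Y| ≤ r / 1000 * ‖Y‖ :=
      (abs_real_inner_le_norm f Y).trans (by gcongr)
    rw [abs_le] at h3
    have h4 : 0 ≤ inner ℝ m Y := by
      by_contra hlt
      push Not at hlt
      nlinarith [mul_nonneg hr.le hY0]
    have h5 : inner ℝ m Y ≤ 6635 / 10000 * r := by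
      by_contra hlt
      push Not at hlt
      have : 299 / 1000 * r * (6635 / 10000 * r) < D * inner ℝ m Y :=
        mul_lt_mul' hD2 hlt (by positivity) hD0
      nlinarith [mul_le_mul_of_nonneg_left hY1 hr.le]
    have h6 : D ≤ D / (2 * κ) := by
      rw [le_div_iff₀ (by linarith)]; nlinarith
    have h7 : D / (2 * κ) ≤ 2 * D := by
      rw [div_le_iff₀ (by linarith)]; nlinarith
    rw [h1, abs_le]
    constructor <;> linarith

lemma mul_volume_le_setIntegral {N : ℕ} {f : Vel N → ℝ} (hf : Integrable f)
    (hf0 : ∀ᵐ v, 0 ≤ f v) {B A S : Set (Vel N)} {δ : ℝ} (hB : ∀ᵐ v, v ∈ B → δ ≤ f v)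
    (hA : MeasurableSet A) (hAv : volume A ≠ ⊤) (hAB : A ⊆ B) (hAS : A ⊆ S) :
    δ * volume.real A ≤ ∫ v in S, f v := by
  calc δ * volume.real A = ∫ v in A, δ := by
        rw [setIntegral_const, smul_eq_mul, mul_comm]
    _ ≤ ∫ v in A, f v := by
        refine setIntegral_mono_on_ae (integrableOn_const hAv) hf.integrableOn hA ?_
        filter_upwards [hB] with v hv hvA using hv (hAB hvA)
    _ ≤ _ := setIntegral_mono_set hf.integrableOn (ae_restrict_of_ae hf0)
        (Eventually.of_forall hAS)

/-- The part of the ball of radius `r` near a hyperplane at distance at most `0.97 r` of its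
centre. -/
lemma exists_box_slab {N : ℕ} (hN : 2 ≤ N) {x₀ v n : Vel N} {r h η : ℝ} (hr : 0 < r)
    (hn : ‖n‖ = 1) (hη : 0 < η) (hηr : η ≤ r / 100) (hv : ‖v - x₀‖ < r)
    (hh : |h + inner ℝ n (v - x₀)| ≤ 97 / 100 * r) :
    ∃ A : Set (Vel N), MeasurableSet A ∧ volume A ≠ ⊤ ∧ A ⊆ Metric.ball x₀ r ∧
      A ⊆ {w | |inner ℝ n (w - v) - h| ≤ η ∧ ‖v - w‖ ≤ 3 * r} ∧
      volume.real A = 2 * η * (r / (5 * √N)) ^ (N - 1) := by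
  have hNr : (0 : ℝ) < N := by exact_mod_cast (by omega : 0 < N)
  have hsN : 0 < √(N : ℝ) := Real.sqrt_pos.2 hNr
  set i₀ : Fin N := ⟨0, by omega⟩
  obtain ⟨e, he⟩ := exists_basis i₀ hn
  set s := h + inner ℝ n (v - x₀) with hs
  set p := x₀ + s • n with hp
  set ρ : Fin N → ℝ := fun i => if i = i₀ then η else r / (10 * √N) with hρ
  have hball : box e p ρ ⊆ Metric.ball x₀ r := by
    intro w hw
    rw [Metric.mem_ball, dist_eq_norm]
    have h1 : ∀ i, inner ℝ (e i) (w - x₀) =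
        inner ℝ (e i) (w - p) + s * (if i = i₀ then 1 else 0) := by
      intro i
      have : w - x₀ = (w - p) + s • n := by rw [hp]; abel
      rw [this, inner_add_right, inner_smul_right, ← he, orthonormal_iff_ite.1 e.orthonormal]
    have h2 : ‖w - x₀‖ ^ 2 ≤ (98 / 100 * r) ^ 2 + r ^ 2 / 100 := by
      rw [norm_sq_eq_sum e, ← Finset.add_sum_erase _ _ (Finset.mem_univ i₀)]
      have h3 : inner ℝ (e i₀) (w - x₀) ^ 2 ≤ (98 / 100 * r) ^ 2 := by
        rw [h1, if_pos rfl, mul_one, ← sq_abs]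
        have h4 : |inner ℝ (e i₀) (w - p)| ≤ η := by
          have := hw i₀
          simp only [hρ, if_true] at this
          exact this
        have h5 := abs_add_le (inner ℝ (e i₀) (w - p)) s
        gcongr
        linarith
      have h4 : ∑ i ∈ Finset.univ.erase i₀, inner ℝ (e i) (w - x₀) ^ 2 ≤
          ∑ _i ∈ Finset.univ.erase i₀, r ^ 2 / (100 * N) := by
        refine Finset.sum_le_sum fun i hi => ?_
        have hne := Finset.ne_of_mem_erase hi
        rw [h1, if_neg hne, mul_zero, add_zero, ← sq_abs]
        have h5 : |inner ℝ (e i) (w - p)| ≤ r / (10 * √N) := by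
          have := hw i
          simp only [hρ, if_neg hne] at this
          exact this
        calc |inner ℝ (e i) (w - p)| ^ 2 ≤ (r / (10 * √N)) ^ 2 := by gcongr
          _ = r ^ 2 / (100 * N) := by
            rw [div_pow, mul_pow, Real.sq_sqrt hNr.le]; norm_num
      have h5 : ∑ _i ∈ Finset.univ.erase i₀, r ^ 2 / (100 * N) ≤ r ^ 2 / 100 := by
        rw [Finset.sum_const, Finset.card_erase_of_mem (Finset.mem_univ _), Finset.card_univ,
          Fintype.card_fin, nsmul_eq_mul]
        have : ((N - 1 : ℕ) : ℝ) ≤ N := by exact_mod_cast Nat.sub_le N 1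
        calc ((N - 1 : ℕ) : ℝ) * (r ^ 2 / (100 * N)) ≤ N * (r ^ 2 / (100 * N)) := by gcongr
          _ = r ^ 2 / 100 := by field_simp
      linarith
    by_contra hlt
    push Not at hlt
    nlinarith
  refine ⟨box e p ρ, measurableSet_box .., ?_, hball, ?_, ?_⟩
  · rw [volume_box]
    exact (ENNReal.prod_lt_top fun i _ => ENNReal.ofReal_lt_top).ne
  · intro w hw
    constructor
    · have h4 : |inner ℝ (e i₀) (w - p)| ≤ η := by
        have := hw i₀
        simp only [hρ, if_true] at this
        exact this
      have h5 : inner ℝ n (w - v) - h = inner ℝ (e i₀) (w - p) := by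
        have h6 : inner ℝ n (w - p) = inner ℝ n (w - v) + inner ℝ n (v - x₀) - s := by
          have : w - p = ((w - v) + (v - x₀)) - s • n := by rw [hp]; abel
          rw [this, inner_sub_right n ((w - v) + (v - x₀)), inner_add_right, inner_smul_right,
            real_inner_self_eq_norm_sq, hn]
          ring
        rw [he, h6, hs]
        ring
      rw [h5]; exact h4
    · have h1 := hball hw
      rw [Metric.mem_ball, dist_eq_norm] at h1
      have h2 : v - w = (v - x₀) - (w - x₀) := by abel
      rw [h2]
      have := norm_sub_le (v - x₀) (w - x₀)
      linarith
  · rw [Measure.real, volume_box, ENNReal.toReal_prod, ← Finset.mul_prod_erase _ _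
      (Finset.mem_univ i₀)]
    have h1 : ∀ i ∈ Finset.univ.erase i₀, (ENNReal.ofReal (2 * ρ i)).toReal = r / (5 * √N) := by
      intro i hi
      rw [hρ]
      simp only [if_neg (Finset.ne_of_mem_erase hi)]
      rw [ENNReal.toReal_ofReal (by positivity)]
      field_simp; norm_num
    rw [Finset.prod_congr rfl h1, Finset.prod_const, Finset.card_erase_of_mem
        (Finset.mem_univ _), Finset.card_univ, Fintype.card_fin]
    simp only [hρ, if_true]
    rw [ENNReal.toReal_ofReal (by positivity)]

/-- A lower bound on a ball of radius `r` spreads to the ball of radius `√(6/5) r`. -/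
theorem exists_spread (N : ℕ) (hN : 2 ≤ N) {bm : ℝ} (hbm : 0 < bm) : ∃ c > 0,
    ∀ {b : ℝ → ℝ} {bM ρ C α T : ℝ} {g : ℝ → Vel N → ℝ}, Bounded b bm bM ρ C α T g →
    ∀ {a t l R r δ : ℝ} {x₀ : Vel N}, 0 < a → a ≤ t → t ≤ T → 0 < l → ρ * (t - a) ≤ l ^ 2 →
      0 < r → 32 * l ≤ r → 0 ≤ δ → ‖x₀‖ + 2 * r + √(N * (25 * (2 * l ^ 2))) ≤ R →
      (∀ s ∈ Icc a t, ∀ᵐ v, v ∈ Metric.ball x₀ r → δ ≤ g s v) →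
      ∀ᵐ v, v ∈ Metric.ball x₀ (√(6 / 5) * r) →
        c * δ ^ 2 * r ^ (N + 1) * (t - a) * Real.exp (-rate N bM C R * (t - a)) ≤ g t v := by
  obtain ⟨c, hc, hpt⟩ := exists_point_lower N hN hbm
  have hNr : (0 : ℝ) < N := by exact_mod_cast (by omega : 0 < N)
  have hsN : 0 < √(N : ℝ) := Real.sqrt_pos.2 hNr
  set vb := (volume : Measure (Vel N)).real (Metric.ball 0 1) with hvb
  have hvb0 : 0 < vb :=
    ENNReal.toReal_pos (Metric.measure_ball_pos _ _ one_pos).ne' measure_ball_lt_top.ne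
  refine ⟨c * ((1 / 1000) ^ N * vb) * (2 * (1 / (5 * √N)) ^ (N - 1)) * (1 / 4) / 3 ^ (N - 1),
    by positivity, ?_⟩
  intro b bM ρ C α T g h a t l R r δ x₀ ha hat htT hl hla hr hlr hδ hR hball
  have key := hpt h (R := R) (R' := 3 * r) (d := r / 4)
    (m₁ := δ * ((r / 1000) ^ N * vb)) (m₂ := δ * (2 * (r / (5 * √N)) ^ (N - 1)))
    (U := Metric.ball x₀ (√(6 / 5) * r))
    ha hat htT hl hla Metric.isOpen_ball (by positivity) (by positivity) (by linarith)
    (by linarith) (fun y hy => ?_) (fun y hy => ?_)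
  · filter_upwards [key] with y hky hyU
    refine le_trans (le_of_eq ?_) (hky hyU)
    obtain ⟨k, rfl⟩ : ∃ k, N = k + 1 := ⟨N - 1, by omega⟩
    simp only [Nat.add_sub_cancel, div_pow, mul_pow, one_pow]
    field_simp
    ring
  · rw [Metric.mem_ball, dist_eq_norm] at hy
    have h1 : √(6 / 5 : ℝ) ≤ 2 := by rw [Real.sqrt_le_left] <;> norm_num
    have h2 : √(6 / 5) * r ≤ 2 * r := by gcongr
    have h3 := norm_sub_norm_le y x₀
    linarith
  · rw [Metric.mem_ball, dist_eq_norm] at hy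
    have hy2 : ‖y - x₀‖ ^ 2 ≤ 6 / 5 * r ^ 2 := by
      have : ‖y - x₀‖ ^ 2 ≤ (√(6 / 5) * r) ^ 2 := by gcongr
      rwa [mul_pow, Real.sq_sqrt (by norm_num)] at this
    obtain ⟨x₁, hx₁⟩ := exists_spread_center hN hr hy2
    refine ⟨Metric.closedBall x₁ (r / 1000), Metric.isClosed_closedBall.measurableSet,
      fun s hs => ?_, fun v hv => ?_⟩
    · have hs0 : 0 ≤ s := ha.le.trans hs.1
      have hvol : (volume : Measure (Vel N)).real (Metric.closedBall x₁ (r / 1000)) =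
          (r / 1000) ^ N * vb := by
        rw [Measure.real, Measure.addHaar_closedBall _ _ (by positivity), ENNReal.toReal_mul,
          ENNReal.toReal_ofReal (by positivity), finrank_euclideanSpace, Fintype.card_fin, hvb,
          Measure.real]
      rw [← hvol]
      refine mul_volume_le_setIntegral (h.sol.wInt hs0).integrable (h.sol.nonneg s hs0)
        (hball s hs) Metric.isClosed_closedBall.measurableSet measure_closedBall_lt_top.ne
        (fun v hv => ?_) subset_rfl
      rw [Metric.mem_ball, dist_eq_norm]
      exact (hx₁ v hv).1
    · obtain ⟨h1, h2, h3⟩ := hx₁ v hv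
      refine ⟨h2, fun s hs η hη hηl => ?_⟩
      have hs0 : 0 ≤ s := ha.le.trans hs.1
      have hD0 : 0 < ‖y - v‖ := by linarith
      obtain ⟨A, hA, hAv, hAB, hAS, hAvol⟩ := exists_box_slab hN (x₀ := x₀) (v := v)
        (n := ‖y - v‖⁻¹ • (y - v)) (h := ‖y - v‖ / (2 * kap α)) hr
        (by rw [norm_smul, norm_inv, norm_norm, inv_mul_cancel₀ hD0.ne']) hη (by linarith) h1
        (h3 α h.hα0 h.hα1)
      have := mul_volume_le_setIntegral (h.sol.wInt hs0).integrable (h.sol.nonneg s hs0)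
        (hball s hs) hA hAv hAB hAS
      refine le_trans (le_of_eq ?_) this
      rw [hAvol]; ring

/-- Iterating the spreading over the times `t - w 2⁻ⁿ`: the lower bound is squared at each step,
up to a factor of order `2⁻ⁿ`. -/
theorem exists_spread_iterate (N : ℕ) (hN : 2 ≤ N) {bm bM ρ C X r w : ℝ} (hbm : 0 < bm)
    (hbM : 0 < bM) (hC : 0 < C) (hr : 0 < r) (hw : 0 < w) (hX : 0 ≤ X)
    (hwr : ρ * w ≤ (r / 32) ^ 2) :
    ∃ A > 0, ∀ {b : ℝ → ℝ} {α T : ℝ} {g : ℝ → Vel N → ℝ}, Bounded b bm bM ρ C α T g →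
    ∀ {t δ : ℝ} {x₀ : Vel N}, w < t → t ≤ T → 0 ≤ δ → ‖x₀‖ ≤ X →
      (∀ s ∈ Icc (t - w) t, ∀ᵐ v, v ∈ Metric.ball x₀ r → δ ≤ g s v) →
      ∀ n : ℕ, ∀ s ∈ Icc (t - w / 2 ^ n) t, ∀ᵐ v, v ∈ Metric.ball x₀ (√(6 / 5) ^ n * r) →
        2 ^ (n + 1) / A * (A * δ / 2) ^ 2 ^ n ≤ g s v := by
  obtain ⟨c, hc, hsp⟩ := exists_spread N hN hbm
  set l := r / 32 with hl
  have hl0 : 0 < l := by positivity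
  set K := X + 2 * r + √(N * (25 * (2 * l ^ 2))) with hK
  have hK0 : 0 ≤ K := by positivity
  set Λ := rate N bM C K * w with hΛ
  set A := c * r ^ (N + 1) * (w / 2) * Real.exp (-Λ) with hA
  have hA0 : 0 < A := by positivity
  have hγ1 : 1 ≤ √(6 / 5 : ℝ) := Real.one_le_sqrt.2 (by norm_num)
  have hγ2 : √(6 / 5 : ℝ) ≤ 2 := by rw [Real.sqrt_le_left] <;> norm_num
  refine ⟨A, hA0, ?_⟩
  intro b α T g h t δ x₀ hwt htT hδ hx₀ h0 n
  induction n with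
  | zero =>
    intro s hs
    simp only [pow_zero, div_one, one_mul, zero_add, pow_one] at hs ⊢
    filter_upwards [h0 s hs] with v hv hvb
    refine le_trans (le_of_eq ?_) (hv hvb)
    field_simp
  | succ n ih =>
    intro s hs
    have h2n : (0 : ℝ) < 2 ^ n := by positivity
    have h2n1 : (1 : ℝ) ≤ 2 ^ n := one_le_pow₀ (by norm_num)
    set w' := w / 2 ^ (n + 1) with hw'
    have hw'0 : 0 < w' := by positivity
    have hww : w / 2 ^ n = 2 * w' := by rw [hw', pow_succ]; field_simp
    have hwn : w / 2 ^ n ≤ w := div_le_self hw.le h2n1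
    have hw'w : w' ≤ w := by linarith
    set r' := √(6 / 5) ^ n * r with hr'
    have hr'0 : 0 < r' := by positivity
    have hrr' : r ≤ r' := by
      rw [hr']; exact le_mul_of_one_le_left hr.le (one_le_pow₀ hγ1)
    have hr'2 : r' ≤ 2 ^ n * r := by rw [hr']; gcongr
    have hKn : ‖x₀‖ + 2 * r' + √(N * (25 * (2 * l ^ 2))) ≤ 2 ^ n * K := by
      have h1 : 0 ≤ X + √(N * (25 * (2 * l ^ 2))) := by positivity
      rw [hK]
      nlinarith
    set δ' := 2 ^ (n + 1) / A * (A * δ / 2) ^ 2 ^ n with hδ'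
    have hδ'0 : 0 ≤ δ' := by positivity
    have hρ := h.hρ
    have key := hsp h (a := s - w') (t := s) (l := l) (R := 2 ^ n * K) (r := r') (δ := δ')
      (x₀ := x₀) (by linarith [hs.1]) (by linarith) (hs.2.trans htT) hl0
      (by rw [sub_sub_cancel]; exact (mul_le_mul_of_nonneg_left hw'w hρ.le).trans hwr) hr'0
      (by rw [hl]; linarith) hδ'0 hKn
      (fun s' hs' => ih s' ⟨by rw [hww]; linarith [hs'.1, hs.1], hs'.2.trans hs.2⟩)
    rw [sub_sub_cancel] at key
    filter_upwards [key] with v hv hvb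
    refine le_trans ?_ (hv (by rw [hr', ← mul_assoc, ← pow_succ']; exact hvb))
    -- the loss rate grows at most like `2ⁿ`, the time step is of order `2⁻ⁿ`
    have hrate : rate N bM C (2 ^ n * K) * w' ≤ Λ := by
      have h1 : rate N bM C (2 ^ n * K) ≤ 2 ^ n * rate N bM C K := by
        unfold rate
        have h2 : 1 + 2 ^ n * K ≤ 2 ^ n * (1 + K) := by linarith
        calc bM * (surf N).real univ * (1 + 2 ^ n * K) * C
            ≤ bM * (surf N).real univ * (2 ^ n * (1 + K)) * C := by gcongr
          _ = _ := by ring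
      have h3 : 0 ≤ rate N bM C K := rate_nonneg hbM.le hC.le hK0
      calc rate N bM C (2 ^ n * K) * w' ≤ 2 ^ n * rate N bM C K * w' := by gcongr
        _ = rate N bM C K * (w / 2) := by rw [hw', pow_succ]; field_simp
        _ ≤ Λ := by rw [hΛ]; gcongr; linarith
    have hE : Real.exp (-Λ) ≤ Real.exp (-rate N bM C (2 ^ n * K) * w') := by
      apply Real.exp_le_exp.2; linarith
    calc 2 ^ (n + 1 + 1) / A * (A * δ / 2) ^ 2 ^ (n + 1)
        = A / 2 ^ n * δ' ^ 2 := by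
          have h1 : (A * δ / 2) ^ 2 ^ (n + 1) = ((A * δ / 2) ^ 2 ^ n) ^ 2 := by
            rw [← pow_mul, ← pow_succ]
          rw [hδ', h1, pow_succ, pow_succ]
          generalize (A * δ / 2) ^ 2 ^ n = Z
          field_simp
      _ = c * δ' ^ 2 * r ^ (N + 1) * w' * Real.exp (-Λ) := by
          rw [hA, hw', pow_succ 2 n]; field_simp
      _ ≤ c * δ' ^ 2 * r' ^ (N + 1) * w' * Real.exp (-rate N bM C (2 ^ n * K) * w') := by
          gcongr

/-! ### Conservation of mass -/

lemma laplacian_comp_smul {N : ℕ} {ψ : Vel N → ℝ} (hψ : ContDiff ℝ ∞ ψ) (c : ℝ) (v : Vel N) :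
    Laplacian.laplacian (fun w => ψ (c • w)) v = c ^ 2 * Laplacian.laplacian ψ (c • v) := by
  rw [InnerProductSpace.laplacian_eq_iteratedFDeriv_stdOrthonormalBasis,
    InnerProductSpace.laplacian_eq_iteratedFDeriv_stdOrthonormalBasis, Finset.mul_sum]
  refine Finset.sum_congr rfl fun i _ => ?_
  rw [iteratedFDeriv_comp_const_smul (i := 2) c (hψ.of_le (WithTop.coe_le_coe.2 le_top))]
  rfl

lemma norm_postVel_sub_le {N : ℕ} {α : ℝ} (h0 : 0 < α) (h1 : α < 1) (v w : Vel N) (σ : Sph N) :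
    ‖postVel α v w (σ : Vel N) - v‖ ≤ ‖v - w‖ := by
  obtain ⟨hκ1, hκ2⟩ := kap_mem h0 h1
  have e : postVel α v w (σ : Vel N) - v =
      (kap α * ‖v - w‖) • (σ : Vel N) - kap α • (v - w) := by
    rw [postVel_eq]; module
  have hσ : ‖(σ : Vel N)‖ = 1 := by simp
  rw [e]
  refine (norm_sub_le _ _).trans ?_
  rw [norm_smul, norm_smul, hσ, Real.norm_of_nonneg (by positivity),
    Real.norm_of_nonneg (by linarith)]
  nlinarith [norm_nonneg (v - w)]

lemma abs_collisionWeak_le_of_lipschitz {N : ℕ} {α : ℝ} (hα0 : 0 < α) (hα1 : α < 1) {b : ℝ → ℝ}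
    {bm bM : ℝ} (hb : CrossBounds b bm bM) {g : Vel N → ℝ} (hg : WInt g) {ψ : Vel N → ℝ} {K : ℝ}
    (hK : 0 ≤ K) (hψ : ∀ v w, |ψ v - ψ w| ≤ K * ‖v - w‖) :
    |collisionWeak α b g g ψ| ≤
      bM * (2 * K) * ((∫ v, |wt v * g v|) * ((∫ v, |wt v * g v|) * (surf N).real univ)) := by
  rw [← integral_dominant, collisionWeak_eq]
  refine norm_integral_le_of_norm_le (f := fun p : Vel N × Vel N × Sph N =>
    cker b p * g p.2.1 * g p.1 * (ψ (postVel α p.1 p.2.1 (p.2.2 : Vel N)) - ψ p.1))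
    (integrable_dominant hg hg (bM * (2 * K))) (Eventually.of_forall fun p => ?_)
  have hM := hb.posM
  have h0 := hb.cker_nonneg p
  have h1 := cker_le hb.upper p
  have h2 : |ψ (postVel α p.1 p.2.1 (p.2.2 : Vel N)) - ψ p.1| ≤ K * ‖p.1 - p.2.1‖ :=
    (hψ _ _).trans (by gcongr; exact norm_postVel_sub_le hα0 hα1 _ _ _)
  rw [Real.norm_eq_abs, abs_mul, abs_mul, abs_mul, abs_of_nonneg h0, abs_mul, abs_mul,
    abs_of_pos (wt_pos p.1), abs_of_pos (wt_pos p.2.1)]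
  calc cker b p * |g p.2.1| * |g p.1| * |ψ (postVel α p.1 p.2.1 (p.2.2 : Vel N)) - ψ p.1|
      ≤ (bM * ‖p.1 - p.2.1‖) * |g p.2.1| * |g p.1| * (K * ‖p.1 - p.2.1‖) := by gcongr
    _ = bM * K * |g p.2.1| * |g p.1| * ‖p.1 - p.2.1‖ ^ 2 := by ring
    _ ≤ bM * K * |g p.2.1| * |g p.1| * (2 * (wt p.1 * wt p.2.1)) := by
        gcongr; exact norm_sub_sq_le_wt_mul _ _
    _ = _ := by ring

lemma integral_abs_le_integral_wt {N : ℕ} {f : Vel N → ℝ} (hf : WInt f) :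
    ∫ v, |f v| ≤ ∫ v, |wt v * f v| := by
  refine integral_mono hf.integrable.abs (Integrable.abs hf) fun v => ?_
  simp only
  rw [abs_mul, abs_of_pos (wt_pos v)]
  exact le_mul_of_one_le_left (abs_nonneg _) (one_le_wt v)

/-- The mass is conserved. The truncations `χ (v / R)` of the test function `1` make a defect of
order `1 / R`: this is where the second moment is used. -/
theorem Bounded.integral_eq {N : ℕ} {b : ℝ → ℝ} {bm bM ρ C α T : ℝ} {g : ℝ → Vel N → ℝ}
    (h : Bounded b bm bM ρ C α T g) {t : ℝ} (ht : t ∈ Icc 0 T) : ∫ v, g t v = ρ := by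
  set χ : ContDiffBump (0 : Vel N) := ⟨1, 2, one_pos, by norm_num⟩ with hχ
  have hχs : ContDiff ℝ ∞ (χ : Vel N → ℝ) := χ.contDiff
  obtain ⟨K, hK⟩ := hχs.lipschitzWith_of_hasCompactSupport χ.hasCompactSupport (by simp)
  obtain ⟨M, hM⟩ := exists_bound_of_compact (continuous_laplacian hχs)
    (hasCompactSupport_laplacian χ.hasCompactSupport)
  have hM0 : 0 ≤ M := (abs_nonneg _).trans (hM 0)
  have hbM := h.cross.posM
  have hC := h.hC
  have hτ0 : 0 ≤ ρ * (1 - α) := mul_nonneg h.hρ.le (by linarith [h.hα1])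
  set D := bM * (2 * K) * (C * (C * (surf N).real univ)) + ρ * (1 - α) * (M * C) with hD
  set c : ℕ → ℝ := fun n => ((n : ℝ) + 1)⁻¹ with hc
  have hc0 : ∀ n, 0 < c n := fun n => by positivity
  have hc1 : ∀ n, c n ≤ 1 := fun n => inv_le_one_of_one_le₀ (by
    have : (0 : ℝ) ≤ n := Nat.cast_nonneg n
    linarith)
  have hclim : Tendsto c atTop (𝓝 0) := by
    simpa [hc, one_div] using tendsto_one_div_add_atTop_nhds_zero_nat (𝕜 := ℝ)
  set ψ : ℕ → Vel N → ℝ := fun n v => χ (c n • v) with hψ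
  have hψs : ∀ n, ContDiff ℝ ∞ (ψ n) := fun n => hχs.comp (contDiff_const_smul (c n))
  have hψc : ∀ n, HasCompactSupport (ψ n) := fun n =>
    χ.hasCompactSupport.comp_smul (hc0 n).ne'
  have hψ1 : ∀ n v, |ψ n v| ≤ 1 := fun n v => by
    rw [abs_of_nonneg χ.nonneg]; exact χ.le_one
  -- truncated masses converge to the mass
  have hlim : ∀ s, 0 ≤ s → Tendsto (fun n => ∫ v, g s v * ψ n v) atTop (𝓝 (∫ v, g s v)) := by
    intro s hs
    refine tendsto_integral_of_dominated_convergence (fun v => |g s v|)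
      (fun n => ((h.sol.wInt hs).integrable_mul (hψs n).continuous.aestronglyMeasurable
        (hψ1 n)).aestronglyMeasurable) (h.sol.wInt hs).integrable.abs ?_ ?_
    · refine fun n => Eventually.of_forall fun v => ?_
      rw [Real.norm_eq_abs, abs_mul]
      exact mul_le_of_le_one_right (abs_nonneg _) (hψ1 n v)
    · refine Eventually.of_forall fun v => ?_
      have h1 : Tendsto (fun n => c n • v) atTop (𝓝 0) := by
        simpa using hclim.smul_const v
      have h2 : Tendsto (fun n => ψ n v) atTop (𝓝 (χ (0 : Vel N))) :=
        (hχs.continuous.tendsto 0).comp h1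
      have h3 : χ (0 : Vel N) = 1 := χ.one_of_mem_closedBall (by simp [hχ])
      rw [h3] at h2
      simpa using h2.const_mul (g s v)
  have hrhs : ∀ n, ∀ s ∈ Icc 0 T, |rhs α ρ b (g s) (ψ n)| ≤ D * c n := by
    intro n s hs
    have hw := h.sol.wInt hs.1
    have hm := h.moment s hs
    have h1 := abs_collisionWeak_le_of_lipschitz h.hα0 h.hα1 h.cross hw (ψ := ψ n)
      (K := K * c n) (by have := (hc0 n).le; positivity) (fun v w => by
        have := hK.dist_le_mul (c n • v) (c n • w)
        rw [Real.dist_eq, dist_eq_norm, ← smul_sub, norm_smul, Real.norm_of_nonneg (hc0 n).le]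
          at this
        rw [mul_assoc]; exact this)
    have h2 : |∫ v, g s v * Laplacian.laplacian (ψ n) v| ≤ M * c n * C := by
      have h3 : ∀ v, ‖g s v * Laplacian.laplacian (ψ n) v‖ ≤ (M * c n) * |g s v| := by
        intro v
        rw [norm_mul, hψ, laplacian_comp_smul hχs, norm_mul, Real.norm_eq_abs, Real.norm_eq_abs,
          Real.norm_eq_abs, abs_of_nonneg (sq_nonneg (c n))]
        have h4 : c n ^ 2 ≤ c n := by nlinarith [hc0 n, hc1 n]
        calc |g s v| * (c n ^ 2 * |Laplacian.laplacian (χ : Vel N → ℝ) (c n • v)|)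
            ≤ |g s v| * (c n * M) := by
              have := (hc0 n).le
              gcongr
              exact hM _
          _ = _ := by ring
      refine (norm_integral_le_of_norm_le (hw.integrable.abs.const_mul (M * c n))
        (Eventually.of_forall h3)).trans ?_
      rw [integral_const_mul]
      have := (hc0 n).le
      gcongr
      exact (integral_abs_le_integral_wt hw).trans hm
    have h0 : 0 ≤ ∫ v, |wt v * g s v| := integral_nonneg fun v => abs_nonneg _
    unfold rhs
    refine (abs_add_le _ _).trans ?_
    rw [abs_mul, abs_of_nonneg hτ0]
    have := (hc0 n).le
    calc _ ≤ bM * (2 * (K * c n)) * (C * (C * (surf N).real univ)) +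
          ρ * (1 - α) * (M * c n * C) := by
          refine add_le_add (h1.trans ?_) (by gcongr)
          gcongr
      _ = D * c n := by rw [hD]; ring
  have hdiff : ∀ n, |(∫ v, g t v * ψ n v) - ∫ v, g 0 v * ψ n v| ≤ D * c n * t := by
    intro n
    rw [h.sol.equation (ψ n) (hψs n) (hψc n) t ht.1, add_sub_cancel_left]
    have := intervalIntegral.norm_integral_le_of_norm_le_const (a := 0) (b := t)
      (f := fun s => rhs α ρ b (g s) (ψ n)) (C := D * c n) (fun s hs => by
        rw [uIoc_of_le ht.1] at hs
        exact hrhs n s ⟨hs.1.le, hs.2.trans ht.2⟩)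
    rwa [sub_zero, abs_of_nonneg ht.1] at this
  have hz : Tendsto (fun n => D * c n * t) atTop (𝓝 0) := by
    simpa using (hclim.const_mul D).mul_const t
  have h1 := squeeze_zero_norm (f := fun n => (∫ v, g t v * ψ n v) - ∫ v, g 0 v * ψ n v)
    hdiff hz
  have h2 := (hlim t ht.1).sub (hlim 0 le_rfl)
  have h3 := tendsto_nhds_unique h1 h2
  rw [← h.sol.mass]
  linarith

/-! ### Concentration of mass -/

/-- The pigeonhole principle for mass in a set covered by finitely many balls. -/
lemma exists_le_setIntegral_of_cover {N : ℕ} {f : Vel N → ℝ} (hf : Integrable f)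
    (hf0 : ∀ᵐ v, 0 ≤ f v) {A : Set (Vel N)} (hA : MeasurableSet A) {t : Finset (Vel N)} {r m : ℝ}
    (hcov : A ⊆ ⋃ x ∈ t, Metric.closedBall x r) (hAm : t.card * m ≤ ∫ v in A, f v)
    (ht : 0 < t.card) : ∃ x ∈ t, m ≤ ∫ v in Metric.closedBall x r ∩ A, f v := by
  by_contra! hlt
  have hmeas : ∀ x, MeasurableSet (Metric.closedBall x r ∩ A) := fun x =>
    Metric.isClosed_closedBall.measurableSet.inter hA
  have h1 : ∫ v in A, f v ≤ ∑ x ∈ t, ∫ v in Metric.closedBall x r ∩ A, f v := by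
    calc ∫ v in A, f v = ∫ v, A.indicator f v := (integral_indicator hA).symm
      _ ≤ ∫ v, ∑ x ∈ t, (Metric.closedBall x r ∩ A).indicator f v := by
          refine integral_mono_ae (hf.indicator hA)
            (integrable_finsetSum _ fun x _ => hf.indicator (hmeas x)) ?_
          filter_upwards [hf0] with v hv
          have hnn : ∀ x ∈ t, 0 ≤ (Metric.closedBall x r ∩ A).indicator f v := fun x _ =>
            by
            by_cases hvx : v ∈ Metric.closedBall x r ∩ A
            · rwa [indicator_of_mem hvx]
            · rw [indicator_of_notMem hvx]
          by_cases hvA : v ∈ A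
          · obtain ⟨x, hx, hvx⟩ := mem_iUnion₂.1 (hcov hvA)
            have h2 : A.indicator f v = (Metric.closedBall x r ∩ A).indicator f v := by
              rw [indicator_of_mem hvA,
                indicator_of_mem (show v ∈ Metric.closedBall x r ∩ A from ⟨hvx, hvA⟩)]
            rw [h2]
            exact Finset.single_le_sum hnn hx
          · rw [indicator_of_notMem hvA]
            exact Finset.sum_nonneg hnn
      _ = _ := by
          rw [integral_finsetSum _ fun x _ => hf.indicator (hmeas x)]
          exact Finset.sum_congr rfl fun x _ => integral_indicator (hmeas x)
  have h2 : ∑ x ∈ t, ∫ v in Metric.closedBall x r ∩ A, f v < ∑ _x ∈ t, m :=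
    Finset.sum_lt_sum_of_nonempty (Finset.card_pos.1 ht) hlt
  rw [Finset.sum_const, nsmul_eq_mul] at h2
  linarith

/-- Markov's inequality for the weight `1 + |v|²`. -/
lemma setIntegral_compl_closedBall_le {N : ℕ} {f : Vel N → ℝ} (hf : WInt f) {C R : ℝ}
    (hC : ∫ v, |wt v * f v| ≤ C) (hR : 0 < R) :
    ∫ v in (Metric.closedBall (0 : Vel N) R)ᶜ, f v ≤ C / R ^ 2 := by
  have hmeas : MeasurableSet (Metric.closedBall (0 : Vel N) R)ᶜ :=
    Metric.isClosed_closedBall.measurableSet.compl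
  rw [le_div_iff₀ (by positivity), ← integral_mul_const]
  refine le_trans ?_ hC
  have hi : Integrable (fun v => |wt v * f v|) := Integrable.abs hf
  refine le_trans ?_ (setIntegral_le_integral (s := (Metric.closedBall (0 : Vel N) R)ᶜ) hi
    (Eventually.of_forall fun v => abs_nonneg _))
  refine setIntegral_mono_on (hf.integrable.mul_const _).integrableOn hi.integrableOn hmeas
    fun v hv => ?_
  have hv' : R < ‖v‖ := by simpa using hv
  rw [abs_mul, abs_of_pos (wt_pos v), mul_comm]
  have h1 : R ^ 2 ≤ wt v := by
    unfold wt; nlinarith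
  calc R ^ 2 * f v ≤ R ^ 2 * |f v| := by gcongr; exact le_abs_self _
    _ ≤ _ := by gcongr

/-- The Cauchy–Schwarz inequality: a bound in `L²` prevents concentration on small sets. -/
lemma setIntegral_le_of_weightedNorm_two {N : ℕ} {f : Vel N → ℝ} (hf : Integrable f) {C : ℝ}
    (hC : 0 ≤ C) (h2 : weightedNorm 2 0 f ≤ ENNReal.ofReal C) {A : Set (Vel N)}
    (hAv : volume A ≠ ⊤) : ∫ v in A, f v ≤ C * √(volume.real A) := by
  have e : weightedNorm 2 0 f = eLpNorm f 2 volume := by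
    unfold weightedNorm; simp
  rw [e] at h2
  have h3 : ENNReal.ofReal (∫ v in A, ‖f v‖) ≤ ENNReal.ofReal (C * √(volume.real A)) := by
    rw [ofReal_integral_norm_eq_lintegral_enorm hf.integrableOn,
      ← eLpNorm_one_eq_lintegral_enorm]
    refine (eLpNorm_le_eLpNorm_mul_rpow_measure_univ (p := 1) (q := 2) (by norm_num)
      hf.aestronglyMeasurable.restrict).trans ?_
    rw [ENNReal.ofReal_mul hC, Measure.restrict_apply_univ]
    refine mul_le_mul' ((eLpNorm_mono_measure f Measure.restrict_le_self).trans h2) (le_of_eq ?_)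
    rw [Real.sqrt_eq_rpow, Measure.real, ENNReal.toReal_rpow, ENNReal.ofReal_toReal]
    · norm_num
    · exact ENNReal.rpow_ne_top_of_nonneg (by norm_num) hAv
  rw [ENNReal.ofReal_le_ofReal_iff (by positivity)] at h3
  refine le_trans ?_ h3
  exact (le_abs_self _).trans (norm_integral_le_integral_norm (μ := volume.restrict A) f)

/-- A density of mass `ρ` with bounded second moment and `L²` norm charges two small balls far
apart, whose centres stay in a bounded set. -/
theorem exists_lumps (N : ℕ) (hN : 2 ≤ N) {ρ C : ℝ} (hρ : 0 < ρ) (hC : 0 < C) :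
    ∃ R₀ > 0, ∃ d > 0, d ≤ R₀ ∧ ∀ r, 0 < r → r ≤ d → ∃ m > 0, ∀ f : Vel N → ℝ, WInt f →
      (∀ᵐ v, 0 ≤ f v) → ∫ v, |wt v * f v| ≤ C → ∫ v, f v = ρ →
      weightedNorm 2 0 f ≤ ENNReal.ofReal C →
      ∃ x₁ x₂ : Vel N, ‖x₁‖ ≤ R₀ ∧ ‖x₂‖ ≤ R₀ ∧ d ≤ ‖x₁ - x₂‖ ∧
        m ≤ (∫ v in Metric.closedBall x₁ r, f v) ∧ m ≤ ∫ v in Metric.closedBall x₂ r, f v := by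
  set R₀ := 1 + 4 * C / ρ with hR₀
  have hR₀1 : 1 ≤ R₀ := by rw [hR₀]; have : 0 ≤ 4 * C / ρ := by positivity
                           linarith
  have hR₀C : C / R₀ ^ 2 ≤ ρ / 4 := by
    rw [div_le_iff₀ (by positivity)]
    have h1 : ρ * R₀ = ρ + 4 * C := by rw [hR₀]; field_simp
    nlinarith
  set vb := (volume : Measure (Vel N)).real (Metric.ball 0 1) with hvb
  have hvb0 : 0 ≤ vb := ENNReal.toReal_nonneg
  -- the ball of radius `2 d` carries at most a quarter of the mass
  obtain ⟨d, hd0, hdR, hdm⟩ : ∃ d > 0, d ≤ R₀ ∧ C * √((2 * d) ^ N * vb) ≤ ρ / 4 := by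
    have hcont : Continuous fun d : ℝ => C * √((2 * d) ^ N * vb) := by fun_prop
    have h0 : C * √((2 * (0 : ℝ)) ^ N * vb) < ρ / 4 := by
      rw [mul_zero, zero_pow (by omega), zero_mul, Real.sqrt_zero, mul_zero]
      positivity
    obtain ⟨ε, hε, hball⟩ := Metric.isOpen_iff.1 (isOpen_lt hcont continuous_const) 0 h0
    refine ⟨min (ε / 2) R₀, by positivity, min_le_right _ _, le_of_lt (hball ?_)⟩
    rw [Metric.mem_ball, Real.dist_eq, sub_zero, abs_of_pos (by positivity)]
    exact (min_le_left _ _).trans_lt (by linarith)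
  refine ⟨R₀, by linarith, d, hd0, hdR, fun r hr hrd => ?_⟩
  obtain ⟨t, htR, htf, htc⟩ := (isCompact_closedBall (0 : Vel N) R₀).finite_cover_balls hr
  lift t to Finset (Vel N) using htf
  have htc' : Metric.closedBall (0 : Vel N) R₀ ⊆ ⋃ x ∈ t, Metric.closedBall x r :=
    htc.trans (iUnion₂_mono fun x _ => Metric.ball_subset_closedBall)
  have htpos : 0 < t.card := by
    rw [Finset.card_pos]
    obtain ⟨x, hx, -⟩ := mem_iUnion₂.1
      (htc (Metric.mem_closedBall_self (by linarith) : (0 : Vel N) ∈ _))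
    exact ⟨x, hx⟩
  have htpos' : (0 : ℝ) < t.card := by exact_mod_cast htpos
  refine ⟨ρ / 2 / t.card, by positivity, fun f hf hf0 hfC hfρ hf2 => ?_⟩
  have hfi := hf.integrable
  have hBm : MeasurableSet (Metric.closedBall (0 : Vel N) R₀) :=
    Metric.isClosed_closedBall.measurableSet
  have hmass : 3 / 4 * ρ ≤ ∫ v in Metric.closedBall (0 : Vel N) R₀, f v := by
    have h1 := integral_add_compl hBm hfi
    have h2 := setIntegral_compl_closedBall_le hf hfC (by linarith : 0 < R₀)
    linarith
  have hcard : (t.card : ℝ) * (ρ / 2 / t.card) = ρ / 2 := by field_simp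
  have hsub : ∀ (x : Vel N) (A : Set (Vel N)), ∫ v in Metric.closedBall x r ∩ A, f v ≤
      ∫ v in Metric.closedBall x r, f v := fun x A =>
    setIntegral_mono_set hfi.integrableOn (ae_restrict_of_ae hf0)
      (Eventually.of_forall inter_subset_left)
  obtain ⟨x₁, hx₁t, hx₁⟩ := exists_le_setIntegral_of_cover hfi hf0 hBm htc'
    (m := ρ / 2 / t.card) (by rw [hcard]; linarith) htpos
  set A := Metric.closedBall (0 : Vel N) R₀ \ Metric.closedBall x₁ (2 * d) with hA
  have hAm : MeasurableSet A := hBm.diff Metric.isClosed_closedBall.measurableSet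
  have hmassA : ρ / 2 ≤ ∫ v in A, f v := by
    have h1 : ∫ v in Metric.closedBall (0 : Vel N) R₀ ∩ Metric.closedBall x₁ (2 * d), f v ≤
        ∫ v in Metric.closedBall x₁ (2 * d), f v :=
      setIntegral_mono_set hfi.integrableOn (ae_restrict_of_ae hf0)
        (Eventually.of_forall inter_subset_right)
    have h2 := integral_inter_add_sdiff (s := Metric.closedBall (0 : Vel N) R₀)
      (Metric.isClosed_closedBall.measurableSet : MeasurableSet (Metric.closedBall x₁ (2 * d)))
      hfi.integrableOn
    have h3 := setIntegral_le_of_weightedNorm_two hfi hC.le hf2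
      (measure_closedBall_lt_top.ne : volume (Metric.closedBall x₁ (2 * d)) ≠ ⊤)
    have h4 : volume.real (Metric.closedBall x₁ (2 * d)) = (2 * d) ^ N * vb := by
      rw [Measure.real, Measure.addHaar_closedBall _ _ (by positivity), ENNReal.toReal_mul,
        ENNReal.toReal_ofReal (by positivity), finrank_euclideanSpace, Fintype.card_fin, hvb,
        Measure.real]
    rw [h4] at h3
    linarith
  obtain ⟨x₂, hx₂t, hx₂⟩ := exists_le_setIntegral_of_cover hfi hf0 hAm
    (sdiff_subset.trans htc') (m := ρ / 2 / t.card) (by rw [hcard]; exact hmassA)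
    htpos
  have hbound : ∀ x ∈ t, ‖x‖ ≤ R₀ := fun x hx => by simpa using htR hx
  refine ⟨x₁, x₂, hbound _ hx₁t, hbound _ hx₂t, ?_, hx₁.trans (hsub _ _), hx₂.trans (hsub _ _)⟩
  have hne : (Metric.closedBall x₂ r ∩ A).Nonempty := by
    by_contra hemp
    rw [Set.not_nonempty_iff_eq_empty.1 hemp, setIntegral_empty] at hx₂
    have : 0 < ρ / 2 / t.card := by positivity
    linarith
  obtain ⟨v, hv₂, -, hv₁⟩ := hne
  rw [Metric.mem_closedBall, dist_eq_norm] at hv₂ hv₁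
  push Not at hv₁
  have h1 : v - x₁ = (v - x₂) - (x₁ - x₂) := by abel
  have h2 := norm_sub_le (v - x₂) (x₁ - x₂)
  rw [← h1] at h2
  linarith

/-- Mass in a ball of radius `l` stays in a slightly larger ball for a time of order `l²`. -/
lemma Bounded.le_setIntegral_closedBall {N : ℕ} {b : ℝ → ℝ} {bm bM ρ C α T : ℝ}
    {g : ℝ → Vel N → ℝ} (h : Bounded b bm bM ρ C α T g) {a t : ℝ} (ha : 0 < a) (hat : a ≤ t)
    (htT : t ≤ T) {l : ℝ} (hl : 0 < l) (hla : ρ * (t - a) ≤ l ^ 2) {x : Vel N} {r R m : ℝ}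
    (hr : √(N * (25 * (2 * l ^ 2))) ≤ r) (hR : ‖x‖ + r ≤ R)
    (hm : m ≤ ∫ v in Metric.closedBall x l, g a v) :
    (1 / 8) ^ N * (Real.exp (-rate N bM C R * (t - a)) * m) ≤
      ∫ v in Metric.closedBall x r, g t v := by
  set e := EuclideanSpace.basisFun (Fin N) ℝ
  set τ := ρ * (1 - α) with hτ
  set ψ := kern e (2 * l ^ 2) τ t (fun _ => l) x with hψ
  have ha0 := ha.le
  have ht0 : 0 ≤ t := ha0.trans hat
  have hl2 : 0 < l ^ 2 := by positivity
  have hcont : ∀ s, Continuous (ψ s) := fun s => (contDiff_kern e _ τ t (fun _ => l) x s).continuous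
  have hτs : ∀ s ∈ Icc a t, 0 ≤ τ * (t - s) ∧ τ * (t - s) ≤ l ^ 2 := fun s hs =>
    h.tau_bounds hs hla
  have hM : ∀ s ∈ Icc a t, ∀ w, |ψ s w| ≤ (4 * (√(2 * l ^ 2) / √(l ^ 2))) ^ N := fun s hs w =>
    kern_le e x hl2 (fun i => by linarith [(hτs s hs).1]) w
  have h8 : (4 * (√(2 * l ^ 2) / √(l ^ 2))) ^ N ≤ 8 ^ N := by
    refine pow_le_pow_left₀ (by positivity) ?_ N
    rw [← Real.sqrt_div (by positivity), mul_div_cancel_right₀ _ hl2.ne']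
    have : √(2 : ℝ) ≤ 2 := by rw [Real.sqrt_le_left] <;> norm_num
    linarith
  have key := h.kern_duhamel ha hat htT e hl hla (fun _ => hl) (fun _ => le_rfl) (y := x)
    (R := R) (Γ := 0) (by linarith) le_rfl (fun s hs => by
      have hs0 : 0 ≤ s := ha0.trans hs.1
      have := le_gain (α := α) (κ₀ := 0) (m₁ := 0) (m₂ := 0) (S₁ := ∅) (S₂ := fun _ => ∅)
        h.cross (h.sol.wInt hs0) (h.sol.nonneg s hs0) (hcont s) (fun w => kern_nonneg ..)
        (hM s hs) MeasurableSet.empty (by simp) le_rfl le_rfl (by simp) (by simp) (by simp)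
      simpa using this)
  rw [zero_mul, add_zero, ← hτ, ← hψ] at key
  have h1 : m ≤ ∫ v, g a v * ψ a v := by
    refine hm.trans ?_
    have hi := (h.sol.wInt ha0).integrable_mul (hcont a).aestronglyMeasurable
      (hM a ⟨le_rfl, hat⟩)
    have hnn : 0 ≤ᵐ[volume] fun v => g a v * ψ a v := by
      filter_upwards [h.sol.nonneg a ha0] with v hv using mul_nonneg hv (kern_nonneg ..)
    refine le_trans ?_ (setIntegral_le_integral (s := Metric.closedBall x l) hi hnn)
    refine setIntegral_mono_on_ae (h.sol.wInt ha0).integrable.integrableOn hi.integrableOn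
      Metric.isClosed_closedBall.measurableSet ?_
    filter_upwards [h.sol.nonneg a ha0] with v hv hvx
    rw [Metric.mem_closedBall, dist_eq_norm] at hvx
    refine le_mul_of_one_le_right hv ?_
    obtain ⟨k1, k2⟩ := hτs a ⟨le_rfl, hat⟩
    rw [hψ, kern]
    have h2 : ∀ i, 1 ≤ prof (2 * l ^ 2) (l ^ 2 + τ * (t - a)) (inner ℝ (e i) (v - x)) := by
      intro i
      have h3 := le_prof (Θ := 2 * l ^ 2) (θ := l ^ 2 + τ * (t - a)) (z := inner ℝ (e i) (v - x))
        (by linarith) (by linarith) ((abs_inner_le_norm' e _ i).trans (hvx.trans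
          (Real.le_sqrt_of_sq_le (by linarith))))
      refine le_trans ?_ h3
      rw [one_le_div (Real.sqrt_pos.2 (by linarith))]
      exact Real.sqrt_le_sqrt (by linarith)
    have := Finset.prod_le_prod (s := Finset.univ) (f := fun _ : Fin N => (1 : ℝ))
      (fun _ _ => zero_le_one) (fun i _ => h2 i)
    simpa using this
  have h2 : ∫ v, g t v * ψ t v ≤ 8 ^ N * ∫ v in Metric.closedBall x r, g t v := by
    have hmem : t ∈ Icc a t := ⟨hat, le_rfl⟩
    have hi := (h.sol.wInt ht0).integrable_mul (hcont t).aestronglyMeasurable (hM t hmem)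
    rw [← integral_const_mul, ← integral_indicator Metric.isClosed_closedBall.measurableSet]
    refine integral_mono_ae hi (((h.sol.wInt ht0).integrable.const_mul _).indicator
      Metric.isClosed_closedBall.measurableSet) ?_
    filter_upwards [h.sol.nonneg t ht0] with v hv
    by_cases hvx : v ∈ Metric.closedBall x r
    · rw [indicator_of_mem hvx, mul_comm]
      have := (le_abs_self _).trans ((hM t hmem v).trans h8)
      gcongr
    · rw [indicator_of_notMem hvx]
      rw [Metric.mem_closedBall, dist_eq_norm] at hvx
      push Not at hvx
      obtain ⟨k1, k2⟩ := hτs t hmem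
      rw [hψ, kern_eq_zero e x (by positivity) (fun i => by linarith) (fun i => by linarith)
        (hr.trans_lt hvx), mul_zero]
  have h3 : (1 / 8 : ℝ) ^ N * 8 ^ N = 1 := by rw [← mul_pow]; norm_num
  calc (1 / 8) ^ N * (Real.exp (-rate N bM C R * (t - a)) * m)
      ≤ (1 / 8) ^ N * (8 ^ N * ∫ v in Metric.closedBall x r, g t v) := by
        have : Real.exp (-rate N bM C R * (t - a)) * m ≤
            Real.exp (-rate N bM C R * (t - a)) * ∫ v, g a v * ψ a v := by gcongr
        exact mul_le_mul_of_nonneg_left (this.trans (key.trans h2)) (by positivity)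
    _ = _ := by rw [← mul_assoc, h3, one_mul]

/-! ### A first ball -/

/-- Two lumps of mass around `x₁` and `x₂`, at distance at least `100 r`. The target `y` is close to
`x₁ - 2 κ² (x₁ - x₂)`; for `v` close to `x₁`, the hyperplane of the velocities `w` for which `y` is
a possible outcome of the collision of `v` and `w` passes through `q = v + (y - v) / (2 κ)`, which
is close to the centre of the sphere onto which collisions between the two lumps spread the mass. -/
lemma first_collision_geometry {N : ℕ} {α : ℝ} (hα0 : 0 < α) (hα1 : α < 1) {x₁ x₂ y v : Vel N}
    {d r R : ℝ} (hr : 0 < r) (hdr : d = 100 * r) (hrR : d ≤ R) (hd : d ≤ ‖x₁ - x₂‖)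
    (hx₁ : ‖x₁‖ ≤ R) (hx₂ : ‖x₂‖ ≤ R) (hy : ‖y - (x₁ - (2 * kap α ^ 2) • (x₁ - x₂))‖ ≤ r)
    (hv : ‖v - x₁‖ ≤ r) :
    d / 10 ≤ ‖y - v‖ ∧ ‖v + (1 / (2 * kap α)) • (y - v)‖ ≤ 3 * R ∧
      ∀ v₁ w : Vel N, ‖v₁ - x₁‖ ≤ r → ‖w - x₂‖ ≤ r → d / 2 ≤ ‖v₁ - w‖ ∧
        ‖v + (1 / (2 * kap α)) • (y - v) - ((1 - kap α) • v₁ + kap α • w)‖ ≤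
          1 / 2 * (kap α * ‖v₁ - w‖) := by
  obtain ⟨hκ1, hκ2⟩ := kap_mem hα0 hα1
  set κ := kap α
  have hκ0 : 0 < κ := by linarith
  set u := x₁ - x₂ with hu
  set ey := y - (x₁ - (2 * κ ^ 2) • u) with hey
  set ev := v - x₁ with hev
  have hκinv : 1 / (2 * κ) ≤ 2 := by
    rw [div_le_iff₀ (by positivity)]; linarith
  have hyv : y - v = (ey - ev) - (2 * κ ^ 2) • u := by rw [hey, hev]; abel
  have he : ‖ey - ev‖ ≤ 2 * r := (norm_sub_le _ _).trans (by linarith)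
  have he' : ‖(1 / (2 * κ)) • (ey - ev)‖ ≤ 4 * r := by
    rw [norm_smul, Real.norm_of_nonneg (by positivity)]
    calc 1 / (2 * κ) * ‖ey - ev‖ ≤ 2 * (2 * r) := by gcongr
      _ = 4 * r := by ring
  have hq : v + (1 / (2 * κ)) • (y - v) =
      x₁ - κ • u + (ev + (1 / (2 * κ)) • (ey - ev)) := by
    rw [hyv, smul_sub, smul_smul, show 1 / (2 * κ) * (2 * κ ^ 2) = κ by field_simp, hev]
    abel
  have hqe : ‖ev + (1 / (2 * κ)) • (ey - ev)‖ ≤ 5 * r := (norm_add_le _ _).trans (by linarith)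
  refine ⟨?_, ?_, fun v₁ w hv₁ hw => ?_⟩
  · have h1 := norm_sub_norm_le ((2 * κ ^ 2) • u) (ey - ev)
    rw [norm_sub_rev ((2 * κ ^ 2) • u), ← hyv, norm_smul, Real.norm_of_nonneg (by positivity)] at h1
    have h2 : 1 / 8 * ‖u‖ ≤ 2 * κ ^ 2 * ‖u‖ := by gcongr; nlinarith
    linarith
  · rw [hq]
    have h1 := norm_add_le (x₁ - κ • u) (ev + (1 / (2 * κ)) • (ey - ev))
    have h2 := norm_sub_le x₁ (κ • u)
    have h3 := norm_sub_le x₁ x₂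
    rw [norm_smul, Real.norm_of_nonneg hκ0.le] at h2
    have h4 : κ * ‖u‖ ≤ 1 / 2 * (R + R) := by
      gcongr
      linarith
    linarith
  · have h1 : d / 2 + 48 * r ≤ ‖v₁ - w‖ := by
      have h2 : u = (v₁ - w) - ((v₁ - x₁) - (w - x₂)) := by rw [hu]; abel
      have h3 := norm_sub_le (v₁ - w) ((v₁ - x₁) - (w - x₂))
      have h4 := norm_sub_le (v₁ - x₁) (w - x₂)
      rw [← h2] at h3
      linarith
    refine ⟨by linarith, ?_⟩
    have h2 : v + (1 / (2 * κ)) • (y - v) - ((1 - κ) • v₁ + κ • w) =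
        (ev + (1 / (2 * κ)) • (ey - ev)) - ((1 - κ) • (v₁ - x₁) + κ • (w - x₂)) := by
      rw [hq, hu]; module
    have h3 : ‖(1 - κ) • (v₁ - x₁) + κ • (w - x₂)‖ ≤ r := by
      refine (norm_add_le _ _).trans ?_
      rw [norm_smul, norm_smul, Real.norm_of_nonneg hκ0.le, Real.norm_of_nonneg (by linarith)]
      calc (1 - κ) * ‖v₁ - x₁‖ + κ * ‖w - x₂‖ ≤ (1 - κ) * r + κ * r := by
            have : 0 ≤ 1 - κ := by linarith
            gcongr
        _ = r := by ring
    have h4 : 1 / 4 * (98 * r) ≤ κ * ‖v₁ - w‖ := by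
      gcongr
      linarith
    rw [h2]
    refine (norm_sub_le _ _).trans ?_
    linarith

/-- Two successive collisions create a uniform lower bound on a ball: the first one turns the two
lumps of mass into mass near every relevant hyperplane, the second one, of this mass with a lump,
reaches every point of a ball. -/
theorem exists_first_ball (N : ℕ) (hN : 2 ≤ N) {bm bM ρ C t₁ : ℝ} (hbm : 0 < bm) (hbM : 0 < bM)
    (hρ : 0 < ρ) (hC : 0 < C) (ht₁ : 0 < t₁) :
    ∃ X > 0, ∃ r > 0, ∃ w > 0, ∃ δ > 0, w < t₁ ∧ ρ * w ≤ (r / 32) ^ 2 ∧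
    ∀ {b : ℝ → ℝ} {α T : ℝ} {g : ℝ → Vel N → ℝ}, Bounded b bm bM ρ C α T g →
    ∀ t ∈ Icc t₁ T, ∃ x₀ : Vel N, ‖x₀‖ ≤ X ∧
      ∀ s ∈ Icc (t - w) t, ∀ᵐ v, v ∈ Metric.ball x₀ r → δ ≤ g s v := by
  have hNr : (0 : ℝ) < N := by exact_mod_cast (by omega : 0 < N)
  have hsN : 1 ≤ √(N : ℝ) := Real.one_le_sqrt.2 (by exact_mod_cast (by omega : 1 ≤ N))
  obtain ⟨R₀, hR₀, d, hd, hdR, hlumps⟩ := exists_lumps N hN hρ hC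
  obtain ⟨c₁, hc₁, hslab⟩ := exists_slab_lower N hN hbm
  obtain ⟨c₂, hc₂, hpoint⟩ := exists_point_lower N hN hbm
  set r := d / 100 with hr
  have hr0 : 0 < r := by positivity
  have hdr : d = 100 * r := by rw [hr]; ring
  -- the three length scales: lumps, slabs, points
  set l₀ := r / (8 * √N) with hl₀
  have hl₀0 : 0 < l₀ := by positivity
  have hl₀r : l₀ ≤ r := by
    rw [hl₀, div_le_iff₀ (by positivity)]; nlinarith
  have hl₀' : √(N * (25 * (2 * l₀ ^ 2))) ≤ r := by
    rw [Real.sqrt_le_left hr0.le, hl₀, div_pow, mul_pow, Real.sq_sqrt hNr.le]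
    have : (N : ℝ) * (25 * (2 * (r ^ 2 / (8 ^ 2 * N)))) = 50 / 64 * r ^ 2 := by
      field_simp; norm_num
    rw [this]
    nlinarith [sq_nonneg r]
  set Rb := 4 * R₀ with hRb
  set l₁ := 4 * Rb with hl₁
  have hl₁0 : 0 < l₁ := by positivity
  set l₂ := d / 80 with hl₂
  have hl₂0 : 0 < l₂ := by positivity
  obtain ⟨m, hm, hlump⟩ := hlumps l₀ hl₀0 (by linarith)
  obtain ⟨w, hw, hwt, hwρ, hwr⟩ : ∃ w > 0, w ≤ t₁ / 4 ∧ ρ * (3 * w) ≤ l₀ ^ 2 ∧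
      ρ * w ≤ (r / 32) ^ 2 := by
    refine ⟨min (t₁ / 4) (min (l₀ ^ 2 / (3 * ρ)) ((r / 32) ^ 2 / ρ)), by positivity,
      min_le_left _ _, ?_, ?_⟩
    · have h1 := (min_le_right (t₁ / 4) _).trans
        (min_le_left (l₀ ^ 2 / (3 * ρ)) ((r / 32) ^ 2 / ρ))
      rw [le_div_iff₀ (by positivity)] at h1
      linarith
    · have h1 := (min_le_right (t₁ / 4) _).trans
        (min_le_right (l₀ ^ 2 / (3 * ρ)) ((r / 32) ^ 2 / ρ))
      rw [le_div_iff₀ hρ] at h1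
      linarith
  have hw0 := hw.le
  have hρw0 : 0 ≤ ρ * w := by positivity
  -- mass of the lumps
  set m' := (1 / 8) ^ N * (Real.exp (-rate N bM C (R₀ + r) * (3 * w)) * m) with hm'
  have hm'0 : 0 < m' := by positivity
  -- mass of the slabs
  set K₁ := Rb + Rb + √(N * (25 * (2 * l₁ ^ 2))) with hK₁
  set m₂ := c₁ * m' ^ 2 * (d / 2) * w * Real.exp (-rate N bM C K₁ * w) / l₁ with hm₂
  have hm₂0 : 0 < m₂ := by positivity
  set R' := √(N * (25 * (2 * l₁ ^ 2))) + 3 * Rb with hR'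
  have hR'0 : 0 < R' := by positivity
  set K₂ := Rb + √(N * (25 * (2 * l₂ ^ 2))) with hK₂
  refine ⟨Rb, by positivity, r, hr0, w, hw,
    c₂ * m' * m₂ * (d / 10) / R' ^ (N - 1) * w * Real.exp (-rate N bM C K₂ * w),
    by positivity, by linarith, hwr, ?_⟩
  intro b α T g h t ht
  obtain ⟨hκ1, hκ2⟩ := kap_mem h.hα0 h.hα1
  have ha₀ : 0 < t - 3 * w := by linarith [ht.1]
  have ha₀T : t - 3 * w ∈ Icc 0 T := ⟨ha₀.le, by linarith [ht.2]⟩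
  obtain ⟨x₁, x₂, hx₁, hx₂, hx, hm₁x, hm₂x⟩ := hlump (g (t - 3 * w)) (h.sol.wInt ha₀.le)
    (h.sol.nonneg _ ha₀.le) (h.moment _ ha₀T) (h.integral_eq ha₀T) (h.l2 _ ha₀T)
  -- the lumps persist
  have hpers : ∀ x : Vel N, ‖x‖ ≤ R₀ →
      m ≤ (∫ v in Metric.closedBall x l₀, g (t - 3 * w) v) → ∀ s ∈ Icc (t - 3 * w) t,
      m' ≤ ∫ v in Metric.closedBall x r, g s v := by
    intro x hxR hmx s hs
    refine le_trans ?_ (h.le_setIntegral_closedBall ha₀ hs.1 (hs.2.trans ht.2) hl₀0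
      (le_trans (by gcongr; linarith [hs.2]) hwρ) hl₀' (R := R₀ + r) (by linarith) hmx)
    rw [hm']
    have h1 : 0 ≤ rate N bM C (R₀ + r) := rate_nonneg hbM.le hC.le (by positivity)
    gcongr (1 / 8) ^ N * (Real.exp ?_ * m)
    rw [neg_mul, neg_mul, neg_le_neg_iff]
    gcongr
    linarith [hs.2]
  have hp₁ := hpers x₁ hx₁ hm₁x
  have hp₂ := hpers x₂ hx₂ hm₂x
  have hκ0 : 0 ≤ kap α := by linarith
  set y₀ := x₁ - (2 * kap α ^ 2) • (x₁ - x₂) with hy₀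
  have hy₀R : ‖y₀‖ ≤ 2 * R₀ := by
    have h1 := norm_sub_le x₁ ((2 * kap α ^ 2) • (x₁ - x₂))
    have h2 := norm_sub_le x₁ x₂
    rw [norm_smul, Real.norm_of_nonneg (by positivity)] at h1
    have h3 : 2 * kap α ^ 2 * ‖x₁ - x₂‖ ≤ 1 / 2 * (R₀ + R₀) := by
      gcongr
      · nlinarith
      · linarith
    linarith
  refine ⟨y₀, by linarith, fun s hs => ?_⟩
  have key := hpoint h (a := s - w) (t := s) (l := l₂) (R := K₂) (R' := R') (d := d / 10)
    (m₁ := m') (m₂ := m₂) (U := Metric.ball y₀ r) (by linarith [hs.1, ht.1]) (by linarith)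
    (hs.2.trans ht.2) hl₂0
    (by
      rw [sub_sub_cancel]
      have : l₀ ^ 2 ≤ l₂ ^ 2 := by gcongr; linarith
      linarith) Metric.isOpen_ball hm'0.le hm₂0.le
    (by linarith) (by
      have : 0 ≤ √(N * (25 * (2 * l₁ ^ 2))) := Real.sqrt_nonneg _
      linarith) (fun y hy => ?_) (fun y hy => ?_)
  · rw [sub_sub_cancel] at key
    exact key
  · rw [Metric.mem_ball, dist_eq_norm] at hy
    have h1 := norm_sub_norm_le y y₀
    linarith
  · rw [Metric.mem_ball, dist_eq_norm] at hy
    refine ⟨Metric.closedBall x₁ r, Metric.isClosed_closedBall.measurableSet,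
      fun s' hs' => hp₁ s' ⟨by linarith [hs'.1, hs.1], hs'.2.trans hs.2⟩, fun v hv => ?_⟩
    rw [Metric.mem_closedBall, dist_eq_norm] at hv
    obtain ⟨hD, hqR, hgeo⟩ := first_collision_geometry h.hα0 h.hα1 hr0 hdr hdR hx hx₁ hx₂ hy.le hv
    refine ⟨hD, fun s' hs' η hη hηl => ?_⟩
    set D := ‖y - v‖ with hDdef
    have hD0 : 0 < D := by linarith
    set n := D⁻¹ • (y - v) with hn
    have hn1 : ‖n‖ = 1 := by
      rw [hn, norm_smul, norm_inv, hDdef, norm_norm, inv_mul_cancel₀ hD0.ne']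
    set q := v + (1 / (2 * kap α)) • (y - v) with hq
    have hs'0 : 0 ≤ s' := by linarith [hs'.1, hs.1, ht.1]
    have hball : ∀ x : Vel N, ‖x‖ ≤ R₀ → ∀ v ∈ Metric.closedBall x r, ‖v‖ ≤ Rb := by
      intro x hxR v hv
      rw [Metric.mem_closedBall, dist_eq_norm] at hv
      have := norm_sub_norm_le v x
      linarith
    have hkey := hslab h (a := s' - w) (t := s') (l := l₁) (R₀ := Rb) (R := K₁) (d := d / 2)
      (m := m') (η := η) (S₁ := Metric.closedBall x₁ r) (S₂ := Metric.closedBall x₂ r) (n := n)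
      (q := q) (by linarith [hs'.1, hs.1, ht.1]) (by linarith)
      (hs'.2.trans (hs.2.trans ht.2))
      (by
        rw [sub_sub_cancel]
        have : l₀ ^ 2 ≤ l₁ ^ 2 := by gcongr; linarith
        linarith)
      Metric.isClosed_closedBall.measurableSet Metric.isClosed_closedBall.measurableSet hm'0.le
      (by positivity) hη (by linarith) hn1
      (fun s'' hs'' => hp₁ s'' ⟨by linarith [hs''.1, hs'.1, hs.1],
        hs''.2.trans (hs'.2.trans hs.2)⟩)
      (fun s'' hs'' => hp₂ s'' ⟨by linarith [hs''.1, hs'.1, hs.1],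
        hs''.2.trans (hs'.2.trans hs.2)⟩)
      (hball x₁ hx₁) (hball x₂ hx₂) (by linarith) le_rfl (by linarith) (by linarith)
      (fun v₁ hv₁ w₁ hw₁ => by
        rw [Metric.mem_closedBall, dist_eq_norm] at hv₁ hw₁
        obtain ⟨h1, h2⟩ := hgeo v₁ w₁ hv₁ hw₁
        refine ⟨h1, (abs_real_inner_le_norm n _).trans ?_⟩
        rw [hn1, one_mul]
        exact h2)
    rw [sub_sub_cancel] at hkey
    refine hkey.trans (setIntegral_mono_set (h.sol.wInt hs'0).integrable.integrableOn
      (ae_restrict_of_ae (h.sol.nonneg s' hs'0)) (Eventually.of_forall fun z hz => ?_))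
    obtain ⟨hz1, hz2⟩ := hz
    have hvR := hball x₁ hx₁ v (by rwa [Metric.mem_closedBall, dist_eq_norm])
    refine ⟨?_, ?_⟩
    · have h1 : inner ℝ n (z - q) = inner ℝ n (z - v) - D / (2 * kap α) := by
        have h2 : z - q = (z - v) - (1 / (2 * kap α)) • (y - v) := by rw [hq]; abel
        have h3 : inner ℝ n (y - v) = D := by
          rw [hn, inner_smul_left, real_inner_self_eq_norm_sq, ← hDdef]
          simp only [conj_trivial]
          field_simp
        rw [h2, inner_sub_right, inner_smul_right, h3]
        ring
      rw [← h1]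
      exact hz1
    · have h1 : v - z = (v - q) - (z - q) := by abel
      have h2 := norm_sub_le (v - q) (z - q)
      have h3 := norm_sub_le v q
      rw [← h1] at h2
      have h4 : √(N * (25 * (2 * l₁ ^ 2))) + η ≤ √(N * (25 * (2 * l₁ ^ 2))) + Rb := by
        linarith
      linarith

/-! ### The Gaussian-type tail -/

/-- The balls of radius `√(6/5) ^ n r` exhaust the space and `√(6/5) ^ 8 > 2`, so that `2 ^ n` is at
most of order `|v|⁸` for the first one which contains `v`. -/
lemma exists_ball_two_pow_le {N : ℕ} {X r : ℝ} (hX : 0 < X) (hr : 0 < r) :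
    ∃ M > 0, ∀ x₀ v : Vel N, ‖x₀‖ ≤ X →
      ∃ n : ℕ, v ∈ Metric.ball x₀ (√(6 / 5) ^ n * r) ∧ (2 : ℝ) ^ n ≤ M + M * ‖v‖ ^ 8 := by
  set γ := √(6 / 5 : ℝ) with hγ
  have hγ0 : 0 < γ := Real.sqrt_pos.2 (by norm_num)
  have hγ1 : 1 < γ := by
    rw [hγ, Real.lt_sqrt zero_le_one]; norm_num
  have hγ8 : 2 ≤ γ ^ 8 := by
    have : γ ^ 8 = (γ ^ 2) ^ 4 := by ring
    rw [this, hγ, Real.sq_sqrt (by norm_num)]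
    norm_num
  refine ⟨1 + 256 * (1 + X ^ 8) / r ^ 8, by positivity, fun x₀ v hx₀ => ?_⟩
  have hex : ∃ n : ℕ, ‖v - x₀‖ < γ ^ n * r := by
    obtain ⟨n, hn⟩ := pow_unbounded_of_one_lt (‖v - x₀‖ / r) hγ1
    exact ⟨n, by rwa [div_lt_iff₀ hr] at hn⟩
  classical
  refine ⟨Nat.find hex, ?_, ?_⟩
  · rw [Metric.mem_ball, dist_eq_norm]; exact Nat.find_spec hex
  have hv8 : 0 ≤ ‖v‖ ^ 8 := by positivity
  have hq : 0 ≤ 256 * (1 + X ^ 8) / r ^ 8 := by positivity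
  rcases hn : Nat.find hex with _ | n
  · rw [pow_zero]
    nlinarith [mul_nonneg hq hv8]
  have hmin : γ ^ n * r ≤ ‖v - x₀‖ := by
    by_contra hlt
    push Not at hlt
    have := Nat.find_min' hex hlt
    omega
  have h1 : (2 : ℝ) ^ n * r ^ 8 ≤ 128 * (‖v‖ ^ 8 + X ^ 8) := by
    calc (2 : ℝ) ^ n * r ^ 8 ≤ (γ ^ 8) ^ n * r ^ 8 := by gcongr
      _ = (γ ^ n * r) ^ 8 := by rw [mul_pow, ← pow_mul, ← pow_mul, mul_comm 8 n]
      _ ≤ (‖v‖ + X) ^ 8 := by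
          have h2 : γ ^ n * r ≤ ‖v‖ + X := hmin.trans ((norm_sub_le _ _).trans (by linarith))
          gcongr
      _ ≤ 2 ^ (8 - 1) * (‖v‖ ^ 8 + X ^ 8) := add_pow_le (norm_nonneg _) hX.le 8
      _ = 128 * (‖v‖ ^ 8 + X ^ 8) := by norm_num
  have h2 : (2 : ℝ) ^ n ≤ 128 * (‖v‖ ^ 8 + X ^ 8) / r ^ 8 := by
    rwa [le_div_iff₀ (by positivity)]
  have h3 : 256 * (1 + X ^ 8) / r ^ 8 + 256 * (1 + X ^ 8) / r ^ 8 * ‖v‖ ^ 8 -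
      2 * (128 * (‖v‖ ^ 8 + X ^ 8) / r ^ 8) = 256 * (1 + X ^ 8 * ‖v‖ ^ 8) / r ^ 8 := by
    field_simp; ring
  have h4 : 0 ≤ 256 * (1 + X ^ 8 * ‖v‖ ^ 8) / r ^ 8 := by positivity
  rw [pow_succ]
  linarith

/-- An exponent `2 ^ n ≤ M (1 + x)` turns the iterated lower bound into an exponential in `x`. The
base is replaced by a smaller one in `(0, 1)`, so that only upper bounds on the exponent matter. -/
lemma exists_exp_le_pow {A δ M : ℝ} (hA : 0 < A) (hδ : 0 < δ) (hM : 0 < M) :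
    ∃ a > 0, ∀ (n : ℕ) (x : ℝ), 0 ≤ x → (2 : ℝ) ^ n ≤ M + M * x →
      a⁻¹ * Real.exp (-a * x) ≤ 2 ^ (n + 1) / A * (A * δ / 2) ^ 2 ^ n := by
  set E := min (A * δ / 2) (1 / 2) with hE
  have hE0 : 0 < E := by positivity
  have hE1 : E < 1 := (min_le_right _ _).trans_lt (by norm_num)
  set L := -Real.log E with hL
  have hL0 : 0 < L := neg_pos.2 (Real.log_neg hE0 hE1)
  refine ⟨L * M + Real.exp (L * M) * A / 2, by positivity, fun n x hx hn => ?_⟩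
  set a := L * M + Real.exp (L * M) * A / 2 with ha
  have haL : L * M ≤ a := by rw [ha]; exact le_add_of_nonneg_right (by positivity)
  have h1 : a⁻¹ ≤ 2 / A * Real.exp (-(L * M)) := by
    have h2 : (Real.exp (L * M) * A / 2)⁻¹ = 2 / A * Real.exp (-(L * M)) := by
      rw [Real.exp_neg]; field_simp
    rw [← h2]
    exact inv_anti₀ (by positivity) (by rw [ha]; exact le_add_of_nonneg_left (by positivity))
  calc a⁻¹ * Real.exp (-a * x) ≤ 2 / A * Real.exp (-(L * M)) * Real.exp (-(L * M) * x) := by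
        gcongr
    _ = 2 / A * Real.exp (-(L * (M + M * x))) := by
        rw [mul_assoc, ← Real.exp_add]; congr 2; ring
    _ ≤ 2 / A * Real.exp (-(L * 2 ^ n)) := by gcongr
    _ = 2 / A * E ^ 2 ^ n := by
        have h2 : -(L * 2 ^ n) = ((2 ^ n : ℕ) : ℝ) * Real.log E := by
          rw [hL]; push_cast; ring
        rw [h2, Real.exp_nat_mul, Real.exp_log hE0]
    _ ≤ 2 ^ (n + 1) / A * (A * δ / 2) ^ 2 ^ n := by
        have h2 : (2 : ℝ) ≤ 2 ^ (n + 1) := by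
          rw [pow_succ]; linarith [one_le_pow₀ (one_le_two : (1 : ℝ) ≤ 2) (n := n)]
        gcongr
        exact min_le_left _ _

lemma le_of_ae_le_of_continuousAt {N : ℕ} {f φ : Vel N → ℝ} (h : ∀ᵐ v, φ v ≤ f v)
    {v : Vel N} (hφ : ContinuousAt φ v) (hf : ContinuousAt f v) : φ v ≤ f v := by
  by_contra hlt
  push Not at hlt
  obtain ⟨w, hw1, hw2⟩ := (Measure.dense_of_ae h).inter_nhds_nonempty (hf.eventually_lt hφ hlt)
  exact absurd (show φ w ≤ f w from hw1) (not_le.2 (show f w < φ w from hw2))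

/-- The almost everywhere lower bound, with a constant depending on the cross-section only through
`bm` and `bM`. -/
theorem exists_tail (N : ℕ) (hN : 2 ≤ N) {bm bM ρ C t₁ : ℝ} (hbm : 0 < bm) (hbM : 0 < bM)
    (hρ : 0 < ρ) (hC : 0 < C) (ht₁ : 0 < t₁) :
    ∃ a₁ > 0, ∀ {b : ℝ → ℝ} {α T : ℝ} {g : ℝ → Vel N → ℝ}, Bounded b bm bM ρ C α T g →
      ∀ t ∈ Icc t₁ T, ∀ᵐ v, a₁⁻¹ * Real.exp (-a₁ * ‖v‖ ^ 8) ≤ g t v := by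
  obtain ⟨X, hX, r, hr, w, hw, δ, hδ, hwt, hwr, hball⟩ := exists_first_ball N hN hbm hbM hρ hC ht₁
  obtain ⟨A, hA, hiter⟩ := exists_spread_iterate N hN hbm hbM hC hr hw hX.le hwr
  obtain ⟨M, hM, hcov⟩ := exists_ball_two_pow_le (N := N) hX hr
  obtain ⟨a, ha, hexp⟩ := exists_exp_le_pow hA hδ hM
  refine ⟨a, ha, fun h t ht => ?_⟩
  obtain ⟨x₀, hx₀, hx₀δ⟩ := hball h t ht
  have hall := ae_all_iff.2 fun n => hiter h (hwt.trans_le ht.1) ht.2 hδ.le hx₀ hx₀δ n t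
    ⟨by rw [sub_le_self_iff]; positivity, le_rfl⟩
  filter_upwards [hall] with v hv
  obtain ⟨n, hn, hn2⟩ := hcov x₀ v hx₀
  exact (hexp n _ (by positivity) hn2).trans (hv n hn)

end

end InelasticBoltzmann

theorem propositionD1 (N : ℕ) (hN : 2 ≤ N) (b : ℝ → ℝ)
    (hb : InelasticBoltzmann.IsCrossSection b)
    (ρ C t₁ : ℝ) (hρ : 0 < ρ) (hC : 0 < C) (ht₁ : 0 < t₁) :
    ∃ a₁ : ℝ, 0 < a₁ ∧
      ∀ α : ℝ, 0 < α → α < 1 → ∀ T : ℝ, t₁ < T →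
      ∀ g : ℝ → InelasticBoltzmann.Vel N → ℝ, InelasticBoltzmann.IsSolution α ρ b g →
        (∀ t ∈ Set.Icc 0 T,
          InelasticBoltzmann.weightedNorm 2 0 (g t) ≤ ENNReal.ofReal C ∧
          InelasticBoltzmann.weightedNorm 1 3 (g t) ≤ ENNReal.ofReal C) →
        ∀ t ∈ Set.Icc t₁ T,
          (∀ᵐ v : InelasticBoltzmann.Vel N, a₁⁻¹ * Real.exp (-a₁ * ‖v‖ ^ 8) ≤ g t v) ∧
          (∀ v : InelasticBoltzmann.Vel N, ContinuousAt (g t) v →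
            a₁⁻¹ * Real.exp (-a₁ * ‖v‖ ^ 8) ≤ g t v) := by
  open InelasticBoltzmann in
  obtain ⟨bm, bM, hbm, hbM, hbb⟩ := hb.bounds
  obtain ⟨a, ha, htail⟩ := exists_tail N hN hbm hbM hρ hC ht₁
  refine ⟨a, ha, fun α hα0 hα1 T _ g hg hbound t ht => ?_⟩
  have h : Bounded b bm bM ρ C α T g :=
    { cross := ⟨hb, hbm, hbM, fun x hx => (hbb x hx).1, fun x hx => (hbb x hx).2⟩
      hρ := hρ
      hC := hC
      hα0 := hα0
      hα1 := hα1
      sol := hg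
      moment := fun s hs => (ENNReal.ofReal_le_ofReal_iff hC.le).1
        ((ofReal_integral_wt_le (hg.wInt hs.1)).trans (hbound s hs).2)
      l2 := fun s hs => (hbound s hs).1 }
  have hae := htail h t ht
  exact ⟨hae, fun v hv => le_of_ae_le_of_continuousAt hae (by fun_prop) hv⟩
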